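/- For $\tau$ in the upper half plane let $\wp,\wp',\zeta,\sigma$ be the Weierstrass functions of the lattice $\Lambda=\mathbb Z+\mathbb Z\tau$, with invariants $g_2,g_3$. Put $\omega_1=\frac12$, $\omega_3=\frac\tau2$, $\omega_2=-\omega_1-\omega_3$, $e_i=\wp(\omega_i)$, $\eta_i=\zeta(\omega_i)$ and $c(b)=4b^3-g_2b-g_3$. **(1) Hermite–Krichever formulas and their inversion.** For $b_1\notin\{e_1,e_2,e_3\}$ and $\mu_1\in\mathbb C$ consider the linear equation $$\Big\{-\tfrac{d^2}{dx^2}+\tfrac{\wp'(x)}{\wp(x)-b_1}\tfrac{d}{dx}-\tfrac{\mu_1c(b_1)}{\wp(x)-b_1}+2\wp(x)-p\Big\}f(x)=0,\qquad p=-c(b_1)\mu_1^2+(6b_1^2-\tfrac{g_2}2)\mu_1+2b_1 .$$ Put $N=2c(b_1)\mu_1^3-(12b_1^2-g_2)\mu_1^2+4$ and $$Q=-N\prod_{\{i,j,k\}=\{1,2,3\}}\big(2(b_1^2+e_ib_1+e_je_k)\mu_1-2b_1-e_i\big)$$ (one factor for each $i$), and suppose $Q\ne0$. Call $(\alpha,\kappa)$,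 with $\alpha\notin\Lambda$, a Hermite–Krichever pair for $(b_1,\mu_1)$ if the linear equation has a solution $e^{\kappa x}\{c_0\Phi_0(x,\alpha)+c_1\frac{d}{dx}\Phi_0(x,\alpha)\}$ with $(c_0,c_1)\ne(0,0)$, where $\Phi_0(x,\alpha)=\frac{\sigma(x-\alpha)}{\sigma(x)}e^{\zeta(\alpha)x}$. Then such pairs exist, and $(\alpha,\kappa)$ is such a pair if and only if, for some square root $\sqrt{-Q}$ of $-Q$, $$\wp(\alpha)=\frac{2c(b_1)b_1\mu_1^3+(-24b_1^3+4g_2b_1+3g_3)\mu_1^2+(24b_1^2-2g_2)\mu_1-8b_1}{N},$$ $$\wp'(\alpha)=\frac{-4\big(c(b_1)\mu_1^3-(12b_1^2-g_2)\mu_1^2+12b_1\mu_1-4\big)}{N^2}\sqrt{-Q},\qquad \kappa=\frac{2\mu_1}{N}\sqrt{-Q}.$$ For every such pair (with nonzero denominators) $$b_1=\frac{2\wp(\alpha)\kappa^3-3\wp'(\alpha)\kappa^2+(6\wp(\alpha)^2-g_2)\kappa-\wp(\alpha)\wp'(\alpha)}{2(\kappa^3-3\wp(\alpha)\kappa+\wp'(\alpha))},$$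 $$\mu_1=\frac{2(\kappa^3-3\wp(\alpha)\kappa+\wp'(\alpha))\kappa}{-2\wp'(\alpha)\kappa^3+(12\wp(\alpha)^2-g_2)\kappa^2-6\wp(\alpha)\wp'(\alpha)\kappa+\wp'(\alpha)^2}.$$ **(2) The explicit function.** Let $C_1,C_3\in\mathbb C$ be constants, $\omega=C_1\omega_3-C_3\omega_1$, $\eta=C_1\eta_3-C_3\eta_1$ and $$b_1(\tau)=\frac{2\wp(\omega)(\zeta(\omega)-\eta)^3+3\wp'(\omega)(\zeta(\omega)-\eta)^2+(6\wp(\omega)^2-g_2)(\zeta(\omega)-\eta)+\wp(\omega)\wp'(\omega)}{2\big((\zeta(\omega)-\eta)^3-3\wp(\omega)(\zeta(\omega)-\eta)-\wp'(\omega)\big)} .$$ Call $\tau$ regular if $\omega\notin\Lambda$, the denominator does not vanish and $b_1(\tau)\notin\{e_1,e_2,e_3\}$. For regular $\tau$, $b_1(\tau)$ is the value of the inversion formula of (1) at $\alpha=-\omega$, $\kappa=\zeta(\omega)-\eta$. With $\mu_1$ the value of the other inversion formula there (whose denominator is nonzero), $Q\neq0$ for $(b_1(\tau),\mu_1)$,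 and $(-\omega,\zeta(\omega)-\eta)$ is a Hermite–Krichever pair for $(b_1(\tau),\mu_1)$. **(3) Sixth Painlevé equation.** Near every regular $\tau_0$ there is a continuous function $\delta_1$ of $\tau$ with $\wp(\delta_1)=b_1(\tau)$. Every continuous $\delta_1$ with $\wp(\delta_1)=b_1(\tau)$ on an open set of regular $\tau$ is holomorphic there, satisfies $2\delta_1\notin\Lambda$, and solves the elliptic form of the sixth Painlevé equation $$\frac{d^2\delta}{d\tau^2}=-\frac1{4\pi^2}\Big\{\frac{\kappa_\infty^2}2\wp'(\delta)+\frac{\kappa_0^2}2\wp'\big(\delta+\tfrac12\big)+\frac{\kappa_1^2}2\wp'\big(\delta+\tfrac{\tau+1}2\big)+\frac{\kappa_t^2}2\wp'\big(\delta+\tfrac\tau2\big)\Big\}$$ with $(\kappa_0,\kappa_1,\kappa_t,\kappa_\infty)=(\frac12,\frac12,\frac12,\frac32)$. **(4) Bäcklund transform of Hitchin's solution.** Let $b^H=\wp(\omega)+\frac{\wp'(\omega)}{2(\zeta(\omega)-\eta)}$ (Hitchin's solution), $t=\frac{e_3-e_1}{e_2-e_1}$ and $\lambda^H=\frac{b^H-e_1}{e_2-e_1}$,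 at a $\tau$ with $\omega\notin\Lambda$, $\zeta(\omega)-\eta\ne0$, $b^H\notin\{e_1,e_2,e_3\}$ and nonzero denominator of $b_1(\tau)$. There is exactly one $\mu^H$ with $\frac{d\lambda^H}{dt}=\frac{\partial H_{VI}}{\partial\mu}(\lambda^H,\mu^H)$, i.e. $\frac{d\lambda^H}{d\tau}=\frac{dt}{d\tau}\frac{\partial H_{VI}}{\partial\mu}$, where $$H_{VI}=\frac1{t(t-1)}\Big\{\lambda(\lambda-1)(\lambda-t)\mu^2-\{\kappa_0(\lambda-1)(\lambda-t)+\kappa_1\lambda(\lambda-t)+(\kappa_t-1)\lambda(\lambda-1)\}\mu+\tfrac{(\kappa_0+\kappa_1+\kappa_t-1)^2-\kappa_\infty^2}4(\lambda-t)\Big\}$$ and $(\kappa_0,\kappa_1,\kappa_t,\kappa_\infty)=(\frac12,\frac12,\frac12,\frac12)$. Apply to $(\lambda^H,\mu^H)$ the Bäcklund transformations $(\kappa_0,\mu)\mapsto(-\kappa_0,\mu-\frac{\kappa_0}{\lambda})$, $(\kappa_1,\mu)\mapsto(-\kappa_1,\mu-\frac{\kappa_1}{\lambda-1})$, $(\kappa_t,\mu)\mapsto(-\kappa_t,\mu-\frac{\kappa_t}{\lambda-t})$,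 and then the one that adds $a=\frac12(1-\kappa_0-\kappa_1-\kappa_t-\kappa_\infty)$ to all four parameters and $\frac a\mu$ to $\lambda$ (here $\mu\ne0$). The resulting parameters are $(\frac12,\frac12,\frac12,\frac32)$ and the resulting $\lambda$ is $\frac{b_1(\tau)-e_1}{e_2-e_1}$. -/

import Mathlib

open UpperHalfPlane

noncomputable section

namespace PVI

/-- The pair of periods `(2ω₁, 2ω₃) = (1, τ)`. -/
def periods (τ : ℍ) : PeriodPair where
  ω₁ := 1
  ω₂ := τ
  indep := by
    rw [LinearIndependent.pair_iff]
    intro s t h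
    have him := congrArg Complex.im h
    have hre := congrArg Complex.re h
    simp at him hre
    have ht : t = 0 := by
      rcases him with h0 | h0
      · exact h0
      · exact absurd h0 τ.im_ne_zero
    subst ht
    simpa using hre

/-- The Weierstrass zeta function
`ζ(z) = 1/z + ∑_{l ≠ 0} (1/(z - l) + 1/l + z/l²)`; the summand with `l = 0` is `1/z`,
since `1/0 = 0` in Lean. -/
def zeta (L : PeriodPair) (z : ℂ) : ℂ :=
  ∑' l : L.lattice, (1 / (z - l) + 1 / (l : ℂ) + z / (l : ℂ) ^ 2)

/-- The Weierstrass sigma function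
`σ(z) = z ∏_{l ≠ 0} (1 - z/l) exp(z/l + z²/(2l²))`; the factor with `l = 0` is `1`,
since `z/0 = 0` in Lean. -/
def sigma (L : PeriodPair) (z : ℂ) : ℂ :=
  z * ∏' l : L.lattice, ((1 - z / (l : ℂ)) * Complex.exp (z / (l : ℂ) + (z / (l : ℂ)) ^ 2 / 2))

/-! ### Half periods `ω₁ = 1/2`, `ω₃ = τ/2`, `ω₂ = -ω₁ - ω₃` and the values at them -/

def e1 (τ : ℍ) : ℂ := (periods τ).weierstrassP (1 / 2)

def e2 (τ : ℍ) : ℂ := (periods τ).weierstrassP (-(1 / 2) - τ / 2)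

def e3 (τ : ℍ) : ℂ := (periods τ).weierstrassP (τ / 2)

def eta1 (τ : ℍ) : ℂ := zeta (periods τ) (1 / 2)

def eta3 (τ : ℍ) : ℂ := zeta (periods τ) (τ / 2)

/-- `4 b³ - g₂ b - g₃` -/
def cubic (τ : ℍ) (b : ℂ) : ℂ := 4 * b ^ 3 - (periods τ).g₂ * b - (periods τ).g₃

/-! ### The linear equation with `l₀ = 1`, `l₁ = l₂ = l₃ = 0` and its Hermite-Krichever solutions -/

/-- `Φ₀(x, α) = σ(x - α) / σ(x) * exp(ζ(α) x)` -/
def Phi0 (τ : ℍ) (α x : ℂ) : ℂ :=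
  sigma (periods τ) (x - α) / sigma (periods τ) x * Complex.exp (zeta (periods τ) α * x)

/-- The value of `p` for which the singularities `℘(x) = b` are apparent. -/
def apparentP (τ : ℍ) (b μ : ℂ) : ℂ :=
  -cubic τ b * μ ^ 2 + (6 * b ^ 2 - (periods τ).g₂ / 2) * μ + 2 * b

/-- `f` satisfies the linear differential equation
`-f'' + ℘'/(℘ - b) f' + (-μ (4b³ - g₂ b - g₃)/(℘ - b) + 2℘ - p) f = 0`
away from its singular points, with `p` such that the points `℘(x) = b` are apparent. -/
def SolvesLinear (τ : ℍ) (b μ : ℂ) (f : ℂ → ℂ) : Prop :=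
  ∀ x : ℂ, x ∉ (periods τ).lattice → (periods τ).weierstrassP x ≠ b →
    -deriv (deriv f) x
      + (periods τ).derivWeierstrassP x / ((periods τ).weierstrassP x - b) * deriv f x
      + (-(μ * cubic τ b) / ((periods τ).weierstrassP x - b)
          + 2 * (periods τ).weierstrassP x - apparentP τ b μ) * f x = 0

/-- The linear equation has a nonzero solution
`exp(κ x) (c₀ Φ₀(x, α) + c₁ (d/dx) Φ₀(x, α))`. -/
def IsHermiteKrichever (τ : ℍ) (b μ α κ : ℂ) : Prop :=
  ∃ c₀ c₁ : ℂ, (c₀ ≠ 0 ∨ c₁ ≠ 0) ∧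
    SolvesLinear τ b μ
      (fun x => Complex.exp (κ * x) * (c₀ * Phi0 τ α x + c₁ * deriv (Phi0 τ α) x))

/-- `2 (4b³ - g₂ b - g₃) μ³ - (12 b² - g₂) μ² + 4` -/
def hkDen (τ : ℍ) (b μ : ℂ) : ℂ :=
  2 * cubic τ b * μ ^ 3 - (12 * b ^ 2 - (periods τ).g₂) * μ ^ 2 + 4

def hkQ (τ : ℍ) (b μ : ℂ) : ℂ :=
  -(hkDen τ b μ
    * (2 * (b ^ 2 + e1 τ * b + e2 τ * e3 τ) * μ - 2 * b - e1 τ)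
    * (2 * (b ^ 2 + e2 τ * b + e1 τ * e3 τ) * μ - 2 * b - e2 τ)
    * (2 * (b ^ 2 + e3 τ * b + e1 τ * e2 τ) * μ - 2 * b - e3 τ))

/-- The formulas for `℘(α)`, `℘'(α)`, `κ` in terms of `b`, `μ` and a square root `s` of `-Q`. -/
def HKFormulas (τ : ℍ) (b μ s α κ : ℂ) : Prop :=
  (periods τ).weierstrassP α =
      (2 * cubic τ b * b * μ ^ 3
        + (-24 * b ^ 3 + 4 * (periods τ).g₂ * b + 3 * (periods τ).g₃) * μ ^ 2
        + (24 * b ^ 2 - 2 * (periods τ).g₂) * μ - 8 * b) / hkDen τ b μ ∧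
    (periods τ).derivWeierstrassP α =
      -4 * (cubic τ b * μ ^ 3 - (12 * b ^ 2 - (periods τ).g₂) * μ ^ 2 + 12 * b * μ - 4)
        / hkDen τ b μ ^ 2 * s ∧
    κ = 2 * μ / hkDen τ b μ * s

/-- `κ³ - 3 ℘(α) κ + ℘'(α)` -/
def invDenB (τ : ℍ) (α κ : ℂ) : ℂ :=
  κ ^ 3 - 3 * (periods τ).weierstrassP α * κ + (periods τ).derivWeierstrassP α

/-- `-2 ℘'(α) κ³ + (12 ℘(α)² - g₂) κ² - 6 ℘(α) ℘'(α) κ + ℘'(α)²` -/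
def invDenMu (τ : ℍ) (α κ : ℂ) : ℂ :=
  -2 * (periods τ).derivWeierstrassP α * κ ^ 3
    + (12 * (periods τ).weierstrassP α ^ 2 - (periods τ).g₂) * κ ^ 2
    - 6 * (periods τ).weierstrassP α * (periods τ).derivWeierstrassP α * κ
    + (periods τ).derivWeierstrassP α ^ 2

/-- The expression of `b` through `α` and `κ`. -/
def invB (τ : ℍ) (α κ : ℂ) : ℂ :=
  (2 * (periods τ).weierstrassP α * κ ^ 3 - 3 * (periods τ).derivWeierstrassP α * κ ^ 2
    + (6 * (periods τ).weierstrassP α ^ 2 - (periods τ).g₂) * κ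
    - (periods τ).weierstrassP α * (periods τ).derivWeierstrassP α) / (2 * invDenB τ α κ)

/-- The expression of `μ` through `α` and `κ`. -/
def invMu (τ : ℍ) (α κ : ℂ) : ℂ := 2 * invDenB τ α κ * κ / invDenMu τ α κ

/-! ### The explicit solution -/

/-- `ω = C₁ ω₃ - C₃ ω₁` -/
def om (C₁ C₃ : ℂ) (τ : ℍ) : ℂ := C₁ * (τ / 2) - C₃ * (1 / 2)

/-- `ζ(ω) - η`, where `η = C₁ η₃ - C₃ η₁` -/
def zetaSubEta (C₁ C₃ : ℂ) (τ : ℍ) : ℂ :=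
  zeta (periods τ) (om C₁ C₃ τ) - (C₁ * eta3 τ - C₃ * eta1 τ)

/-- `(ζ(ω) - η)³ - 3 ℘(ω) (ζ(ω) - η) - ℘'(ω)` -/
def solDen (C₁ C₃ : ℂ) (τ : ℍ) : ℂ :=
  zetaSubEta C₁ C₃ τ ^ 3
    - 3 * (periods τ).weierstrassP (om C₁ C₃ τ) * zetaSubEta C₁ C₃ τ
    - (periods τ).derivWeierstrassP (om C₁ C₃ τ)

/-- The explicit function `b₁` of `τ`. -/
def solB (C₁ C₃ : ℂ) (τ : ℍ) : ℂ :=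
  (2 * (periods τ).weierstrassP (om C₁ C₃ τ) * zetaSubEta C₁ C₃ τ ^ 3
    + 3 * (periods τ).derivWeierstrassP (om C₁ C₃ τ) * zetaSubEta C₁ C₃ τ ^ 2
    + (6 * (periods τ).weierstrassP (om C₁ C₃ τ) ^ 2 - (periods τ).g₂) * zetaSubEta C₁ C₃ τ
    + (periods τ).weierstrassP (om C₁ C₃ τ) * (periods τ).derivWeierstrassP (om C₁ C₃ τ))
    / (2 * solDen C₁ C₃ τ)

/-- `b` is none of `e₁, e₂, e₃`. -/
def NotBranchValue (τ : ℍ) (b : ℂ) : Prop := b ≠ e1 τ ∧ b ≠ e2 τ ∧ b ≠ e3 τ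

/-- The explicit `b₁` is defined at `τ` and differs from `e₁, e₂, e₃` there. -/
def SolRegular (C₁ C₃ : ℂ) (τ : ℍ) : Prop :=
  om C₁ C₃ τ ∉ (periods τ).lattice ∧ solDen C₁ C₃ τ ≠ 0 ∧ NotBranchValue τ (solB C₁ C₃ τ)

/-- `δ` is a continuous branch, on an open subset `U` of the upper half plane,
of the solutions of `℘(δ) = b₁`. -/
def IsDelta (C₁ C₃ : ℂ) (U : Set ℂ) (δ : ℂ → ℂ) : Prop :=
  IsOpen U ∧ (∀ z ∈ U, 0 < z.im) ∧ ContinuousOn δ U ∧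
    ∀ τ : ℍ, (τ : ℂ) ∈ U → SolRegular C₁ C₃ τ ∧ δ τ ∉ (periods τ).lattice ∧
      (periods τ).weierstrassP (δ τ) = solB C₁ C₃ τ

/-- `δ` is a holomorphic solution on `U` of the sixth Painlevé equation in elliptic form with
parameters `(κ₀, κ₁, κₜ, κ_∞)`; the condition on `2 δ` says that no term on the right-hand side
has a pole. -/
def SolvesEllipticPVI (k0 k1 kt kinf : ℂ) (U : Set ℂ) (δ : ℂ → ℂ) : Prop :=
  DifferentiableOn ℂ δ U ∧ ∀ τ : ℍ, (τ : ℂ) ∈ U →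
    2 * δ τ ∉ (periods τ).lattice ∧
    deriv (deriv δ) τ = -(1 / (4 * (Real.pi : ℂ) ^ 2)) *
      (kinf ^ 2 / 2 * (periods τ).derivWeierstrassP (δ τ)
        + k0 ^ 2 / 2 * (periods τ).derivWeierstrassP (δ τ + 1 / 2)
        + k1 ^ 2 / 2 * (periods τ).derivWeierstrassP (δ τ + (τ + 1) / 2)
        + kt ^ 2 / 2 * (periods τ).derivWeierstrassP (δ τ + τ / 2))

/-! ### The sixth Painlevé system and its Bäcklund transformations -/

/-- Parameters, independent variable `t`, and canonical variables `(λ, μ)`. -/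
structure Point where
  k0 : ℂ
  k1 : ℂ
  kt : ℂ
  kinf : ℂ
  t : ℂ
  lam : ℂ
  mu : ℂ

/-- The Hamiltonian of the sixth Painlevé system. -/
def hamiltonian (P : Point) : ℂ :=
  1 / (P.t * (P.t - 1)) *
    (P.lam * (P.lam - 1) * (P.lam - P.t) * P.mu ^ 2
      - (P.k0 * (P.lam - 1) * (P.lam - P.t) + P.k1 * P.lam * (P.lam - P.t)
          + (P.kt - 1) * P.lam * (P.lam - 1)) * P.mu
      + ((P.k0 + P.k1 + P.kt - 1) ^ 2 - P.kinf ^ 2) / 4 * (P.lam - P.t))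

/-- The Bäcklund transformation that reverses the sign of `κ₀`. -/
def Point.flip0 (P : Point) : Point :=
  { P with k0 := -P.k0, mu := P.mu - P.k0 / P.lam }

/-- The Bäcklund transformation that reverses the sign of `κ₁`. -/
def Point.flip1 (P : Point) : Point :=
  { P with k1 := -P.k1, mu := P.mu - P.k1 / (P.lam - 1) }

/-- The Bäcklund transformation that reverses the sign of `κₜ`. -/
def Point.flipt (P : Point) : Point :=
  { P with kt := -P.kt, mu := P.mu - P.kt / (P.lam - P.t) }

/-- `(1 - κ₀ - κ₁ - κₜ - κ_∞) / 2` -/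
def Point.a (P : Point) : ℂ := (1 - P.k0 - P.k1 - P.kt - P.kinf) / 2

/-- Okamoto's Bäcklund transformation: with `a = (1 - κ₀ - κ₁ - κₜ - κ_∞) / 2`, it adds `a` to
each parameter and `a / μ` to `λ`. -/
def Point.okamoto (P : Point) : Point :=
  { P with
    k0 := P.k0 + P.a
    k1 := P.k1 + P.a
    kt := P.kt + P.a
    kinf := P.kinf + P.a
    lam := P.lam + P.a / P.mu }

/-- The composite of the three sign changes and Okamoto's transformation. -/
def Point.backlund (P : Point) : Point := P.flip0.flip1.flipt.okamoto

/-- `t = (e₃ - e₁) / (e₂ - e₁)` -/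
def modT (τ : ℍ) : ℂ := (e3 τ - e1 τ) / (e2 τ - e1 τ)

/-- `λ = (b - e₁) / (e₂ - e₁)` -/
def lamOf (τ : ℍ) (b : ℂ) : ℂ := (b - e1 τ) / (e2 τ - e1 τ)

/-- Hitchin's solution `b = ℘(ω) + ℘'(ω) / (2 (ζ(ω) - η))`. -/
def hitchinB (C₁ C₃ : ℂ) (τ : ℍ) : ℂ :=
  (periods τ).weierstrassP (om C₁ C₃ τ)
    + (periods τ).derivWeierstrassP (om C₁ C₃ τ) / (2 * zetaSubEta C₁ C₃ τ)

/-- Hitchin's solution is defined at `τ` and differs from `e₁, e₂, e₃` there. -/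
def HitchinRegular (C₁ C₃ : ℂ) (τ : ℍ) : Prop :=
  om C₁ C₃ τ ∉ (periods τ).lattice ∧ zetaSubEta C₁ C₃ τ ≠ 0 ∧
    NotBranchValue τ (hitchinB C₁ C₃ τ)

/-- Hitchin's solution as a point `(λ, μ)` of the Painlevé system with all parameters `1/2`. -/
def hitchinPoint (C₁ C₃ : ℂ) (τ : ℍ) (m : ℂ) : Point :=
  ⟨1 / 2, 1 / 2, 1 / 2, 1 / 2, modT τ, lamOf τ (hitchinB C₁ C₃ τ), m⟩

/-- `m` is the value at `τ` of the variable conjugate to Hitchin's solution: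
`dλ/dτ = dt/dτ * ∂H/∂μ`, which is the first Hamilton equation `dλ/dt = ∂H/∂μ` written in `τ`. -/
def IsHitchinMomentum (C₁ C₃ : ℂ) (τ : ℍ) (m : ℂ) : Prop :=
  deriv (fun z : ℂ => lamOf (ofComplex z) (hitchinB C₁ C₃ (ofComplex z))) τ =
    deriv (fun z : ℂ => modT (ofComplex z)) τ *
      deriv (fun m' => hamiltonian (hitchinPoint C₁ C₃ τ m')) m

end PVI

end

noncomputable section

namespace PVI

open Filter Topology PeriodPair

/-! ### The Weierstrass zeta function -/

section

variable (L : PeriodPair)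

/-! Hermite–Krichever formulas. `Phi0` satisfies the Lamé equation Φ'' = (2℘ + ℘(α))Φ
(`deriv_deriv_Phi0`), so the ansatz and its derivatives stay in the span of Φ₀ and Φ₀' over
polynomials in ℘, ℘'. The addition theorem writes Φ₀'/Φ₀ as a rational function of ℘(x) and ℘'(x).
The linear equation then becomes a polynomial identity in ℘(x), ℘'(x); its parts even and odd in x
give c₀ = κc₁ and three algebraic equations, `HKCond`, for A = ℘(α), A' = ℘'(α) and κ
(`isHermiteKrichever_iff`). Together with the Weierstrass cubic these force a linear equation for A,
and the remaining freedom is a square root s of -Q (`formulas_of_hkCond`). On the solutions κ³ - 3Aκ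
+ A' equals s, which is nonzero, and this yields the inversion (`inversion_of_formulas`). At α = -ω,
κ = ζ(ω) - η the conditions hold as rational identities and -Q is the square of the denominator of
the explicit function (`hkCond_of_inversion`).

Painlevé equation. The odd theta function satisfies the heat equation 4πi ∂θ/∂τ = ∂²θ/∂z². By
Liouville and the Legendre relation it is a constant times σ(z)exp(-η₁z²), so its z-derivatives
divided by θ are polynomials in ψ = ζ - 2η₁z, ℘ + 2η₁, ℘' and g₂. This gives the τ-derivatives of ℘,
℘' and ψ along any curve z = γ(τ), with γ' entering only through ψ + 2πiγ'. For γ = ω that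
combination is exactly ζ(ω) - η (`zetaSubEta_eq`), so ℘(ω), ℘'(ω), ζ(ω) - η, together with η₁ and
g₂, obey a closed system of differential equations. Hence (b₁, μ₁) satisfies a first order system in
which ω no longer occurs (`hasDerivAt_solB`, `hasDerivAt_solMu`). Comparing the derivatives of ℘(δ)
and b₁ gives (ψ(δ) + 2πiδ')℘'(δ) as a polynomial in b₁, μ₁, g₂, g₃. One more differentiation gives
δ'', and the equation reduces to a rational identity in the differences b₁ - eᵢ (`pvi_identity`).
Existence and holomorphy of δ come from the implicit function theorem applied to theta functions
(`exists_branch`).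

Bäcklund transform. The first Hamilton equation is linear in the momentum. After the three sign
changes its solution becomes 2(e₂ - e₁)Zd/M, where Z = ζ(ω) - η and d, M are the denominators of b₁
and μ₁. Since b₁ - b^H = M/(2Zd), Okamoto's shift with a = 1 gives b₁. -/

theorem summable_norm_rpow_neg_three :
    Summable fun l : L.lattice => ‖(l : ℂ)‖ ^ (-3 : ℝ) :=
  ZLattice.summable_norm_rpow _ _ (by simp; norm_num)

theorem zeta_term_eq {z l : ℂ} (hl : l ≠ 0) (hz : z ≠ l) :
    1 / (z - l) + 1 / l + z / l ^ 2 = z ^ 2 / (l ^ 2 * (z - l)) := by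
  have : z - l ≠ 0 := sub_ne_zero.mpr hz
  field_simp
  ring

/-- The two correction terms reduce the summand to order |l|⁻³; the factor 2 comes from |z - l| ≥
|l|/2. -/
theorem zeta_term_bound {r : ℝ} {z : ℂ} (hz : ‖z‖ < r) {l : ℂ} (h : 2 * r ≤ ‖l‖) :
    ‖1 / (z - l) + 1 / l + z / l ^ 2‖ ≤ 2 * r ^ 2 * ‖l‖ ^ (-3 : ℝ) := by
  have hr : 0 < r := (norm_nonneg z).trans_lt hz
  have hl : 0 < ‖l‖ := by linarith
  have hzl : z ≠ l := by rintro rfl; linarith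
  rw [zeta_term_eq (norm_pos_iff.mp hl) hzl]
  have h1 : ‖l‖ / 2 ≤ ‖z - l‖ := by
    rw [norm_sub_rev]
    exact .trans (by linarith) (norm_sub_norm_le l z)
  have h2 : ‖l‖ ^ (-3 : ℝ) = (‖l‖ ^ 3)⁻¹ := by
    rw [Real.rpow_neg hl.le]; norm_cast
  rw [h2, norm_div, norm_mul, norm_pow, norm_pow]
  calc ‖z‖ ^ 2 / (‖l‖ ^ 2 * ‖z - l‖) ≤ r ^ 2 / (‖l‖ ^ 2 * (‖l‖ / 2)) := by gcongr
    _ = _ := by field_simp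

/-- The zeta function without its term `1/z`. -/
def zetaReg (z : ℂ) : ℂ :=
  ∑' l : L.lattice, if (l : ℂ) = 0 then 0 else (1 / (z - l) + 1 / (l : ℂ) + z / (l : ℂ) ^ 2)

theorem hasSumLocallyUniformly_zetaReg :
    HasSumLocallyUniformly (fun (l : L.lattice) (z : ℂ) =>
      if (l : ℂ) = 0 then 0 else (1 / (z - l) + 1 / (l : ℂ) + z / (l : ℂ) ^ 2)) (zetaReg L) := by
  refine L.hasSumLocallyUniformly_aux (u := fun r l => 2 * r ^ 2 * ‖(l : ℂ)‖ ^ (-3 : ℝ)) _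
    (fun r _ => (summable_norm_rpow_neg_three L).mul_left _) fun r hr =>
    Filter.eventually_atTop.mpr ⟨2 * r, ?_⟩
  rintro _ h s hs l rfl
  split_ifs
  · simpa using by positivity
  · exact zeta_term_bound hs h

theorem hasSum_zetaReg (z : ℂ) : HasSum (fun l : L.lattice =>
    if (l : ℂ) = 0 then 0 else (1 / (z - l) + 1 / (l : ℂ) + z / (l : ℂ) ^ 2)) (zetaReg L z) :=
  (hasSumLocallyUniformly_zetaReg L).hasSum

theorem zeta_eq_zetaReg_add (z : ℂ) : zeta L z = zetaReg L z + 1 / z := by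
  have h1 : HasSum (fun l : L.lattice => if l = 0 then 1 / z else 0) (1 / z) :=
    hasSum_ite_eq 0 (1 / z)
  rw [zeta, ← ((hasSum_zetaReg L z).add h1).tsum_eq]
  congr 1
  ext l
  by_cases h : l = 0
  · subst h; simp
  · simp [h]

/-- The condition `z ∈ L.lattice → z = 0` still allows the origin, where ζ(z) - 1/z and σ(z)/z are
regular; the local analysis at the pole needs this point. -/
theorem mem_regSet {z : ℂ} : z ∈ ((L.lattice : Set ℂ) \ {0})ᶜ ↔ (z ∈ L.lattice → z = 0) := by
  simp

theorem hasDerivAt_zeta_term {l z : ℂ} (hz : z ≠ l) :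
    HasDerivAt (fun z : ℂ => 1 / (z - l) + 1 / l + z / l ^ 2)
      (-(1 / (z - l) ^ 2 - 1 / l ^ 2)) z := by
  have h := ((((hasDerivAt_id z).sub_const l).inv (sub_ne_zero.mpr hz)).add_const (1 / l)).add
    ((hasDerivAt_id z).div_const (l ^ 2))
  convert! h using 1
  · ext w; simp
  · simp; ring

theorem differentiableOn_zetaReg :
    DifferentiableOn ℂ (zetaReg L) ((L.lattice : Set ℂ) \ {0})ᶜ := by
  refine (hasSumLocallyUniformly_zetaReg L).hasSumLocallyUniformlyOn.differentiableOn
    (.of_forall fun s => .fun_sum fun i hi => ?_) L.isOpen_compl_lattice_sdiff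
  split_ifs with h
  · simp
  · intro z hz
    refine (hasDerivAt_zeta_term ?_).differentiableAt.differentiableWithinAt
    rintro rfl
    exact h ((mem_regSet L).mp hz i.2)

theorem deriv_zetaReg {z : ℂ} (hz : z ∈ L.lattice → z = 0) :
    deriv (zetaReg L) z = -L.weierstrassPExcept 0 z := by
  have key : Set.EqOn (deriv (zetaReg L)) (fun z => -L.weierstrassPExcept 0 z)
      ((L.lattice : Set ℂ) \ {0})ᶜ := by
    refine ((hasSumLocallyUniformly_zetaReg L).tendstoLocallyUniformlyOn.deriv
      (.of_forall fun s => ?_) L.isOpen_compl_lattice_sdiff).unique ?_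
    · refine .fun_sum fun i hi => ?_
      split_ifs with h
      · simp
      · intro z hz
        refine (hasDerivAt_zeta_term ?_).differentiableAt.differentiableWithinAt
        rintro rfl
        exact h ((mem_regSet L).mp hz i.2)
    · refine (L.hasSumLocallyUniformly_weierstrassPExcept 0).tendstoLocallyUniformlyOn.neg.congr ?_
      intro s z hz
      have hd : ∀ i ∈ s, HasDerivAt (fun z : ℂ => if (i : ℂ) = 0 then 0 else
          (1 / (z - i) + 1 / (i : ℂ) + z / (i : ℂ) ^ 2))
          (-(if (i : ℂ) = 0 then 0 else (1 / (z - i) ^ 2 - 1 / (i : ℂ) ^ 2))) z := by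
        intro i _
        split_ifs with h
        · simpa using hasDerivAt_const z (0 : ℂ)
        · refine hasDerivAt_zeta_term ?_
          rintro rfl
          exact h ((mem_regSet L).mp hz i.2)
      have := HasDerivAt.fun_sum hd
      simp only [Function.comp_apply, Pi.neg_apply]
      rw [this.deriv, Finset.sum_neg_distrib]
  exact key ((mem_regSet L).mpr hz)

theorem analyticAt_zetaReg {z : ℂ} (hz : z ∈ L.lattice → z = 0) : AnalyticAt ℂ (zetaReg L) z :=
  (differentiableOn_zetaReg L).analyticAt
    (L.isOpen_compl_lattice_sdiff.mem_nhds ((mem_regSet L).mpr hz))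

theorem hasDerivAt_zeta {z : ℂ} (hz : z ∉ L.lattice) :
    HasDerivAt (zeta L) (-L.weierstrassP z) z := by
  have hz0 : z ≠ 0 := by rintro rfl; exact hz (zero_mem _)
  have h1 : HasDerivAt (zetaReg L) (-L.weierstrassPExcept 0 z) z := by
    rw [← deriv_zetaReg L (fun h => absurd h hz)]
    exact (analyticAt_zetaReg L (fun h => absurd h hz)).differentiableAt.hasDerivAt
  have h2 := h1.add (hasDerivAt_inv hz0)
  have h3 := L.weierstrassPExcept_add 0 z
  convert! h2 using 1
  · ext w; rw [zeta_eq_zetaReg_add]; simp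
  · rw [← h3]; simp; ring

theorem zeta_neg (z : ℂ) : zeta L (-z) = -zeta L z := by
  rw [zeta, ← (Equiv.neg L.lattice).tsum_eq, zeta, ← tsum_neg]
  congr 1
  ext l
  simp only [Equiv.neg_apply, NegMemClass.coe_neg]
  rw [show -z - -(l : ℂ) = -(z - l) by ring, div_neg, div_neg]
  ring

theorem isOpen_compl_lattice : IsOpen ((L.lattice : Set ℂ)ᶜ) := L.isClosed_lattice.isOpen_compl

theorem eventually_notMem_lattice {z : ℂ} (hz : z ∉ L.lattice) : ∀ᶠ w in 𝓝 z, w ∉ L.lattice :=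
  (isOpen_compl_lattice L).mem_nhds hz

theorem eventually_nhdsNE_notMem_lattice (z : ℂ) : ∀ᶠ w in 𝓝[≠] z, w ∉ L.lattice := by
  have := L.compl_lattice_sdiff_singleton_mem_nhds z
  filter_upwards [mem_nhdsWithin_of_mem_nhds this, self_mem_nhdsWithin] with w hw hw' h
  simp_all

theorem analyticAt_weierstrassP {z : ℂ} (hz : z ∉ L.lattice) : AnalyticAt ℂ L.weierstrassP z :=
  L.analyticOnNhd_weierstrassP z hz

theorem analyticAt_derivWeierstrassP {z : ℂ} (hz : z ∉ L.lattice) :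
    AnalyticAt ℂ L.derivWeierstrassP z :=
  L.analyticOnNhd_derivWeierstrassP z hz

theorem hasDerivAt_weierstrassP {z : ℂ} (hz : z ∉ L.lattice) :
    HasDerivAt L.weierstrassP (L.derivWeierstrassP z) z := by
  rw [← L.deriv_weierstrassP]
  exact (analyticAt_weierstrassP L hz).differentiableAt.hasDerivAt

/-! ### The Weierstrass sigma function -/

/-- The elementary factor `(1 - u) exp(u + u² / 2)`. -/
def elemFactor (u : ℂ) : ℂ := (1 - u) * Complex.exp (u + u ^ 2 / 2)

theorem hasDerivAt_elemFactor (u : ℂ) :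
    HasDerivAt elemFactor (-u ^ 2 * Complex.exp (u + u ^ 2 / 2)) u := by
  have h1 : HasDerivAt (fun u : ℂ => 1 - u) (-1) u := by
    simpa using (hasDerivAt_id u).const_sub 1
  have h2 : HasDerivAt (fun u : ℂ => u + u ^ 2 / 2) (1 + u) u := by
    convert! (hasDerivAt_id u).add (((hasDerivAt_id u).pow 2).div_const 2) using 1
    simp
  convert! h1.mul h2.cexp using 1
  ring

/-- The exponential cancels the Taylor terms of order one and two, leaving the derivative -u² exp(u
+ u²/2). The mean value inequality on the ball of radius |u| then gives a cubic bound. -/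
theorem norm_elemFactor_sub_one_le {u : ℂ} (hu : ‖u‖ ≤ 1) :
    ‖elemFactor u - 1‖ ≤ Real.exp 2 * ‖u‖ ^ 3 := by
  have h := Convex.norm_image_sub_le_of_norm_deriv_le (f := elemFactor)
    (s := Metric.closedBall 0 ‖u‖) (x := 0) (y := u) (C := Real.exp 2 * ‖u‖ ^ 2)
    (fun x _ => (hasDerivAt_elemFactor x).differentiableAt) ?_ (convex_closedBall _ _)
    (by simp) (by simp)
  · simp only [elemFactor, sub_zero] at h ⊢
    simp only [ne_eq, OfNat.ofNat_ne_zero, not_false_eq_true, zero_pow, zero_div, add_zero,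
      Complex.exp_zero, mul_one] at h
    exact h.trans (le_of_eq (by ring))
  · intro x hx
    have hx' : ‖x‖ ≤ ‖u‖ := by simpa using hx
    rw [(hasDerivAt_elemFactor x).deriv, norm_mul, norm_neg, norm_pow, mul_comm]
    gcongr
    refine (Complex.norm_exp_le_exp_norm _).trans (Real.exp_le_exp.mpr ?_)
    have : ‖x‖ ≤ 1 := hx'.trans hu
    calc ‖x + x ^ 2 / 2‖ ≤ ‖x‖ + ‖x ^ 2 / 2‖ := norm_add_le _ _
      _ = ‖x‖ + ‖x‖ ^ 2 / 2 := by simp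
      _ ≤ 2 := by nlinarith [norm_nonneg x]

/-- The entire function `σ(z)/z`. -/
def sigmaReg (z : ℂ) : ℂ := ∏' l : L.lattice, elemFactor (z / l)

theorem sigma_eq (z : ℂ) : sigma L z = z * sigmaReg L z := rfl

theorem norm_elemFactor_div_le {r : ℝ} {z l : ℂ} (hz : ‖z‖ ≤ r) (hr : 0 < r) (h : r ≤ ‖l‖) :
    ‖elemFactor (z / l) - 1‖ ≤ Real.exp 2 * r ^ 3 * ‖l‖ ^ (-3 : ℝ) := by
  have hl : 0 < ‖l‖ := by linarith
  have h2 : ‖l‖ ^ (-3 : ℝ) = (‖l‖ ^ 3)⁻¹ := by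
    rw [Real.rpow_neg hl.le]; norm_cast
  have hu : ‖z / l‖ ≤ 1 := by
    rw [norm_div]; exact (div_le_one hl).mpr (hz.trans h)
  refine (norm_elemFactor_sub_one_le hu).trans ?_
  rw [h2, norm_div, div_pow, mul_assoc]
  gcongr
  rw [div_eq_mul_inv]
  gcongr

theorem eventually_norm_elemFactor_le {r : ℝ} (hr : 0 < r) :
    ∀ᶠ l : L.lattice in cofinite, ∀ z ∈ Metric.ball (0 : ℂ) r,
      ‖elemFactor (z / l) - 1‖ ≤ Real.exp 2 * r ^ 3 * ‖(l : ℂ)‖ ^ (-3 : ℝ) := by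
  rw [Filter.eventually_cofinite]
  refine (isCompact_iff_finite.mp (isCompact_closedBall (0 : L.lattice) r)).subset ?_
  intro l hl
  simp only [Metric.mem_closedBall, dist_zero_right]
  by_contra hlt
  refine hl fun z hz => norm_elemFactor_div_le ?_ hr (not_le.mp hlt).le
  simpa using (Metric.mem_ball.mp hz).le

theorem continuous_elemFactor : Continuous elemFactor :=
  continuous_iff_continuousAt.mpr fun u => (hasDerivAt_elemFactor u).continuousAt

theorem hasProdLocallyUniformlyOn_sigmaReg {r : ℝ} (hr : 0 < r) :
    HasProdLocallyUniformlyOn (fun (l : L.lattice) (z : ℂ) => elemFactor (z / l)) (sigmaReg L)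
      (Metric.ball 0 r) := by
  have h := Summable.hasProdLocallyUniformlyOn_one_add (Metric.isOpen_ball (x := (0 : ℂ)) (ε := r))
    ((summable_norm_rpow_neg_three L).mul_left (Real.exp 2 * r ^ 3))
    (eventually_norm_elemFactor_le L hr)
    (fun l => ((continuous_elemFactor.comp (continuous_id.div_const _)).sub
      continuous_const).continuousOn)
  simp only [add_sub_cancel] at h
  exact h

theorem differentiable_sigmaReg : Differentiable ℂ (sigmaReg L) := by
  intro z
  have hr : 0 < ‖z‖ + 1 := by positivity
  have h := (hasProdLocallyUniformlyOn_sigmaReg L hr).differentiableOn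
    (.of_forall fun s => by
      simpa [Finset.prod_fn] using DifferentiableOn.finsetProd (fun l _ => by
        intro w _
        exact ((hasDerivAt_elemFactor _).comp w
          ((hasDerivAt_id w).div_const _)).differentiableAt.differentiableWithinAt))
    Metric.isOpen_ball
  exact h.differentiableAt (Metric.isOpen_ball.mem_nhds (by simp))

theorem differentiable_sigma : Differentiable ℂ (sigma L) :=
  differentiable_id.mul (differentiable_sigmaReg L)

theorem summable_norm_elemFactor (z : ℂ) :
    Summable fun l : L.lattice => ‖elemFactor (z / l) - 1‖ := by
  have hr : 0 < ‖z‖ + 1 := by positivity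
  refine ((summable_norm_rpow_neg_three L).mul_left
    (Real.exp 2 * (‖z‖ + 1) ^ 3)).of_norm_bounded_eventually ?_
  filter_upwards [eventually_norm_elemFactor_le L hr] with l hl
  simpa using hl z (by simp)

theorem elemFactor_ne_zero {u : ℂ} (hu : u ≠ 1) : elemFactor u ≠ 0 :=
  mul_ne_zero (sub_ne_zero.mpr hu.symm) (Complex.exp_ne_zero _)

theorem div_ne_one_of_notMem {z : ℂ} (hz : z ∈ L.lattice → z = 0) (l : L.lattice) :
    z / l ≠ 1 := by
  intro h
  by_cases hl : (l : ℂ) = 0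
  · simp [hl] at h
  · rw [div_eq_one_iff_eq hl] at h
    exact hl (h ▸ hz (h ▸ l.2))

theorem sigmaReg_ne_zero {z : ℂ} (hz : z ∈ L.lattice → z = 0) : sigmaReg L z ≠ 0 := by
  have := tprod_one_add_ne_zero_of_summable (f := fun l : L.lattice => elemFactor (z / l) - 1)
    (fun l => by simpa using elemFactor_ne_zero (div_ne_one_of_notMem L hz l))
    (summable_norm_elemFactor L z)
  simpa [sigmaReg] using this

theorem sigma_ne_zero {z : ℂ} (hz : z ∉ L.lattice) : sigma L z ≠ 0 := by
  refine mul_ne_zero ?_ (sigmaReg_ne_zero L fun h => absurd h hz)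
  rintro rfl; exact hz (zero_mem _)

theorem sigmaReg_zero : sigmaReg L 0 = 1 := by
  simp [sigmaReg, elemFactor]

theorem sigma_eq_zero {z : ℂ} (hz : z ∈ L.lattice) : sigma L z = 0 := by
  by_cases h0 : z = 0
  · simp [h0, sigma_eq]
  · rw [sigma_eq, sigmaReg, tprod_of_exists_eq_zero, mul_zero]
    exact ⟨⟨z, hz⟩, by simp [elemFactor, h0]⟩

theorem sigma_eq_zero_iff {z : ℂ} : sigma L z = 0 ↔ z ∈ L.lattice :=
  ⟨fun h => by_contra fun hz => sigma_ne_zero L hz h, sigma_eq_zero L⟩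

theorem sigmaReg_neg (z : ℂ) : sigmaReg L (-z) = sigmaReg L z := by
  rw [sigmaReg, ← (Equiv.neg L.lattice).tprod_eq, sigmaReg]
  simp

theorem sigma_neg (z : ℂ) : sigma L (-z) = -sigma L z := by
  simp [sigma_eq, sigmaReg_neg]

theorem logDeriv_elemFactor_div {z l : ℂ} (h : z / l ≠ 1) :
    logDeriv (fun z => elemFactor (z / l)) z =
      if l = 0 then 0 else (1 / (z - l) + 1 / l + z / l ^ 2) := by
  have hd : HasDerivAt (fun z => elemFactor (z / l))
      (-(z / l) ^ 2 * Complex.exp (z / l + (z / l) ^ 2 / 2) * (1 / l)) z :=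
    HasDerivAt.comp (h := fun z => z / l) z (hasDerivAt_elemFactor (z / l))
      ((hasDerivAt_id z).div_const l)
  rw [logDeriv_apply, hd.deriv]
  split_ifs with hl
  · simp [hl]
  · have hzl : z ≠ l := fun e => h (by rw [e, div_self hl])
    have h1 : z - l ≠ 0 := sub_ne_zero.mpr hzl
    have h2 : l - z ≠ 0 := sub_ne_zero.mpr hzl.symm
    rw [zeta_term_eq hl hzl, elemFactor]
    have h3 : 1 - z / l = (l - z) / l := by field_simp
    rw [h3]
    field_simp
    ring

/-- The logarithmic derivative turns the product into the sum of its factors' logarithmic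
derivatives, which are the summands of ζ. -/
theorem logDeriv_sigmaReg {z : ℂ} (hz : z ∈ L.lattice → z = 0) :
    logDeriv (sigmaReg L) z = zetaReg L z := by
  have hr : 0 < ‖z‖ + 1 := by positivity
  have hne := div_ne_one_of_notMem L hz
  have hterm : (fun l : L.lattice => logDeriv (fun z => elemFactor (z / l)) z) =
      fun l : L.lattice =>
        if (l : ℂ) = 0 then 0 else (1 / (z - l) + 1 / (l : ℂ) + z / (l : ℂ) ^ 2) :=
    funext fun l => logDeriv_elemFactor_div (hne l)
  have h := logDeriv_tprod_eq_tsum (s := Metric.ball (0 : ℂ) (‖z‖ + 1)) (x := z)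
    (f := fun (l : L.lattice) z => elemFactor (z / l)) Metric.isOpen_ball (by simp)
    (fun l => elemFactor_ne_zero (hne l))
    (fun l w _ => ((hasDerivAt_elemFactor _).comp w
          ((hasDerivAt_id w).div_const _)).differentiableAt.differentiableWithinAt)
    (by rw [hterm]; exact (hasSum_zetaReg L z).summable)
    (hasProdLocallyUniformlyOn_sigmaReg L hr).multipliableLocallyUniformlyOn
    (sigmaReg_ne_zero L hz)
  rw [hterm] at h
  exact h

theorem hasDerivAt_sigmaReg {z : ℂ} (hz : z ∈ L.lattice → z = 0) :
    HasDerivAt (sigmaReg L) (zetaReg L z * sigmaReg L z) z := by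
  rw [← logDeriv_sigmaReg L hz, logDeriv_apply, div_mul_cancel₀ _ (sigmaReg_ne_zero L hz)]
  exact (differentiable_sigmaReg L z).hasDerivAt

theorem hasDerivAt_sigma {z : ℂ} (hz : z ∉ L.lattice) :
    HasDerivAt (sigma L) (zeta L z * sigma L z) z := by
  have hz0 : z ≠ 0 := by rintro rfl; exact hz (zero_mem _)
  convert! (hasDerivAt_id z).mul (hasDerivAt_sigmaReg L fun h => absurd h hz) using 1
  rw [zeta_eq_zetaReg_add, sigma_eq]
  simp only [id]
  field_simp
  ring

end

section

variable (L : PeriodPair)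

/-! ### Elliptic functions -/

theorem notMem_add {z l : ℂ} (hz : z ∉ L.lattice) (hl : l ∈ L.lattice) : z + l ∉ L.lattice :=
  fun h => hz ((Submodule.add_mem_iff_left _ hl).mp h)

theorem notMem_neg {z : ℂ} (hz : z ∉ L.lattice) : -z ∉ L.lattice :=
  fun h => hz (neg_mem_iff.mp h)

/-- Liouville's theorem for elliptic functions: no poles means constant. -/
theorem elliptic_eq_const {f g : ℂ → ℂ}
    (hper : ∀ l ∈ L.lattice, ∀ z ∉ L.lattice, f (z + l) = f z)
    (hd : ∀ z ∉ L.lattice, DifferentiableAt ℂ f z) (hg : AnalyticAt ℂ g 0)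
    (hfg : ∀ᶠ z in 𝓝[≠] 0, f z = g z) {z : ℂ} (hz : z ∉ L.lattice) : f z = g 0 := by
  classical
  -- The values of `f` on the lattice carry no information, so they are replaced by the limit `g 0`.
  -- The result is entire and periodic, hence bounded.
  set F : ℂ → ℂ := fun z => if z ∈ L.lattice then g 0 else f z with hF
  have hFper : ∀ z w, w ∈ L.lattice → F (z + w) = F z := by
    intro z w hw
    by_cases hz : z ∈ L.lattice
    · simp [hF, hz, add_mem hz hw]
    · simp [hF, hz, notMem_add L hz hw, hper w hw z hz]
  have hF0 : F =ᶠ[𝓝 0] g := by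
    rw [eventually_nhdsWithin_iff] at hfg
    have hl := eventually_nhdsNE_notMem_lattice L 0
    rw [eventually_nhdsWithin_iff] at hl
    filter_upwards [hfg, hl] with w hw hw'
    by_cases h : w = 0
    · subst h; simp [hF]
    · simp [hF, hw' h, hw h]
  have hFd : Differentiable ℂ F := by
    intro w
    by_cases hw : w ∈ L.lattice
    · have h0 : DifferentiableAt ℂ F (w - w) := by
        rw [sub_self]
        exact (hF0.differentiableAt_iff).mpr hg.differentiableAt
      have h1 : DifferentiableAt ℂ (fun x => F (x - w)) w :=
        DifferentiableAt.comp (f := fun x => x - w) w h0 (by fun_prop)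
      convert! h1 using 1
      ext x
      rw [sub_eq_add_neg, hFper _ _ (neg_mem hw)]
    · refine DifferentiableAt.congr_of_eventuallyEq (hd w hw) ?_
      filter_upwards [eventually_notMem_lattice L hw] with x hx
      simp [hF, hx]
  have := (hFd.apply_eq_apply_of_bounded (IsZLattice.isCompact_range_of_periodic L.lattice F
    hFd.continuous hFper).isBounded z 0)
  simpa [hF, hz] using this

/-- The complement of a countable set in the plane is connected. -/
theorem eq_const_of_deriv_eq_zero {f : ℂ → ℂ}
    (hd : ∀ z ∉ L.lattice, HasDerivAt f 0 z) : ∃ c, ∀ z ∉ L.lattice, f z = c := by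
  have hc : IsConnected ((L.lattice : Set ℂ)ᶜ) :=
    Set.Countable.isConnected_compl_of_one_lt_rank
      (by rw [Complex.rank_real_complex]; exact Cardinal.one_lt_two)
      (Set.countable_coe_iff.mp (inferInstance : Countable L.lattice))
  obtain ⟨c, h⟩ := (isOpen_compl_lattice L).exists_is_const_of_deriv_eq_zero hc.isPreconnected
    (fun z hz => (hd z hz).differentiableAt.differentiableWithinAt)
    (fun z hz => (hd z hz).deriv)
  exact ⟨c, fun z hz => h z hz⟩

/-! ### Quasi-periodicity -/

theorem weierstrassP_add_of_mem {l : ℂ} (hl : l ∈ L.lattice) (z : ℂ) :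
    L.weierstrassP (z + l) = L.weierstrassP z := L.weierstrassP_add_coe z ⟨l, hl⟩

theorem exists_zeta_add {l : ℂ} (hl : l ∈ L.lattice) :
    ∃ c, ∀ z ∉ L.lattice, zeta L (z + l) = zeta L z + c := by
  obtain ⟨c, hc⟩ := eq_const_of_deriv_eq_zero L (f := fun z => zeta L (z + l) - zeta L z) (by
    intro z hz
    have h1 := (hasDerivAt_zeta L (notMem_add L hz hl)).comp_add_const z l
    have h2 := h1.sub (hasDerivAt_zeta L hz)
    rw [weierstrassP_add_of_mem L hl] at h2
    simpa using! h2)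
  exact ⟨c, fun z hz => by rw [← hc z hz]; ring⟩

/-- The increment of ζ does not depend on the point; at -l/2 oddness evaluates it. -/
theorem zeta_add_of_half {l : ℂ} (hl : l ∈ L.lattice) (hl2 : l / 2 ∉ L.lattice) {z : ℂ}
    (hz : z ∉ L.lattice) : zeta L (z + l) = zeta L z + 2 * zeta L (l / 2) := by
  obtain ⟨c, hc⟩ := exists_zeta_add L hl
  have h := hc (-(l / 2)) (notMem_neg L hl2)
  rw [show -(l / 2) + l = l / 2 by ring, zeta_neg] at h
  rw [hc z hz]
  linear_combination -h

theorem exists_sigma_add {l c : ℂ} (hl : l ∈ L.lattice)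
    (hc : ∀ z ∉ L.lattice, zeta L (z + l) = zeta L z + c) :
    ∃ k, ∀ z, sigma L (z + l) = k * Complex.exp (c * z) * sigma L z := by
  obtain ⟨k, hk⟩ := eq_const_of_deriv_eq_zero L
    (f := fun z => sigma L (z + l) * Complex.exp (-(c * z)) / sigma L z) (by
      intro z hz
      have h1 := (hasDerivAt_sigma L (notMem_add L hz hl)).comp_add_const z l
      have h2 : HasDerivAt (fun z => Complex.exp (-(c * z))) (Complex.exp (-(c * z)) * -c) z := by
        simpa using ((hasDerivAt_id z).const_mul c).neg.cexp
      have h3 := (h1.mul h2).div (hasDerivAt_sigma L hz) (sigma_ne_zero L hz)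
      convert! h3 using 1
      rw [hc z hz, eq_comm, div_eq_zero_iff]
      left
      simp only [Pi.mul_apply]
      ring)
  refine ⟨k, fun z => ?_⟩
  by_cases hz : z ∈ L.lattice
  · rw [sigma_eq_zero L hz, sigma_eq_zero L (add_mem hz hl), mul_zero]
  · have := hk z hz
    rw [div_eq_iff (sigma_ne_zero L hz), Complex.exp_neg,
      mul_inv_eq_iff_eq_mul₀ (Complex.exp_ne_zero _)] at this
    rw [this]; ring

/-- As for ζ, the constant is found at -l/2, where σ is odd and does not vanish. -/
theorem sigma_add_of_half {l : ℂ} (hl : l ∈ L.lattice) (hl2 : l / 2 ∉ L.lattice) (z : ℂ) :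
    sigma L (z + l) = -Complex.exp (2 * zeta L (l / 2) * (z + l / 2)) * sigma L z := by
  obtain ⟨k, hk⟩ := exists_sigma_add L hl (fun z hz => zeta_add_of_half L hl hl2 hz)
  have h := hk (-(l / 2))
  rw [show -(l / 2) + l = l / 2 by ring, sigma_neg] at h
  have h0 := sigma_ne_zero L hl2
  have h1 : k * Complex.exp (2 * zeta L (l / 2) * -(l / 2)) = -1 := by
    apply mul_right_cancel₀ h0
    linear_combination h
  have h2 : k = -Complex.exp (2 * zeta L (l / 2) * (l / 2)) := by
    have h3 : Complex.exp (2 * zeta L (l / 2) * -(l / 2)) *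
        Complex.exp (2 * zeta L (l / 2) * (l / 2)) = 1 := by
      rw [← Complex.exp_add]; simp
    linear_combination Complex.exp (2 * zeta L (l / 2) * (l / 2)) * h1 - k * h3
  rw [hk z, h2, mul_add (2 * zeta L (l / 2)), Complex.exp_add]
  ring

/-! ### The fundamental identity for `℘(u) - ℘(v)` -/

/-- Evenness kills the first derivative at 0, so the divided difference can be taken twice. -/
theorem exists_even_expansion {f : ℂ → ℂ} (hf : AnalyticAt ℂ f 0) (he : ∀ z, f (-z) = f z) :
    ∃ g : ℂ → ℂ, AnalyticAt ℂ g 0 ∧ ∀ z, f z = f 0 + z ^ 2 * g z := by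
  have h1 : AnalyticAt ℂ (dslope f 0) 0 := by
    obtain ⟨p, hp⟩ := hf
    exact ⟨_, hp.has_fpower_series_dslope_fslope⟩
  have h2 : AnalyticAt ℂ (dslope (dslope f 0) 0) 0 := by
    obtain ⟨p, hp⟩ := h1
    exact ⟨_, hp.has_fpower_series_dslope_fslope⟩
  have h0 : dslope f 0 0 = 0 := by
    rw [dslope_same]
    have hd : HasDerivAt f (deriv f 0) (-0) := by
      rw [neg_zero]; exact hf.differentiableAt.hasDerivAt
    have h3 := HasDerivAt.comp (h := fun z : ℂ => -z) 0 hd (hasDerivAt_neg 0)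
    have h4 : f ∘ (fun z : ℂ => -z) = f := funext he
    rw [h4] at h3
    have h5 := h3.unique hf.differentiableAt.hasDerivAt
    linear_combination (-1 / 2) * h5
  refine ⟨_, h2, fun z => ?_⟩
  have h3 := sub_smul_dslope f 0 z
  have h4 := sub_smul_dslope (dslope f 0) 0 z
  simp only [sub_zero, smul_eq_mul, h0] at h3 h4
  rw [show z ^ 2 * dslope (dslope f 0) 0 z = z * (z * dslope (dslope f 0) 0 z) by ring, h4, h3]
  ring

/-- The difference `D` of the two sides is elliptic in the first variable: the quasi-period factors
cancel, and so do the double poles at 0. By Liouville it is constant, and at `v` it vanishes because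
σ(0) = 0. -/
theorem weierstrassP_sub {u v : ℂ} (hu : u ∉ L.lattice) (hv : v ∉ L.lattice) :
    L.weierstrassP u - L.weierstrassP v =
      -(sigma L (u + v) * sigma L (u - v)) / (sigma L u ^ 2 * sigma L v ^ 2) := by
  have hv0 := sigma_ne_zero L hv
  set D : ℂ → ℂ := fun z => sigma L (z + v) * sigma L (z - v) / (sigma L z ^ 2 * sigma L v ^ 2)
    + L.weierstrassP z - L.weierstrassP v with hD
  have hper : ∀ l ∈ L.lattice, ∀ z ∉ L.lattice, D (z + l) = D z := by
    intro l hl z hz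
    obtain ⟨c, hc⟩ := exists_zeta_add L hl
    obtain ⟨k, hk⟩ := exists_sigma_add L hl hc
    have hz0 := sigma_ne_zero L hz
    have hz1 := sigma_ne_zero L (notMem_add L hz hl)
    have hk0 : k ≠ 0 := by
      rintro rfl
      exact hz1 (by rw [hk]; simp)
    have e1 : sigma L (z + l + v) = k * Complex.exp (c * z) * Complex.exp (c * v) *
        sigma L (z + v) := by
      rw [show z + l + v = z + v + l by ring, hk, mul_add, Complex.exp_add]; ring
    have e2 : sigma L (z + l - v) = k * Complex.exp (c * z) * (Complex.exp (c * v))⁻¹ *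
        sigma L (z - v) := by
      rw [show z + l - v = z - v + l by ring, hk, mul_sub, Complex.exp_sub]; ring
    simp only [hD, weierstrassP_add_of_mem L hl, e1, e2, hk z]
    have := Complex.exp_ne_zero (c * z)
    have := Complex.exp_ne_zero (c * v)
    field_simp
  have hdiff : ∀ z ∉ L.lattice, DifferentiableAt ℂ D z := by
    intro z hz
    have h1 := differentiable_sigma L
    have h2 := (hasDerivAt_weierstrassP L hz).differentiableAt
    have h3 : DifferentiableAt ℂ (fun z => sigma L (z + v)) z :=
      (h1 _).comp z (by fun_prop)
    have h4 : DifferentiableAt ℂ (fun z => sigma L (z - v)) z :=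
      (h1 _).comp z (by fun_prop)
    have h5 := sigma_ne_zero L hz
    exact (((h3.mul h4).div (((h1 z).pow 2).mul_const _)
      (mul_ne_zero (pow_ne_zero _ h5) (pow_ne_zero _ hv0))).add h2).sub_const _
  have hNd : Differentiable ℂ fun z => sigma L (z + v) * sigma L (z - v) := by
    intro z
    exact ((differentiable_sigma L _).comp z (by fun_prop : DifferentiableAt ℂ (· + v) z)).mul
      ((differentiable_sigma L _).comp z (by fun_prop : DifferentiableAt ℂ (· - v) z))
  -- The even numerator is -σ(v)² + z²k and (σ(z)/z)² is 1 + z²m, so the quotient has principal part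
  -- -1/z², which cancels that of ℘.
  obtain ⟨k, hka, hk⟩ := exists_even_expansion
    (f := fun z => sigma L (z + v) * sigma L (z - v)) (hNd.analyticAt 0) (by
      intro z
      rw [show -z + v = -(z - v) by ring, show -z - v = -(z + v) by ring, sigma_neg, sigma_neg]
      ring)
  obtain ⟨m, hma, hm⟩ := exists_even_expansion (f := fun z => sigmaReg L z ^ 2)
    (((differentiable_sigmaReg L).analyticAt 0).pow 2) (by intro z; rw [sigmaReg_neg])
  simp only [zero_add, zero_sub, sigma_neg, sigmaReg_zero] at hk hm
  have hs := (differentiable_sigmaReg L).analyticAt 0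
  have hga : AnalyticAt ℂ (fun z => (k z + sigma L v ^ 2 * m z) / (sigma L v ^ 2 * sigmaReg L z ^ 2)
      + L.weierstrassPExcept 0 z - L.weierstrassP v) 0 := by
    have h1 := L.analyticAt_weierstrassPExcept 0
    have h2 : sigma L v ^ 2 * sigmaReg L 0 ^ 2 ≠ 0 := by simp [sigmaReg_zero, hv0]
    exact (((hka.add (analyticAt_const.mul hma)).div (analyticAt_const.mul (hs.pow 2)) h2).add
      h1).sub analyticAt_const
  have hconst := fun z (hz : z ∉ L.lattice) => elliptic_eq_const L hper hdiff hga (by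
    have hs0 : ∀ᶠ z in 𝓝[≠] (0 : ℂ), sigmaReg L z ≠ 0 :=
      (hs.continuousAt.eventually_ne (by simp [sigmaReg_zero])).filter_mono nhdsWithin_le_nhds
    filter_upwards [hs0, self_mem_nhdsWithin] with z hz hz0
    have hz0' : z ≠ 0 := hz0
    have h3 := L.weierstrassPExcept_add 0 z
    simp only [ZeroMemClass.coe_zero, sub_zero] at h3
    simp only [hD]
    rw [← h3, hk z, sigma_eq L z]
    have hm' := hm z
    field_simp
    linear_combination sigma L v ^ 2 * hm') hz
  have h1 := hconst u hu
  have h2 := hconst v hv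
  rw [← h2] at h1
  simp only [hD, sub_self, sigma_eq_zero L (zero_mem _), mul_zero, zero_div, zero_add] at h1
  rw [neg_div]
  linear_combination h1

theorem weierstrassP_eq_iff {u v : ℂ} (hu : u ∉ L.lattice) (hv : v ∉ L.lattice) :
    L.weierstrassP u = L.weierstrassP v ↔ u + v ∈ L.lattice ∨ u - v ∈ L.lattice := by
  rw [← sub_eq_zero, weierstrassP_sub L hu hv, div_eq_zero_iff, neg_eq_zero, mul_eq_zero,
    sigma_eq_zero_iff, sigma_eq_zero_iff]
  have := sigma_ne_zero L hu
  have := sigma_ne_zero L hv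
  simp [*]

/-- Derivative at u = v of the formula for ℘(u) - ℘(v): only the term in which the factor σ(u - v)
is differentiated survives. It locates the zeros of ℘'. -/
theorem derivWeierstrassP_mul_sigma {v : ℂ} (hv : v ∉ L.lattice) :
    L.derivWeierstrassP v * sigma L v ^ 4 = -sigma L (2 * v) := by
  have h0 : HasDerivAt (sigma L) 1 (v - v) := by
    rw [sub_self]
    have h := (hasDerivAt_id (0 : ℂ)).mul (hasDerivAt_sigmaReg L (fun _ => rfl))
    simpa [sigmaReg_zero] using! h
  have h1 : HasDerivAt (fun u => sigma L (u - v)) 1 v := h0.comp_sub_const v v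
  have h2 : HasDerivAt (fun u => sigma L (u + v)) (deriv (sigma L) (v + v)) v :=
    (differentiable_sigma L (v + v)).hasDerivAt.comp_add_const v v
  have hv0 := sigma_ne_zero L hv
  have h3 := ((h2.mul h1).neg.div ((((hasDerivAt_sigma L hv).pow 2)).mul_const (sigma L v ^ 2))
    (by simp [hv0])).unique (f := fun u => -(sigma L (u + v) * sigma L (u - v)) /
      (sigma L u ^ 2 * sigma L v ^ 2)) (f₁' := L.derivWeierstrassP v) (by
      refine HasDerivAt.congr_of_eventuallyEq
        ((hasDerivAt_weierstrassP L hv).sub_const (L.weierstrassP v)) ?_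
      filter_upwards [eventually_notMem_lattice L hv] with u hu
      exact (weierstrassP_sub L hu hv).symm)
  rw [← h3]
  simp only [Pi.mul_apply, Pi.neg_apply, sub_self, sigma_eq_zero L (zero_mem _)]
  rw [two_mul]
  simp only [Pi.pow_apply, mul_zero, zero_add, mul_one, neg_zero, zero_mul, sub_zero]
  field_simp

theorem derivWeierstrassP_eq_zero_iff {v : ℂ} (hv : v ∉ L.lattice) :
    L.derivWeierstrassP v = 0 ↔ 2 * v ∈ L.lattice := by
  rw [← sigma_eq_zero_iff, ← neg_eq_zero (a := sigma L (2 * v)), ← derivWeierstrassP_mul_sigma L hv]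
  simp [sigma_ne_zero L hv]

/-! ### Isolated values, the second derivative and the surjectivity of ℘. -/

theorem eventually_nhdsNE_weierstrassP_ne {a : ℂ} (ha : a ∉ L.lattice) (z : ℂ) :
    ∀ᶠ w in 𝓝[≠] z, w ∉ L.lattice ∧ L.weierstrassP w ≠ L.weierstrassP a := by
  have key : ∀ a z : ℂ, ∀ᶠ w in 𝓝[≠] z, w + a ∉ L.lattice := by
    intro a z
    have h := eventually_nhdsNE_notMem_lattice L (z + a)
    have ht : Tendsto (fun w => w + a) (𝓝[≠] z) (𝓝[≠] (z + a)) := by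
      refine tendsto_nhdsWithin_of_tendsto_nhds_of_eventually_within _
        ((continuous_id.add continuous_const).continuousAt.tendsto.mono_left nhdsWithin_le_nhds) ?_
      filter_upwards [self_mem_nhdsWithin] with w hw
      simpa using hw
    exact ht.eventually h
  filter_upwards [key a z, key (-a) z, eventually_nhdsNE_notMem_lattice L z] with w h1 h2 h3
  refine ⟨h3, ?_⟩
  rw [Ne, weierstrassP_eq_iff L h3 ha, not_or, sub_eq_add_neg]
  exact ⟨h1, h2⟩

/-- Otherwise ℘ would be constant near z, against the isolation of its level sets. -/
theorem eventually_nhdsNE_derivWeierstrassP_ne {z : ℂ} (hz : z ∉ L.lattice) :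
    ∀ᶠ w in 𝓝[≠] z, L.derivWeierstrassP w ≠ 0 := by
  rcases (analyticAt_derivWeierstrassP L hz).eventually_eq_zero_or_eventually_ne_zero with h | h
  · exfalso
    have hc : ∀ᶠ w in 𝓝 z, L.weierstrassP w = L.weierstrassP z := by
      obtain ⟨s, hs, hso, hzs⟩ := eventually_nhds_iff.mp (h.and (eventually_notMem_lattice L hz))
      obtain ⟨ε, hε, hb⟩ := Metric.isOpen_iff.mp hso z hzs
      filter_upwards [Metric.ball_mem_nhds z hε] with w hw
      refine Metric.isOpen_ball.is_const_of_deriv_eq_zero (convex_ball z ε).isPreconnected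
        (fun x hx => (hasDerivAt_weierstrassP L (hs x
          (hb hx)).2).differentiableAt.differentiableWithinAt)
        (fun x hx => ?_) hw (Metric.mem_ball_self hε)
      rw [L.deriv_weierstrassP]
      exact (hs x (hb hx)).1
    obtain ⟨w, hw, hw'⟩ := ((hc.filter_mono nhdsWithin_le_nhds).and
      (eventually_nhdsNE_weierstrassP_ne L hz z)).exists
    exact hw'.2 hw
  · exact h

/-- Equality of two functions near a point extends from a punctured neighbourhood. -/
theorem eq_of_eventually_nhdsNE {f g : ℂ → ℂ} {z : ℂ} (hf : ContinuousAt f z)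
    (hg : ContinuousAt g z) (h : ∀ᶠ w in 𝓝[≠] z, f w = g w) : f z = g z :=
  tendsto_nhds_unique_of_eventuallyEq (hf.tendsto.mono_left nhdsWithin_le_nhds)
    (hg.tendsto.mono_left nhdsWithin_le_nhds) h

/-- Differentiate the Weierstrass cubic equation, divide by ℘' where it is nonzero, and extend to
its zeros by continuity. -/
theorem hasDerivAt_derivWeierstrassP {z : ℂ} (hz : z ∉ L.lattice) :
    HasDerivAt L.derivWeierstrassP (6 * L.weierstrassP z ^ 2 - L.g₂ / 2) z := by
  have hp := analyticAt_weierstrassP L hz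
  have hp' := analyticAt_derivWeierstrassP L hz
  have : deriv L.derivWeierstrassP z = 6 * L.weierstrassP z ^ 2 - L.g₂ / 2 := by
    refine eq_of_eventually_nhdsNE (g := fun z => 6 * L.weierstrassP z ^ 2 - L.g₂ / 2)
      hp'.deriv.continuousAt
      (((continuousAt_const.mul (hp.continuousAt.pow 2))).sub continuousAt_const) ?_
    filter_upwards [eventually_nhdsNE_derivWeierstrassP_ne L hz,
      (eventually_notMem_lattice L hz).filter_mono nhdsWithin_le_nhds] with w hw hwl
    have h1 := hasDerivAt_weierstrassP L hwl
    have h2 := (analyticAt_derivWeierstrassP L hwl).differentiableAt.hasDerivAt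
    have h3 := (((h1.pow 3).const_mul 4).sub (h1.const_mul L.g₂)).sub_const L.g₃
    have h4 := (h2.pow 2).unique (h3.congr_of_eventuallyEq (by
      filter_upwards [eventually_notMem_lattice L hwl] with x hx
      simpa using L.derivWeierstrassP_sq x hx))
    apply mul_left_cancel₀ hw
    simp only [Nat.cast_ofNat] at h4
    linear_combination h4 / 2
  rw [← this]
  exact hp'.differentiableAt.hasDerivAt

/-- If `c` were omitted, 1/(℘ - c) would be elliptic without poles and would tend to 0 at the
lattice points, hence vanish identically. -/
theorem weierstrassP_surjective (c : ℂ) : ∃ z ∉ L.lattice, L.weierstrassP z = c := by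
  by_contra! h
  have h0 : L.ω₁ / 2 ∉ L.lattice := L.ω₁_div_two_notMem_lattice
  have hga : AnalyticAt ℂ (fun z => z ^ 2 / (z ^ 2 * L.weierstrassPExcept 0 z + 1 - c * z ^ 2))
      0 := by
    have h1 := L.analyticAt_weierstrassPExcept 0
    exact (analyticAt_id.pow 2).div ((((analyticAt_id.pow 2).mul h1).add analyticAt_const).sub
      (analyticAt_const.mul (analyticAt_id.pow 2))) (by simp)
  have hE := elliptic_eq_const L (f := fun z => (L.weierstrassP z - c)⁻¹)
    (fun l hl z _ => by simp only [weierstrassP_add_of_mem L hl])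
    (fun z hz => ((hasDerivAt_weierstrassP L hz).differentiableAt.sub_const c).inv
      (sub_ne_zero.mpr (h z hz))) hga (by
      filter_upwards [self_mem_nhdsWithin] with z hz0
      have hz0' : z ≠ 0 := hz0
      have h3 := L.weierstrassPExcept_add 0 z
      simp only [ZeroMemClass.coe_zero, sub_zero] at h3
      have h4 : z ^ 2 * L.weierstrassPExcept 0 z + 1 - c * z ^ 2 =
          z ^ 2 * (L.weierstrassP z - c) := by
        rw [← h3]
        simp only [ne_eq, OfNat.ofNat_ne_zero, not_false_eq_true, zero_pow, div_zero, sub_zero]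
        field_simp
      rw [h4, div_mul_eq_div_div, div_self (pow_ne_zero 2 hz0'), one_div]) h0
  simp only [ne_eq, OfNat.ofNat_ne_zero, not_false_eq_true, zero_pow, zero_div] at hE
  exact sub_ne_zero.mpr (h _ h0) (inv_eq_zero.mp hE)

/-! ### Addition theorem -/

/-- Logarithmic derivative in u of the σ-formula for ℘(u) - ℘(v). -/
theorem derivWeierstrassP_eq_mul {u v : ℂ} (hu : u ∉ L.lattice) (hv : v ∉ L.lattice)
    (hp : u + v ∉ L.lattice) (hm : u - v ∉ L.lattice) :
    L.derivWeierstrassP u = (L.weierstrassP u - L.weierstrassP v) *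
      (zeta L (u + v) + zeta L (u - v) - 2 * zeta L u) := by
  have h1 := (hasDerivAt_sigma L hm).comp_sub_const u v
  have h2 := (hasDerivAt_sigma L hp).comp_add_const u v
  have hv0 := sigma_ne_zero L hv
  have hu0 := sigma_ne_zero L hu
  have h3 := ((h2.mul h1).neg.div ((((hasDerivAt_sigma L hu).pow 2)).mul_const (sigma L v ^ 2))
    (by simp [hv0, hu0])).unique (f := fun u => -(sigma L (u + v) * sigma L (u - v)) /
      (sigma L u ^ 2 * sigma L v ^ 2)) (f₁' := L.derivWeierstrassP u) (by
      refine HasDerivAt.congr_of_eventuallyEq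
        ((hasDerivAt_weierstrassP L hu).sub_const (L.weierstrassP v)) ?_
      filter_upwards [eventually_notMem_lattice L hu] with u hu
      exact (weierstrassP_sub L hu hv).symm)
  rw [← h3, weierstrassP_sub L hu hv]
  simp only [Pi.mul_apply, Pi.neg_apply, Pi.pow_apply]
  field_simp
  ring

/-- The preceding formula is added to its copy with u and v exchanged; ζ(u + v) cancels. This is the
form needed for Φ₀'/Φ₀. -/
theorem zeta_addition {u v : ℂ} (hu : u ∉ L.lattice) (hv : v ∉ L.lattice)
    (hp : u + v ∉ L.lattice) (hm : u - v ∉ L.lattice) :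
    2 * (L.weierstrassP u - L.weierstrassP v) * (zeta L (u - v) - zeta L u + zeta L v) =
      L.derivWeierstrassP u + L.derivWeierstrassP v := by
  have hm' : v - u ∉ L.lattice := by simpa using notMem_neg L hm
  rw [derivWeierstrassP_eq_mul L hu hv hp hm,
    derivWeierstrassP_eq_mul L hv hu (by rwa [add_comm]) hm', show v - u = -(u - v) by ring,
    zeta_neg, add_comm v u]
  ring

end

/-! ### The lattice `ℤ + ℤ τ` -/

section

variable (τ : ℍ)

theorem mem_periods {z : ℂ} : z ∈ (periods τ).lattice ↔ ∃ m n : ℤ, (m : ℂ) + n * τ = z := by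
  rw [PeriodPair.mem_lattice]
  simp [periods]

theorem one_mem : (1 : ℂ) ∈ (periods τ).lattice := (periods τ).ω₁_mem_lattice

theorem tau_mem : (τ : ℂ) ∈ (periods τ).lattice := (periods τ).ω₂_mem_lattice

theorem rat_mem_periods {a b : ℚ} :
    (a : ℂ) + b * τ ∈ (periods τ).lattice ↔ a.den = 1 ∧ b.den = 1 := by
  rw [← (periods τ).mul_ω₁_add_mul_ω₂_mem_lattice]
  simp [periods]

theorem half_notMem : (1 / 2 : ℂ) ∉ (periods τ).lattice := (periods τ).ω₁_div_two_notMem_lattice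

theorem tau_half_notMem : (τ / 2 : ℂ) ∉ (periods τ).lattice :=
  (periods τ).ω₂_div_two_notMem_lattice

theorem half_add_tau_half_notMem : (1 / 2 + τ / 2 : ℂ) ∉ (periods τ).lattice := by
  have h := (rat_mem_periods τ (a := 1 / 2) (b := 1 / 2)).not.mpr (by norm_num)
  convert! h using 2
  push_cast
  ring

theorem half_sub_tau_half_notMem : (1 / 2 - τ / 2 : ℂ) ∉ (periods τ).lattice := by
  intro h
  refine half_add_tau_half_notMem τ ?_
  convert! add_mem h (tau_mem τ) using 1
  ring

theorem neg_half_sub_notMem : (-(1 / 2) - τ / 2 : ℂ) ∉ (periods τ).lattice := by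
  have := notMem_neg _ (half_add_tau_half_notMem τ)
  rwa [neg_add'] at this

theorem zeta_add_one {z : ℂ} (hz : z ∉ (periods τ).lattice) :
    zeta (periods τ) (z + 1) = zeta (periods τ) z + 2 * eta1 τ :=
  zeta_add_of_half _ (one_mem τ) (half_notMem τ) hz

theorem zeta_add_tau {z : ℂ} (hz : z ∉ (periods τ).lattice) :
    zeta (periods τ) (z + τ) = zeta (periods τ) z + 2 * eta3 τ :=
  zeta_add_of_half _ (tau_mem τ) (tau_half_notMem τ) hz

theorem sigma_add_one (z : ℂ) : sigma (periods τ) (z + 1) =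
    -Complex.exp (2 * eta1 τ * (z + 1 / 2)) * sigma (periods τ) z :=
  sigma_add_of_half _ (one_mem τ) (half_notMem τ) z

theorem sigma_add_tau (z : ℂ) : sigma (periods τ) (z + τ) =
    -Complex.exp (2 * eta3 τ * (z + τ / 2)) * sigma (periods τ) z :=
  sigma_add_of_half _ (tau_mem τ) (tau_half_notMem τ) z

/-! ### The values `e₁, e₂, e₃` -/

theorem e1_ne_e2 : e1 τ ≠ e2 τ := by
  rw [e1, e2, Ne, weierstrassP_eq_iff _ (half_notMem τ) (neg_half_sub_notMem τ), not_or]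
  constructor
  · convert! notMem_neg _ (tau_half_notMem τ) using 2; ring
  · intro h
    refine tau_half_notMem τ ?_
    convert! sub_mem h (one_mem τ) using 1
    ring

theorem e1_ne_e3 : e1 τ ≠ e3 τ := by
  rw [e1, e3, Ne, weierstrassP_eq_iff _ (half_notMem τ) (tau_half_notMem τ), not_or]
  exact ⟨half_add_tau_half_notMem τ, half_sub_tau_half_notMem τ⟩

theorem e2_ne_e3 : e2 τ ≠ e3 τ := by
  rw [e2, e3, Ne, weierstrassP_eq_iff _ (neg_half_sub_notMem τ) (tau_half_notMem τ), not_or]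
  constructor
  · convert! notMem_neg _ (half_notMem τ) using 2; ring
  · intro h
    refine half_notMem τ ?_
    convert! neg_mem (add_mem h (tau_mem τ)) using 1
    ring

theorem cubic_eq_sq {z : ℂ} (hz : z ∉ (periods τ).lattice) :
    (periods τ).derivWeierstrassP z ^ 2 = cubic τ ((periods τ).weierstrassP z) :=
  (periods τ).derivWeierstrassP_sq z hz

theorem derivWeierstrassP_half : (periods τ).derivWeierstrassP (1 / 2) = 0 := by
  rw [derivWeierstrassP_eq_zero_iff _ (half_notMem τ)]
  simpa using one_mem τ

theorem derivWeierstrassP_tau_half : (periods τ).derivWeierstrassP (τ / 2) = 0 := by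
  rw [derivWeierstrassP_eq_zero_iff _ (tau_half_notMem τ), mul_div_cancel₀ _ two_ne_zero]
  exact tau_mem τ

theorem derivWeierstrassP_neg_half_sub : (periods τ).derivWeierstrassP (-(1 / 2) - τ / 2) = 0 := by
  rw [derivWeierstrassP_eq_zero_iff _ (neg_half_sub_notMem τ)]
  convert! neg_mem (add_mem (one_mem τ) (tau_mem τ)) using 1
  ring

theorem cubic_e1 : cubic τ (e1 τ) = 0 := by
  rw [e1, ← cubic_eq_sq τ (half_notMem τ), derivWeierstrassP_half, zero_pow two_ne_zero]

theorem cubic_e2 : cubic τ (e2 τ) = 0 := by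
  rw [e2, ← cubic_eq_sq τ (neg_half_sub_notMem τ), derivWeierstrassP_neg_half_sub,
    zero_pow two_ne_zero]

theorem cubic_e3 : cubic τ (e3 τ) = 0 := by
  rw [e3, ← cubic_eq_sq τ (tau_half_notMem τ), derivWeierstrassP_tau_half, zero_pow two_ne_zero]

theorem g₂_eq_aux12 : (periods τ).g₂ = 4 * (e1 τ ^ 2 + e1 τ * e2 τ + e2 τ ^ 2) := by
  apply mul_left_cancel₀ (sub_ne_zero.mpr (e1_ne_e2 τ))
  have h1 := cubic_e1 τ
  have h2 := cubic_e2 τ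
  simp only [cubic] at h1 h2
  linear_combination h2 - h1

theorem g₂_eq_aux13 : (periods τ).g₂ = 4 * (e1 τ ^ 2 + e1 τ * e3 τ + e3 τ ^ 2) := by
  apply mul_left_cancel₀ (sub_ne_zero.mpr (e1_ne_e3 τ))
  have h1 := cubic_e1 τ
  have h2 := cubic_e3 τ
  simp only [cubic] at h1 h2
  linear_combination h2 - h1

/-- The two expressions for g₂, through e₁, e₂ and through e₁, e₃, differ by a multiple of the sum,
and the factor e₂ - e₃ can be cancelled. -/
theorem e_sum : e1 τ + e2 τ + e3 τ = 0 := by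
  apply mul_left_cancel₀ (sub_ne_zero.mpr (e2_ne_e3 τ))
  linear_combination (g₂_eq_aux13 τ - g₂_eq_aux12 τ) / 4

theorem g₂_eq : (periods τ).g₂ = 2 * (e1 τ ^ 2 + e2 τ ^ 2 + e3 τ ^ 2) := by
  have h : e3 τ = -e1 τ - e2 τ := by linear_combination e_sum τ
  rw [g₂_eq_aux12, h]
  ring

theorem g₃_eq : (periods τ).g₃ = 4 * (e1 τ * e2 τ * e3 τ) := by
  have h : e3 τ = -e1 τ - e2 τ := by linear_combination e_sum τ
  have h1 := cubic_e1 τ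
  simp only [cubic] at h1
  rw [g₂_eq_aux12] at h1
  rw [h]
  linear_combination -h1

theorem cubic_eq_prod (b : ℂ) : cubic τ b = 4 * ((b - e1 τ) * (b - e2 τ) * (b - e3 τ)) := by
  have h : e3 τ = -e1 τ - e2 τ := by linear_combination e_sum τ
  rw [cubic, g₂_eq, g₃_eq, h]
  ring

theorem notBranchValue_iff (b : ℂ) : NotBranchValue τ b ↔ cubic τ b ≠ 0 := by
  rw [cubic_eq_prod, NotBranchValue]
  simp [sub_eq_zero, not_or, and_assoc]

/-! ### The Legendre relation -/

/-- The open parallelogram with vertices `±1 ± τ`. -/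
def fundBox : Set ℂ :=
  {z | z.im ∈ Set.Ioo (-τ.im) τ.im} ∩
    {z | z.re * τ.im - z.im * τ.re ∈ Set.Ioo (-τ.im) τ.im}

theorem isOpen_fundBox : IsOpen (fundBox τ) :=
  (isOpen_Ioo.preimage Complex.continuous_im).inter (isOpen_Ioo.preimage
    (f := fun z : ℂ => z.re * τ.im - z.im * τ.re) (by fun_prop))

theorem convex_fundBox : Convex ℝ (fundBox τ) := by
  refine Convex.inter ?_ ?_
  · exact (convex_Ioo (-τ.im) τ.im).linear_preimage Complex.imLm
  · refine (convex_Ioo (-τ.im) τ.im).is_linear_preimage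
      (f := fun z : ℂ => z.re * τ.im - z.im * τ.re) ⟨fun x y => ?_, fun c x => ?_⟩
    · simp; ring
    · simp; ring

theorem mem_fundBox {a b : ℝ} (ha : |a| < 1) (hb : |b| < 1) : (a + b * τ : ℂ) ∈ fundBox τ := by
  have h := τ.im_pos
  rw [abs_lt] at ha hb
  simp only [fundBox, Set.mem_inter_iff, Set.mem_ofPred_eq, Complex.add_im, Complex.add_re,
    Complex.mul_re, Complex.mul_im, Complex.ofReal_re, Complex.ofReal_im, coe_re, coe_im,
    Set.mem_Ioo]
  refine ⟨⟨by nlinarith, by nlinarith⟩, by nlinarith, by nlinarith⟩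

theorem eq_zero_of_mem_fundBox {z : ℂ} (hz : z ∈ fundBox τ) (hl : z ∈ (periods τ).lattice) :
    z = 0 := by
  obtain ⟨m, n, rfl⟩ := (mem_periods τ).mp hl
  have h := τ.im_pos
  simp only [fundBox, Set.mem_inter_iff, Set.mem_ofPred_eq, Complex.add_im, Complex.add_re,
    Complex.mul_re, Complex.mul_im, Complex.intCast_re, Complex.intCast_im, coe_re, coe_im,
    Set.mem_Ioo] at hz
  obtain ⟨⟨h1, h2⟩, h3, h4⟩ := hz
  have hn : n = 0 := by
    have h5 : (n : ℝ) < 1 := by nlinarith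
    have h6 : (-1 : ℝ) < n := by nlinarith
    have h7 : n < 1 := by exact_mod_cast h5
    have h8 : -1 < n := by exact_mod_cast h6
    omega
  subst hn
  have hm : m = 0 := by
    have h5 : (m : ℝ) < 1 := by simp at h4; nlinarith
    have h6 : (-1 : ℝ) < m := by simp at h3; nlinarith
    have h7 : m < 1 := by exact_mod_cast h5
    have h8 : -1 < m := by exact_mod_cast h6
    omega
  subst hm
  simp

/-- On the convex box σ(z)/z has no zeros, so it has a continuous logarithm F. Near each point F
differs from a principal logarithm by a constant, and is therefore differentiable. The primitive
replaces contour integration in the Legendre relation. -/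
theorem exists_primitive_zetaReg :
    ∃ F : ℂ → ℂ, ∀ z ∈ fundBox τ, HasDerivAt F (zetaReg (periods τ) z) z := by
  have hne : ∀ z ∈ fundBox τ, sigmaReg (periods τ) z ≠ 0 := fun z hz =>
    sigmaReg_ne_zero _ (eq_zero_of_mem_fundBox τ hz)
  have hsc : IsSimplyConnected (fundBox τ) := by
    have : ContractibleSpace (fundBox τ) := (convex_fundBox τ).contractibleSpace
      ⟨0, by simpa using mem_fundBox τ (a := 0) (b := 0) (by simp) (by simp)⟩
    exact SimplyConnectedSpace.ofContractible _
  obtain ⟨F, hFc, hF⟩ := Complex.exists_continuousOn_eqOn_exp_comp hsc (isOpen_fundBox τ)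
    (g := sigmaReg (periods τ)) (differentiable_sigmaReg _).continuous.continuousOn (by
      rintro ⟨z, hz, h⟩; exact hne z hz h)
  refine ⟨F, fun z hz => ?_⟩
  have hs := hne z hz
  have h1 : HasDerivAt (fun w => F z + Complex.log (sigmaReg (periods τ) w / sigmaReg (periods τ) z))
      (zetaReg (periods τ) z) z := by
    have h2 := (hasDerivAt_sigmaReg (periods τ) (eq_zero_of_mem_fundBox τ hz)).div_const
      (sigmaReg (periods τ) z)
    have h3 := (h2.clog (by simp [hs])).const_add (F z)
    convert! h3 using 1
    field_simp
  refine h1.congr_of_eventuallyEq ?_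
  have hcont : ContinuousAt F z := hFc.continuousAt ((isOpen_fundBox τ).mem_nhds hz)
  have hnear : ∀ᶠ w in 𝓝 z, ‖F w - F z‖ < Real.pi := by
    have : Tendsto (fun w => ‖F w - F z‖) (𝓝 z) (𝓝 0) := by
      have := (hcont.tendsto.sub_const (F z)).norm
      simpa using this
    exact this.eventually_lt_const Real.pi_pos
  filter_upwards [hnear, (isOpen_fundBox τ).mem_nhds hz] with w hw hwU
  have h4 : Complex.exp (F w) = sigmaReg (periods τ) w := hF hwU
  have h5 : Complex.exp (F z) = sigmaReg (periods τ) z := hF hz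
  have h6 := (Complex.abs_im_le_norm (F w - F z)).trans_lt hw
  rw [abs_lt] at h6
  rw [← h4, ← h5, ← Complex.exp_sub, Complex.log_exp h6.1 h6.2.le]
  ring

theorem eq_of_hasDerivAt_zero {G : ℂ → ℂ}
    (hG : ∀ s : ℝ, |s| < 1 → HasDerivAt G 0 (s : ℂ)) : G (1 / 2) = G (-(1 / 2)) := by
  have h := (isOpen_Ioo (a := (-1 : ℝ)) (b := 1)).is_const_of_deriv_eq_zero
    isPreconnected_Ioo (f := fun s : ℝ => G s) (x := 1 / 2) (y := -(1 / 2))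
    (fun s hs => (hG s (abs_lt.mpr hs)).comp_ofReal.differentiableAt.differentiableWithinAt)
    (fun s hs => (hG s (abs_lt.mpr hs)).comp_ofReal.deriv) (by norm_num) (by norm_num)
  simpa using h

theorem real_add_real_mul_mem {a b : ℝ} (h : (a + b * τ : ℂ) ∈ (periods τ).lattice) :
    ∃ m n : ℤ, (m : ℝ) = a ∧ (n : ℝ) = b := by
  obtain ⟨m, n, h⟩ := (mem_periods τ).mp h
  have him := congrArg Complex.im h
  have hre := congrArg Complex.re h
  simp only [Complex.add_im, Complex.add_re, Complex.mul_re, Complex.mul_im, Complex.intCast_re,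
    Complex.intCast_im, Complex.ofReal_re, Complex.ofReal_im, coe_re, coe_im, zero_add, zero_mul,
    add_zero, sub_zero] at him hre
  have hn : (n : ℝ) = b := mul_right_cancel₀ τ.im_ne_zero him
  rw [hn] at hre
  exact ⟨m, n, by linarith, hn⟩

theorem half_not_int (m : ℤ) : (m : ℝ) ≠ -(1 / 2) := by
  intro h
  have : ((2 * m : ℤ) : ℝ) = ((-1 : ℤ) : ℝ) := by push_cast; linarith
  have := Int.cast_injective this
  omega

/-- The Legendre relation. -/
theorem legendre : eta1 τ * τ - eta3 τ = Real.pi * Complex.I := by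
  obtain ⟨F, hF⟩ := exists_primitive_zetaReg τ
  have hτ := τ.im_pos
  have hhalf : |(1 / 2 : ℝ)| < 1 := by norm_num [abs_lt]
  have hhalf' : |(-(1 / 2) : ℝ)| < 1 := by norm_num [abs_lt]
  -- Quasi-periodicity under 1 is integrated along the direction of τ; the endpoints s = ±1/2 are
  -- the four corners ±1/2 ± τ/2. The logarithms restore the pole 1/z of ζ.
  have c1 := eq_of_hasDerivAt_zero (G := fun s => F (1 / 2 + s * τ) - F (-(1 / 2) + s * τ)
    - 2 * eta1 τ * τ * s + Complex.log (1 / 2 + s * τ) - Complex.log (1 / 2 - s * τ)) (by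
    intro s hs
    have hlin : ∀ c : ℂ, HasDerivAt (fun s : ℂ => c + s * τ) τ s := fun c => by
      simpa using ((hasDerivAt_id (s : ℂ)).mul_const (τ : ℂ)).const_add c
    have hlin' : HasDerivAt (fun s : ℂ => 1 / 2 - s * τ) (-τ) s := by
      simpa only [id, one_mul] using! ((hasDerivAt_id (s : ℂ)).mul_const (τ : ℂ)).const_sub (1 / 2)
    have m1 : (1 / 2 + s * τ : ℂ) ∈ fundBox τ := by simpa using mem_fundBox τ hhalf hs
    have m2 : (-(1 / 2) + s * τ : ℂ) ∈ fundBox τ := by simpa using mem_fundBox τ hhalf' hs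
    have hn : (-(1 / 2) + s * τ : ℂ) ∉ (periods τ).lattice := by
      intro h
      obtain ⟨m, n, hm, -⟩ := real_add_real_mul_mem τ (a := -(1 / 2)) (b := s) (by simpa using h)
      exact half_not_int m hm
    have slit1 : (1 / 2 + s * τ : ℂ) ∈ Complex.slitPlane := by
      by_cases h0 : s = 0
      · subst h0; simp [Complex.slitPlane]
      · right; simp [h0, τ.im_ne_zero]
    have slit2 : (1 / 2 - s * τ : ℂ) ∈ Complex.slitPlane := by
      by_cases h0 : s = 0
      · subst h0; simp [Complex.slitPlane]
      · right; simp [h0, τ.im_ne_zero]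
    have d1 := HasDerivAt.comp (h := fun s : ℂ => 1 / 2 + s * τ) (s : ℂ) (hF _ m1) (hlin _)
    have d2 := HasDerivAt.comp (h := fun s : ℂ => -(1 / 2) + s * τ) (s : ℂ) (hF _ m2) (hlin _)
    have d3 := (hasDerivAt_id (s : ℂ)).const_mul (2 * eta1 τ * τ)
    have d := (((d1.sub d2).sub d3).add ((hlin (1 / 2)).clog slit1)).sub (hlin'.clog slit2)
    convert! d using 1
    have z1 := zeta_eq_zetaReg_add (periods τ) (1 / 2 + s * τ)
    have z2 := zeta_eq_zetaReg_add (periods τ) (-(1 / 2) + s * τ)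
    have z3 := zeta_add_one τ hn
    rw [show -(1 / 2) + (s : ℂ) * τ + 1 = 1 / 2 + s * τ by ring] at z3
    rw [show (-(1 / 2) + (s : ℂ) * τ) = -(1 / 2 - s * τ) by ring] at z2 z3 ⊢
    rw [div_neg] at z2
    simp only [one_div] at z1 z2 z3 ⊢
    simp only [div_eq_mul_inv]
    linear_combination (τ : ℂ) * z1 - (τ : ℂ) * z2 - (τ : ℂ) * z3)
  -- The same along the real direction, with quasi-period τ. The factor -i turns the upper half
  -- plane into the right half plane, where the principal logarithm is differentiable.
  have c2 := eq_of_hasDerivAt_zero (G := fun s => F (s + τ / 2) - F (s - τ / 2)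
    - 2 * eta3 τ * s + Complex.log (-Complex.I * (s + τ / 2))
    - Complex.log (-Complex.I * (-s + τ / 2))) (by
    intro s hs
    have hlin : ∀ c : ℂ, HasDerivAt (fun s : ℂ => s + c) 1 s := fun c =>
      (hasDerivAt_id (s : ℂ)).add_const c
    have hlin1 : HasDerivAt (fun s : ℂ => -Complex.I * (s + τ / 2)) (-Complex.I) s := by
      simpa using (hlin (τ / 2)).const_mul (-Complex.I)
    have hlin2 : HasDerivAt (fun s : ℂ => -Complex.I * (-s + τ / 2)) Complex.I s := by
      simpa using (((hasDerivAt_id (s : ℂ)).neg).add_const (τ / 2 : ℂ)).const_mul (-Complex.I)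
    have m1 : (s + τ / 2 : ℂ) ∈ fundBox τ := by
      convert! mem_fundBox τ hs hhalf using 1; push_cast; ring
    have m2 : (s - τ / 2 : ℂ) ∈ fundBox τ := by
      convert! mem_fundBox τ hs hhalf' using 1; push_cast; ring
    have hn : (s - τ / 2 : ℂ) ∉ (periods τ).lattice := by
      intro h
      obtain ⟨m, n, -, hm⟩ := real_add_real_mul_mem τ (a := s) (b := -(1 / 2))
        (by convert! h using 1; push_cast; ring)
      exact half_not_int n hm
    have slit1 : (-Complex.I * (s + τ / 2) : ℂ) ∈ Complex.slitPlane := by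
      left; simp [hτ]
    have slit2 : (-Complex.I * (-s + τ / 2) : ℂ) ∈ Complex.slitPlane := by
      left; simp [hτ]
    have d1 := HasDerivAt.comp (h := fun s : ℂ => s + τ / 2) (s : ℂ) (hF _ m1) (hlin _)
    have d2 := HasDerivAt.comp (h := fun s : ℂ => s - τ / 2) (s : ℂ) (hF _ m2)
      (by simpa [sub_eq_add_neg] using hlin (-(τ / 2)))
    have d3 := (hasDerivAt_id (s : ℂ)).const_mul (2 * eta3 τ)
    have d := (((d1.sub d2).sub d3).add (hlin1.clog slit1)).sub (hlin2.clog slit2)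
    convert! d using 1
    have z1 := zeta_eq_zetaReg_add (periods τ) (s + τ / 2)
    have z2 := zeta_eq_zetaReg_add (periods τ) (s - τ / 2)
    have z3 := zeta_add_tau τ hn
    rw [show (s : ℂ) - τ / 2 + τ = s + τ / 2 by ring] at z3
    have hI := Complex.I_ne_zero
    have y1 : -Complex.I / (-Complex.I * (s + τ / 2)) = 1 / (s + τ / 2) := by
      rw [div_mul_eq_div_div, div_self (neg_ne_zero.mpr hI)]
    have y2 : Complex.I / (-Complex.I * (-s + τ / 2)) = 1 / (s - τ / 2) := by
      rw [show -Complex.I * (-s + τ / 2) = Complex.I * (s - τ / 2) by ring, div_mul_eq_div_div,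
        div_self hI]
    rw [y1, y2]
    linear_combination z1 - z2 - z3)
  -- The F-values at the corners cancel between `c1` and `c2`. What remains are the quarter turns
  -- ±πi/2 between the two choices of logarithm, and these produce πi.
  have l1 : Complex.log (Complex.I * (1 / 2 - τ / 2)) =
      Real.pi / 2 * Complex.I + Complex.log (1 / 2 - τ / 2) := by
    have him : (1 / 2 - τ / 2 : ℂ).im < 0 := by simp [hτ]
    have h0 : (1 / 2 - τ / 2 : ℂ) ≠ 0 := by intro h; rw [h] at him; simp at him
    rw [(Complex.log_mul_eq_add_log_iff Complex.I_ne_zero h0).mpr, Complex.log_I]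
    rw [Complex.arg_I]
    have h1 := Complex.arg_neg_iff.mpr him
    have h2 := Complex.neg_pi_lt_arg (1 / 2 - τ / 2)
    have := Real.pi_pos
    constructor <;> linarith
  have l2 : Complex.log (-Complex.I * (1 / 2 + τ / 2)) =
      -(Real.pi / 2) * Complex.I + Complex.log (1 / 2 + τ / 2) := by
    have him : 0 < (1 / 2 + τ / 2 : ℂ).im := by simp [hτ]
    have h0 : (1 / 2 + τ / 2 : ℂ) ≠ 0 := by intro h; rw [h] at him; simp at him
    rw [(Complex.log_mul_eq_add_log_iff (neg_ne_zero.mpr Complex.I_ne_zero) h0).mpr,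
      Complex.log_neg_I]
    rw [Complex.arg_neg_I]
    have h1 := Complex.arg_nonneg_iff.mpr him.le
    have h2 := Complex.arg_le_pi (1 / 2 + τ / 2)
    have := Real.pi_pos
    constructor <;> linarith
  simp only [show (1 / 2 : ℂ) * τ = τ / 2 by ring, show -(1 / 2 : ℂ) * τ = -(τ / 2) by ring,
    sub_neg_eq_add, neg_neg] at c1 c2
  rw [show -Complex.I * (-(1 / 2) + (τ : ℂ) / 2) = Complex.I * (1 / 2 - τ / 2) by ring, l1, l2]
    at c2
  simp only [← sub_eq_add_neg] at c1
  rw [show (-(1 / 2) : ℂ) + τ / 2 = -(1 / 2) + τ / 2 from rfl] at c1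
  linear_combination c2 / 2 - c1 / 2

end

/-! ### The odd theta function and its derivatives -/

/-- The exponent in the `n`-th term of the theta series. -/
def thetaExp (n : ℤ) (z t : ℂ) : ℂ :=
  Real.pi * Complex.I * (n + 1 / 2) ^ 2 * t + 2 * Real.pi * Complex.I * (n + 1 / 2) * z

/-- The `n`-th term of the `k`-th `z`-derivative of the odd theta function. -/
def thetaTerm (k : ℕ) (n : ℤ) (z t : ℂ) : ℂ :=
  (-1) ^ n * (2 * Real.pi * Complex.I * (n + 1 / 2)) ^ k * Complex.exp (thetaExp n z t)

/-- The `k`-th `z`-derivative of the odd theta function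
`∑ (-1)ⁿ exp(πi (n + 1/2)² t + 2πi (n + 1/2) z)`. -/
def theta (k : ℕ) (z t : ℂ) : ℂ := ∑' n : ℤ, thetaTerm k n z t

/-- A summable bound for the terms of the theta series on `|Im z| ≤ S`, `Im t ≥ T`. -/
def thetaBound (k : ℕ) (S T : ℝ) (n : ℤ) : ℝ :=
  (4 * Real.pi) ^ k * Real.exp (Real.pi * S) * (|(n : ℝ)| ^ k *
    Real.exp (-Real.pi * (T * n ^ 2 - 2 * (S + T / 2) * |(n : ℝ)|)) +
    |(n : ℝ)| ^ 0 * Real.exp (-Real.pi * (T * n ^ 2 - 2 * (S + T / 2) * |(n : ℝ)|)))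

theorem summable_thetaBound (k : ℕ) (S : ℝ) {T : ℝ} (hT : 0 < T) :
    Summable (thetaBound k S T) := by
  have h := fun k => summable_pow_mul_jacobiTheta₂_term_bound (S + T / 2) hT k
  simp only [Int.cast_abs] at h
  exact ((h k).add (h 0)).mul_left _

/-- The half-integer shift costs (n + 1/2)² ≥ n² - |n|, which explains S + T/2 in the bound; the
polynomial factor uses |n + 1/2| ≤ 2 max(|n|, 1). -/
theorem norm_thetaTerm_le (k : ℕ) (n : ℤ) {S T : ℝ} {z t : ℂ} (hT : 0 < T) (hz : |z.im| ≤ S)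
    (ht : T ≤ t.im) : ‖thetaTerm k n z t‖ ≤ thetaBound k S T n := by
  have hpi := Real.pi_pos
  have hn0 : (0 : ℝ) ≤ |(n : ℝ)| := abs_nonneg _
  have h1 : ‖(2 * Real.pi * Complex.I * ((n : ℂ) + 1 / 2))‖ ^ k ≤
      (4 * Real.pi) ^ k * (|(n : ℝ)| ^ k + 1) := by
    have ha : ‖(2 * Real.pi * Complex.I * ((n : ℂ) + 1 / 2))‖ ≤
        4 * Real.pi * max |(n : ℝ)| 1 := by
      have hb : ‖((n : ℂ) + 1 / 2)‖ ≤ 2 * max |(n : ℝ)| 1 := by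
        refine (norm_add_le _ _).trans ?_
        rw [Complex.norm_intCast]
        have := le_max_left |(n : ℝ)| 1
        have := le_max_right |(n : ℝ)| 1
        norm_num
        linarith
      rw [norm_mul, norm_mul, norm_mul, Complex.norm_I, Complex.norm_real,
        Real.norm_of_nonneg hpi.le, Complex.norm_two]
      nlinarith
    refine (pow_le_pow_left₀ (norm_nonneg _) ha k).trans ?_
    rw [mul_pow]
    gcongr
    rcases le_total |(n : ℝ)| 1 with h | h
    · rw [max_eq_right h, one_pow]; linarith [pow_nonneg hn0 k]
    · rw [max_eq_left h]; linarith
  have h2 : ‖Complex.exp (thetaExp n z t)‖ ≤ Real.exp (Real.pi * S) *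
      Real.exp (-Real.pi * (T * n ^ 2 - 2 * (S + T / 2) * |(n : ℝ)|)) := by
    rw [Complex.norm_exp, ← Real.exp_add, Real.exp_le_exp]
    have hre : (thetaExp n z t).re = -Real.pi * (n + 1 / 2) ^ 2 * t.im
        - 2 * Real.pi * (n + 1 / 2) * z.im := by
      rw [thetaExp, (by push_cast; ring : Real.pi * Complex.I * ((n : ℂ) + 1 / 2) ^ 2 * t
        + 2 * Real.pi * Complex.I * ((n : ℂ) + 1 / 2) * z =
        ((Real.pi * (n + 1 / 2) ^ 2 : ℝ) : ℂ) * t * Complex.I +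
        ((2 * Real.pi * (n + 1 / 2) : ℝ) : ℂ) * z * Complex.I)]
      rw [Complex.add_re, Complex.mul_I_re, Complex.im_ofReal_mul, Complex.mul_I_re,
        Complex.im_ofReal_mul]
      ring
    rw [hre]
    have hS : 0 ≤ S := (abs_nonneg _).trans hz
    have e1 : ((n : ℝ) + 1 / 2) ^ 2 * T ≤ (n + 1 / 2) ^ 2 * t.im := by gcongr
    have e2 : -|(n : ℝ)| ≤ n := neg_abs_le _
    have e3 : -((n + 1 / 2) * z.im) ≤ (|(n : ℝ)| + 1 / 2) * S := by
      refine (neg_le_abs _).trans ?_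
      rw [abs_mul]
      gcongr
      refine (abs_add_le _ _).trans ?_
      norm_num
    nlinarith [mul_le_mul_of_nonneg_left e1 hpi.le, mul_le_mul_of_nonneg_left e3 hpi.le,
      mul_le_mul_of_nonneg_left e2 (mul_pos hpi hT).le, mul_pos hpi hT]
  rw [thetaTerm, norm_mul, norm_mul, norm_zpow, norm_neg, norm_one, one_zpow, one_mul, norm_pow]
  refine (mul_le_mul h1 h2 (norm_nonneg _) (by positivity)).trans (le_of_eq ?_)
  rw [thetaBound]
  ring

theorem hasSum_theta (k : ℕ) (z : ℂ) {t : ℂ} (ht : 0 < t.im) :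
    HasSum (fun n => thetaTerm k n z t) (theta k z t) :=
  ((summable_thetaBound k |z.im| ht).of_norm_bounded
    fun n => norm_thetaTerm_le k n ht le_rfl le_rfl).hasSum

theorem hasDerivAt_thetaTerm_fst (k : ℕ) (n : ℤ) (z t : ℂ) :
    HasDerivAt (fun z => thetaTerm k n z t) (thetaTerm (k + 1) n z t) z := by
  have h1 : HasDerivAt (fun z => thetaExp n z t) (2 * Real.pi * Complex.I * (n + 1 / 2)) z := by
    simpa [thetaExp] using! ((hasDerivAt_id z).const_mul
      (2 * Real.pi * Complex.I * (n + 1 / 2 : ℂ))).const_add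
        (Real.pi * Complex.I * (n + 1 / 2 : ℂ) ^ 2 * t)
  convert! h1.cexp.const_mul ((-1) ^ n * (2 * Real.pi * Complex.I * (n + 1 / 2 : ℂ)) ^ k) using 1
  rw [thetaTerm, pow_succ]
  ring

/-- The heat equation term by term: 4πi ∂/∂t raises the index by two, as ∂²/∂z² does. -/
theorem hasDerivAt_thetaTerm_snd (k : ℕ) (n : ℤ) (z t : ℂ) :
    HasDerivAt (fun t => thetaTerm k n z t)
      (thetaTerm (k + 2) n z t / (4 * Real.pi * Complex.I)) t := by
  have h1 : HasDerivAt (fun t => thetaExp n z t) (Real.pi * Complex.I * (n + 1 / 2) ^ 2) t := by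
    simpa [thetaExp] using! ((hasDerivAt_id t).const_mul
      (Real.pi * Complex.I * (n + 1 / 2 : ℂ) ^ 2)).add_const
        (2 * Real.pi * Complex.I * (n + 1 / 2 : ℂ) * z)
  convert! h1.cexp.const_mul ((-1) ^ n * (2 * Real.pi * Complex.I * (n + 1 / 2 : ℂ)) ^ k) using 1
  have hpi : (Real.pi : ℂ) ≠ 0 := Complex.ofReal_ne_zero.mpr Real.pi_ne_zero
  have hI := Complex.I_ne_zero
  rw [thetaTerm, pow_add]
  field_simp
  ring

theorem hasDerivAt_theta_fst (k : ℕ) (z : ℂ) {t : ℂ} (ht : 0 < t.im) :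
    HasDerivAt (fun z => theta k z t) (theta (k + 1) z t) z := by
  set U : Set ℂ := {w | |w.im| < |z.im| + 1}
  have hU : IsOpen U := isOpen_lt (by fun_prop) continuous_const
  have hzU : z ∈ U := by simp [U]
  have hle : ∀ (n : ℤ), ∀ w ∈ U, ‖thetaTerm k n w t‖ ≤ thetaBound k (|z.im| + 1) t.im n :=
    fun n w hw => norm_thetaTerm_le k n ht (le_of_lt hw) le_rfl
  have hd : ∀ n : ℤ, DifferentiableOn ℂ (fun z => thetaTerm k n z t) U := fun n w _ =>
    (hasDerivAt_thetaTerm_fst k n w t).differentiableAt.differentiableWithinAt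
  have h1 := Complex.differentiableOn_tsum_of_summable_norm
    (summable_thetaBound k (|z.im| + 1) ht) hd hU hle
  have h2 := Complex.hasSum_deriv_of_summable_norm
    (summable_thetaBound k (|z.im| + 1) ht) hd hU hle hzU
  simp only [(hasDerivAt_thetaTerm_fst k _ _ _).deriv] at h2
  rw [(hasSum_theta (k + 1) z ht).unique h2]
  exact (h1.differentiableAt (hU.mem_nhds hzU)).hasDerivAt

theorem hasDerivAt_theta_snd (k : ℕ) (z : ℂ) {t : ℂ} (ht : 0 < t.im) :
    HasDerivAt (fun t => theta k z t) (theta (k + 2) z t / (4 * Real.pi * Complex.I)) t := by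
  set U : Set ℂ := {w | t.im / 2 < w.im}
  have hU : IsOpen U := isOpen_lt continuous_const (by fun_prop)
  have htU : t ∈ U := by simpa [U] using ht
  have hle : ∀ (n : ℤ), ∀ w ∈ U, ‖thetaTerm k n z w‖ ≤ thetaBound k |z.im| (t.im / 2) n :=
    fun n w hw => norm_thetaTerm_le k n (half_pos ht) le_rfl (le_of_lt hw)
  have hd : ∀ n : ℤ, DifferentiableOn ℂ (fun t => thetaTerm k n z t) U := fun n w _ =>
    (hasDerivAt_thetaTerm_snd k n z w).differentiableAt.differentiableWithinAt
  have h1 := Complex.differentiableOn_tsum_of_summable_norm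
    (summable_thetaBound k |z.im| (half_pos ht)) hd hU hle
  have h2 := Complex.hasSum_deriv_of_summable_norm
    (summable_thetaBound k |z.im| (half_pos ht)) hd hU hle htU
  simp only [(hasDerivAt_thetaTerm_snd k _ _ _).deriv] at h2
  rw [((hasSum_theta (k + 2) z ht).div_const _).unique h2]
  exact (h1.differentiableAt (hU.mem_nhds htU)).hasDerivAt

theorem continuousAt_theta (k : ℕ) {p : ℂ × ℂ} (ht : 0 < p.2.im) :
    ContinuousAt (fun p : ℂ × ℂ => theta k p.1 p.2) p := by
  set U : Set (ℂ × ℂ) := {q | |q.1.im| < |p.1.im| + 1 ∧ p.2.im / 2 < q.2.im}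
  have hU : IsOpen U := by
    have h1 : IsOpen {q : ℂ × ℂ | |q.1.im| < |p.1.im| + 1} := isOpen_lt (by fun_prop) (by fun_prop)
    have h2 : IsOpen {q : ℂ × ℂ | p.2.im / 2 < q.2.im} := isOpen_lt (by fun_prop) (by fun_prop)
    exact h1.inter h2
  have hpU : p ∈ U := by simpa [U] using ht
  refine (continuousOn_tsum (f := fun (n : ℤ) (p : ℂ × ℂ) => thetaTerm k n p.1 p.2) (fun n => ?_)
    (summable_thetaBound k (|p.1.im| + 1) (half_pos ht))
    (fun n q hq => norm_thetaTerm_le k n (half_pos ht) hq.1.le hq.2.le)).continuousAt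
      (hU.mem_nhds hpU)
  unfold thetaTerm thetaExp
  fun_prop

/-- Joint differentiability from continuous partial derivatives; strictness is what the implicit
function theorem needs. -/
theorem hasStrictFDerivAt_theta (k : ℕ) {p : ℂ × ℂ} (ht : 0 < p.2.im) :
    HasStrictFDerivAt (fun p : ℂ × ℂ => theta k p.1 p.2)
      ((ContinuousLinearMap.toSpanSingleton ℂ (theta (k + 1) p.1 p.2)).coprod
        (ContinuousLinearMap.toSpanSingleton ℂ
          (theta (k + 2) p.1 p.2 / (4 * Real.pi * Complex.I)))) p := by
  have hev : ∀ᶠ q : ℂ × ℂ in 𝓝 p, 0 < q.2.im :=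
    (isOpen_lt continuous_const (by fun_prop)).mem_nhds ht
  have hts : Continuous (ContinuousLinearMap.toSpanSingleton ℂ : ℂ → ℂ →L[ℂ] ℂ) :=
    (ContinuousLinearMap.toSpanSingletonCLE (𝕜 := ℂ) (E := ℂ)).continuous
  refine hasStrictFDerivAt_uncurry_coprod (f := fun z t => theta k z t)
    (f₁ := fun z t => ContinuousLinearMap.toSpanSingleton ℂ (theta (k + 1) z t))
    (f₂ := fun z t => ContinuousLinearMap.toSpanSingleton ℂ
          (theta (k + 2) z t / (4 * Real.pi * Complex.I))) ?_ ?_ ?_ ?_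
  · filter_upwards [hev] with q hq using (hasDerivAt_theta_fst k q.1 hq).hasFDerivAt
  · filter_upwards [hev] with q hq using (hasDerivAt_theta_snd k q.1 hq).hasFDerivAt
  · exact hts.continuousAt.comp (continuousAt_theta (k + 1) ht)
  · exact hts.continuousAt.comp ((continuousAt_theta (k + 2) ht).div_const _)

theorem hasDerivAt_theta_comp (k : ℕ) {γ : ℂ → ℂ} {γ' t : ℂ} (ht : 0 < t.im)
    (hγ : HasDerivAt γ γ' t) : HasDerivAt (fun t => theta k (γ t) t)
      (γ' * theta (k + 1) (γ t) t + theta (k + 2) (γ t) t / (4 * Real.pi * Complex.I)) t := by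
  have h := HasFDerivAt.comp_hasDerivAt (f := fun t => (γ t, t)) t
    (hasStrictFDerivAt_theta k (p := (γ t, t)) ht).hasFDerivAt (hγ.prodMk (hasDerivAt_id t))
  simpa using! h

/-! ### Quasi-periodicity of the theta function -/

theorem theta_add_one (z : ℂ) {t : ℂ} (ht : 0 < t.im) : theta 0 (z + 1) t = -theta 0 z t := by
  refine (hasSum_theta 0 (z + 1) ht).unique ?_
  convert! (hasSum_theta 0 z ht).neg using 2 with n
  have h : Complex.exp (thetaExp n (z + 1) t) = -Complex.exp (thetaExp n z t) := by
    have h1 : thetaExp n (z + 1) t =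
        thetaExp n z t + (n * (2 * Real.pi * Complex.I) + Real.pi * Complex.I) := by
      rw [thetaExp, thetaExp]; ring
    rw [h1, Complex.exp_add, Complex.exp_add, Complex.exp_int_mul_two_pi_mul_I,
      Complex.exp_pi_mul_I]
    ring
  rw [thetaTerm, thetaTerm, h]
  ring

theorem theta_add_tau (z : ℂ) {t : ℂ} (ht : 0 < t.im) : theta 0 (z + t) t =
    -Complex.exp (-(Real.pi * Complex.I * t) - 2 * Real.pi * Complex.I * z) * theta 0 z t := by
  have h0 := (Equiv.addRight (1 : ℤ)).hasSum_iff.mpr (hasSum_theta 0 z ht)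
  refine (hasSum_theta 0 (z + t) ht).unique ?_
  convert! h0.mul_left
    (-Complex.exp (-(Real.pi * Complex.I * t) - 2 * Real.pi * Complex.I * z)) using 2 with n
  have h1 : thetaExp n (z + t) t =
      (-(Real.pi * Complex.I * t) - 2 * Real.pi * Complex.I * z) + thetaExp (n + 1) z t := by
    rw [thetaExp, thetaExp]; push_cast; ring
  simp only [Function.comp_apply, Equiv.coe_addRight, thetaTerm, pow_zero, mul_one]
  rw [h1, Complex.exp_add, zpow_add_one₀ (by norm_num)]
  ring

theorem theta_neg (z : ℂ) {t : ℂ} (ht : 0 < t.im) : theta 0 (-z) t = -theta 0 z t := by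
  have h0 := (Equiv.subLeft (-1 : ℤ)).hasSum_iff.mpr (hasSum_theta 0 z ht)
  refine (hasSum_theta 0 (-z) ht).unique ?_
  convert! h0.neg using 2 with n
  have h1 : thetaExp n (-z) t = thetaExp (-1 - n) z t := by
    rw [thetaExp, thetaExp]; push_cast; ring
  simp only [Function.comp_apply, Equiv.subLeft_apply, thetaTerm, pow_zero, mul_one]
  rw [h1, zpow_sub₀ (by norm_num), zpow_neg_one, inv_neg, inv_one]
  rcases Int.even_or_odd n with h | h
  · simp [h.neg_one_zpow]
  · simp [h.neg_one_zpow]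

theorem theta_zero {t : ℂ} (ht : 0 < t.im) : theta 0 0 t = 0 := by
  have := theta_neg 0 ht
  rw [neg_zero] at this
  linear_combination this / 2

/-- On the real interval [0, 1] the series times exp(-πix) is a Fourier series; its constant
coefficient exp(πit/4) is not zero. -/
theorem exists_theta_ne_zero {t : ℂ} (ht : 0 < t.im) : ∃ z, theta 0 z t ≠ 0 := by
  by_contra! h
  have hs : ∀ x : ℝ, HasSum (fun n : ℤ => thetaTerm 0 n x t *
      Complex.exp (-(Real.pi * Complex.I * x))) 0 := by
    intro x
    have := (hasSum_theta 0 x ht).mul_right (Complex.exp (-(Real.pi * Complex.I * x)))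
    rwa [h x, zero_mul] at this
  have key := intervalIntegral.hasSum_integral_of_dominated_convergence (a := 0) (b := 1)
    (μ := MeasureTheory.volume) (f := fun _ => (0 : ℂ))
    (F := fun (n : ℤ) (x : ℝ) => thetaTerm 0 n x t * Complex.exp (-(Real.pi * Complex.I * x)))
    (fun n _ => thetaBound 0 0 t.im n)
    (fun n => by
      apply Continuous.aestronglyMeasurable
      unfold thetaTerm thetaExp
      fun_prop)
    (fun n => .of_forall fun x _ => by
      rw [norm_mul]
      have h1 : ‖Complex.exp (-(Real.pi * Complex.I * x))‖ = 1 := by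
        rw [show -(Real.pi * Complex.I * (x : ℂ)) = ((-(Real.pi * x) : ℝ) : ℂ) * Complex.I by
          push_cast; ring, Complex.norm_exp_ofReal_mul_I]
      rw [h1, mul_one]
      exact norm_thetaTerm_le 0 n ht (by simp) le_rfl)
    (.of_forall fun x _ => summable_thetaBound 0 0 ht)
    intervalIntegrable_const (.of_forall fun x _ => hs x)
  have hint : ∀ n : ℤ, ∫ x in (0 : ℝ)..1,
      thetaTerm 0 n x t * Complex.exp (-(Real.pi * Complex.I * x)) =
      if n = 0 then Complex.exp (Real.pi * Complex.I * (1 / 2) ^ 2 * t) else 0 := by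
    intro n
    have h1 : ∀ x : ℝ, thetaTerm 0 n x t * Complex.exp (-(Real.pi * Complex.I * x)) =
        (-1) ^ n * Complex.exp (Real.pi * Complex.I * (n + 1 / 2) ^ 2 * t) *
          Complex.exp (n * (2 * Real.pi * Complex.I) * x) := by
      intro x
      rw [thetaTerm, pow_zero, mul_one, mul_assoc ((-1) ^ n) (Complex.exp _), mul_assoc ((-1) ^ n) (Complex.exp _), ← Complex.exp_add,
        ← Complex.exp_add, thetaExp]
      congr 2
      ring
    simp only [h1]
    rw [intervalIntegral.integral_const_mul]
    split_ifs with hn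
    · subst hn; simp
    · have hc : (n : ℂ) * (2 * Real.pi * Complex.I) ≠ 0 :=
        mul_ne_zero (Int.cast_ne_zero.mpr hn) Complex.two_pi_I_ne_zero
      rw [integral_exp_mul_complex hc]
      simp [Complex.exp_int_mul_two_pi_mul_I]
  simp only [hint, intervalIntegral.integral_zero] at key
  exact Complex.exp_ne_zero _ ((hasSum_ite_eq (0 : ℤ) _).unique key)

/-! ### Theta and sigma -/

section

variable (τ : ℍ)

theorem periodic_of_one_tau {f : ℂ → ℂ} (h1 : ∀ z ∉ (periods τ).lattice, f (z + 1) = f z)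
    (h2 : ∀ z ∉ (periods τ).lattice, f (z + τ) = f z) :
    ∀ l ∈ (periods τ).lattice, ∀ z ∉ (periods τ).lattice, f (z + l) = f z := by
  have key : ∀ p ∈ (periods τ).lattice, (∀ z ∉ (periods τ).lattice, f (z + p) = f z) →
      ∀ n : ℤ, ∀ z ∉ (periods τ).lattice, f (z + n * p) = f z := by
    intro p hp hf n
    induction n with
    | zero => intro z _; simp
    | succ n ih =>
      intro z hz
      have hm : ((n : ℤ) : ℂ) * p ∈ (periods τ).lattice := by
        rw [← zsmul_eq_mul]; exact Submodule.smul_mem _ _ hp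
      rw [← ih z hz, ← hf _ (notMem_add _ hz hm)]
      congr 1; push_cast; ring
    | pred n ih =>
      intro z hz
      have hm : ((-(n : ℤ) - 1 : ℤ) : ℂ) * p ∈ (periods τ).lattice := by
        rw [← zsmul_eq_mul]; exact Submodule.smul_mem _ _ hp
      rw [← ih z hz, ← hf _ (notMem_add _ hz hm)]
      congr 1; push_cast; ring
  intro l hl z hz
  obtain ⟨m, n, rfl⟩ := (mem_periods τ).mp hl
  have hm : (m : ℂ) ∈ (periods τ).lattice := (mem_periods τ).mpr ⟨m, 0, by simp⟩
  rw [← add_assoc, key _ (tau_mem τ) h2 n _ (notMem_add _ hz hm)]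
  simpa using key _ (one_mem τ) h1 m z hz

/-- The quotient of θ·exp(η₁z²) by σ is elliptic, since the Legendre relation matches the
multipliers under z ↦ z + τ. Its only possible pole, at 0, is removed by θ(0) = 0, so Liouville
applies. -/
theorem exists_theta_eq_sigma : ∃ k ≠ 0, ∀ z, theta 0 z τ =
    k * sigma (periods τ) z * Complex.exp (-(eta1 τ * z ^ 2)) := by
  have hτ : 0 < (τ : ℂ).im := τ.im_pos
  set f : ℂ → ℂ := fun z => theta 0 z τ * Complex.exp (eta1 τ * z ^ 2) / sigma (periods τ) z
    with hf
  have hper := periodic_of_one_tau τ (f := f) (by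
    intro z hz
    have e1 : Complex.exp (eta1 τ * (z + 1) ^ 2) =
        Complex.exp (eta1 τ * z ^ 2) * Complex.exp (2 * eta1 τ * (z + 1 / 2)) := by
      rw [← Complex.exp_add]; ring_nf
    have h0 := sigma_ne_zero _ hz
    simp only [hf, theta_add_one z hτ, sigma_add_one, e1]
    have := Complex.exp_ne_zero (2 * eta1 τ * (z + 1 / 2))
    field_simp) (by
    intro z hz
    have e1 : Complex.exp (-(Real.pi * Complex.I * τ) - 2 * Real.pi * Complex.I * z) *
        Complex.exp (eta1 τ * (z + τ) ^ 2) =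
        Complex.exp (eta1 τ * z ^ 2) * Complex.exp (2 * eta3 τ * (z + τ / 2)) := by
      rw [← Complex.exp_add, ← Complex.exp_add]
      congr 1
      linear_combination (2 * z + τ) * legendre τ
    have h0 := sigma_ne_zero _ hz
    have h1 := Complex.exp_ne_zero (2 * eta3 τ * (z + τ / 2))
    simp only [hf, theta_add_tau z hτ, sigma_add_tau]
    rw [div_eq_div_iff (mul_ne_zero (neg_ne_zero.mpr h1) h0) h0]
    linear_combination (-(theta 0 z τ * sigma (periods τ) z)) * e1)
  have hth : Differentiable ℂ fun z => theta 0 z τ := fun z =>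
    (hasDerivAt_theta_fst 0 z hτ).differentiableAt
  have hg : AnalyticAt ℂ (fun z => dslope (fun z => theta 0 z τ) 0 z *
      Complex.exp (eta1 τ * z ^ 2) / sigmaReg (periods τ) z) 0 := by
    have h1 : AnalyticAt ℂ (dslope (fun z => theta 0 z τ) 0) 0 := by
      obtain ⟨p, hp⟩ := hth.analyticAt 0
      exact ⟨_, hp.has_fpower_series_dslope_fslope⟩
    have h2 : AnalyticAt ℂ (fun z => Complex.exp (eta1 τ * z ^ 2)) 0 := by fun_prop
    exact (h1.mul h2).div ((differentiable_sigmaReg _).analyticAt 0) (by simp [sigmaReg_zero])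
  have hconst := fun z (hz : z ∉ (periods τ).lattice) => elliptic_eq_const (periods τ) hper
    (fun z hz => ((hth z).mul (by fun_prop)).div (differentiable_sigma _ z) (sigma_ne_zero _ hz))
    hg (by
      filter_upwards [self_mem_nhdsWithin] with z hz0
      have hz0' : z ≠ 0 := hz0
      have h4 := sub_smul_dslope (fun z => theta 0 z τ) 0 z
      simp only [sub_zero, smul_eq_mul, theta_zero hτ] at h4
      simp only [hf]
      rw [← h4, sigma_eq, mul_assoc, mul_div_mul_left _ _ hz0']) hz
  set k := (fun z => dslope (fun z => theta 0 z τ) 0 z *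
      Complex.exp (eta1 τ * z ^ 2) / sigmaReg (periods τ) z) 0
  have hoff : ∀ z ∉ (periods τ).lattice, theta 0 z τ =
      k * sigma (periods τ) z * Complex.exp (-(eta1 τ * z ^ 2)) := by
    intro z hz
    have h1 := hconst z hz
    have h0 := sigma_ne_zero _ hz
    have h2 := Complex.exp_ne_zero (eta1 τ * z ^ 2)
    simp only [hf] at h1
    rw [div_eq_iff h0] at h1
    rw [Complex.exp_neg, ← h1]
    field_simp
  have hall : ∀ z, theta 0 z τ =
      k * sigma (periods τ) z * Complex.exp (-(eta1 τ * z ^ 2)) := by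
    intro z
    refine eq_of_eventually_nhdsNE (g := fun z =>
      k * sigma (periods τ) z * Complex.exp (-(eta1 τ * z ^ 2))) (hth z).continuousAt
      (((continuousAt_const.mul (differentiable_sigma _ z).continuousAt)).mul (by fun_prop)) ?_
    filter_upwards [eventually_nhdsNE_notMem_lattice (periods τ) z] with w hw using hoff w hw
  refine ⟨k, ?_, hall⟩
  intro hk
  obtain ⟨z, hz⟩ := exists_theta_ne_zero hτ
  exact hz (by rw [hall, hk]; simp)

theorem theta_eq_zero_iff {z : ℂ} : theta 0 z τ = 0 ↔ z ∈ (periods τ).lattice := by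
  obtain ⟨k, hk, h⟩ := exists_theta_eq_sigma τ
  rw [h, ← sigma_eq_zero_iff]
  simp [hk, Complex.exp_ne_zero]

end

/-! ### Logarithmic derivatives of theta -/

/-- `ζ(z) - 2 η₁ z`, the logarithmic derivative of the theta function. -/
def psi (τ : ℍ) (z : ℂ) : ℂ := zeta (periods τ) z - 2 * eta1 τ * z

/-- `℘(z) + 2 η₁` -/
def wpEta (τ : ℍ) (z : ℂ) : ℂ := (periods τ).weierstrassP z + 2 * eta1 τ

/-- `2πi` -/
def tpi : ℂ := 2 * Real.pi * Complex.I

theorem tpi_ne_zero : tpi ≠ 0 := Complex.two_pi_I_ne_zero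

section

variable (τ : ℍ) {z : ℂ}

theorem hasDerivAt_psi (hz : z ∉ (periods τ).lattice) :
    HasDerivAt (psi τ) (-wpEta τ z) z := by
  convert! (hasDerivAt_zeta _ hz).sub ((hasDerivAt_id z).const_mul (2 * eta1 τ)) using 1
  rw [wpEta]; ring

theorem hasDerivAt_wpEta (hz : z ∉ (periods τ).lattice) :
    HasDerivAt (wpEta τ) ((periods τ).derivWeierstrassP z) z :=
  (hasDerivAt_weierstrassP _ hz).add_const _

theorem theta_one_eq (hz : z ∉ (periods τ).lattice) :
    theta 1 z τ = psi τ z * theta 0 z τ := by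
  obtain ⟨k, -, h⟩ := exists_theta_eq_sigma τ
  have h1 : HasDerivAt (fun z => k * sigma (periods τ) z * Complex.exp (-(eta1 τ * z ^ 2)))
      (psi τ z * theta 0 z τ) z := by
    have h2 : HasDerivAt (fun z : ℂ => -(eta1 τ * z ^ 2)) (-(eta1 τ * (2 * z))) z := by
      simpa using! (((hasDerivAt_id z).pow 2).const_mul (eta1 τ)).neg
    convert! ((hasDerivAt_sigma _ hz).const_mul k).mul h2.cexp using 1
    rw [h, psi]; ring
  exact (hasDerivAt_theta_fst 0 z τ.im_pos).unique (by
    convert! h1 using 1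
    ext w
    rw [h])

/-- The recursion E ↦ E' + Eψ for the quotients of the z-derivatives of θ by θ; the formulas up to
order five are its iterates from E = ψ. -/
theorem theta_succ_eq {j : ℕ} {E : ℂ → ℂ} {E' : ℂ}
    (h : ∀ z ∉ (periods τ).lattice, theta j z τ = E z * theta 0 z τ)
    (hz : z ∉ (periods τ).lattice) (hE : HasDerivAt E E' z) :
    theta (j + 1) z τ = (E' + E z * psi τ z) * theta 0 z τ := by
  have h1 := hE.mul (hasDerivAt_theta_fst 0 z τ.im_pos)
  have h2 := (hasDerivAt_theta_fst j z τ.im_pos).unique (h1.congr_of_eventuallyEq (by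
    filter_upwards [eventually_notMem_lattice _ hz] with w hw using h w hw))
  rw [h2, theta_one_eq τ hz]
  ring

theorem theta_two_eq (hz : z ∉ (periods τ).lattice) :
    theta 2 z τ = (psi τ z ^ 2 - wpEta τ z) * theta 0 z τ := by
  rw [theta_succ_eq τ (fun z hz => theta_one_eq τ hz) hz (hasDerivAt_psi τ hz)]
  ring

theorem theta_three_eq (hz : z ∉ (periods τ).lattice) :
    theta 3 z τ = (psi τ z ^ 3 - 3 * psi τ z * wpEta τ z - (periods τ).derivWeierstrassP z) *
      theta 0 z τ := by
  rw [theta_succ_eq τ (E := fun z => psi τ z ^ 2 - wpEta τ z) (fun z hz => theta_two_eq τ hz) hz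
    (((hasDerivAt_psi τ hz).pow 2).sub (hasDerivAt_wpEta τ hz))]
  simp only [Nat.cast_ofNat]
  ring

theorem theta_four_eq (hz : z ∉ (periods τ).lattice) :
    theta 4 z τ = (psi τ z ^ 4 - 6 * psi τ z ^ 2 * wpEta τ z + 3 * wpEta τ z ^ 2
      - 4 * psi τ z * (periods τ).derivWeierstrassP z
      - (6 * (periods τ).weierstrassP z ^ 2 - (periods τ).g₂ / 2)) * theta 0 z τ := by
  rw [theta_succ_eq τ (E := fun z => psi τ z ^ 3 - 3 * psi τ z * wpEta τ z
      - (periods τ).derivWeierstrassP z) (fun z hz => theta_three_eq τ hz) hz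
    ((((hasDerivAt_psi τ hz).pow 3).sub (((hasDerivAt_psi τ hz).const_mul 3).mul
      (hasDerivAt_wpEta τ hz))).sub (hasDerivAt_derivWeierstrassP _ hz))]
  simp only [Nat.cast_ofNat]
  ring

theorem theta_five_eq (hz : z ∉ (periods τ).lattice) :
    theta 5 z τ = (psi τ z ^ 5 - 10 * psi τ z ^ 3 * wpEta τ z + 15 * psi τ z * wpEta τ z ^ 2
      - 10 * psi τ z ^ 2 * (periods τ).derivWeierstrassP z
      + 10 * wpEta τ z * (periods τ).derivWeierstrassP z
      - 5 * psi τ z * (6 * (periods τ).weierstrassP z ^ 2 - (periods τ).g₂ / 2)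
      - 12 * (periods τ).weierstrassP z * (periods τ).derivWeierstrassP z) * theta 0 z τ := by
  have hψ := hasDerivAt_psi τ hz
  have hS := hasDerivAt_wpEta τ hz
  have hP := hasDerivAt_weierstrassP _ hz
  have hQ := hasDerivAt_derivWeierstrassP _ hz
  rw [theta_succ_eq τ (E := fun z => psi τ z ^ 4 - 6 * psi τ z ^ 2 * wpEta τ z
      + 3 * wpEta τ z ^ 2 - 4 * psi τ z * (periods τ).derivWeierstrassP z
      - (6 * (periods τ).weierstrassP z ^ 2 - (periods τ).g₂ / 2))
    (fun z hz => theta_four_eq τ hz) hz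
    (((((hψ.pow 4).sub (((hψ.pow 2).const_mul 6).mul hS)).add ((hS.pow 2).const_mul 3)).sub
      ((hψ.const_mul 4).mul hQ)).sub (((hP.pow 2).const_mul 6).sub_const _))]
  simp only [Nat.cast_ofNat, Pi.pow_apply]
  ring

end

/-! ### Differentiation with respect to `τ` -/

section

variable {τ : ℍ} {γ : ℂ → ℂ} {γ' : ℂ}

theorem eventually_coe_ofComplex (τ : ℍ) :
    ∀ᶠ t : ℂ in 𝓝 (τ : ℂ), 0 < t.im ∧ ((ofComplex t : ℍ) : ℂ) = t := by
  filter_upwards [isOpen_upperHalfPlaneSet.mem_nhds (show (τ : ℂ) ∈ _ from τ.im_pos)] with t ht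
  exact ⟨ht, by rw [ofComplex_apply_of_im_pos ht]⟩

/-- The lattice moves with t. Being off it is an open condition because it means that the jointly
continuous theta function is nonzero. -/
theorem eventually_comp_notMem (hγ : ContinuousAt γ τ) (hz : γ τ ∉ (periods τ).lattice) :
    ∀ᶠ t : ℂ in 𝓝 (τ : ℂ), γ t ∉ (periods (ofComplex t)).lattice := by
  have h0 : theta 0 (γ τ) τ ≠ 0 := fun h => hz ((theta_eq_zero_iff τ).mp h)
  have hc : ContinuousAt (fun t : ℂ => theta 0 (γ t) t) τ :=
    ContinuousAt.comp (f := fun t : ℂ => (γ t, t)) (x := (τ : ℂ))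
      (continuousAt_theta 0 (p := (γ τ, (τ : ℂ))) τ.im_pos) (hγ.prodMk continuousAt_id)
  filter_upwards [hc.eventually_ne h0, eventually_coe_ofComplex τ] with t ht ht' hmem
  have := (theta_eq_zero_iff (ofComplex t)).mpr hmem
  rw [ht'.2] at this
  exact ht this

theorem hasDerivAt_theta_div (k : ℕ) (hγ : HasDerivAt γ γ' τ) (hz : γ τ ∉ (periods τ).lattice) :
    HasDerivAt (fun t : ℂ => theta k (γ t) t / theta 0 (γ t) t)
      (((γ' * theta (k + 1) (γ τ) τ + theta (k + 2) (γ τ) τ / (2 * tpi)) * theta 0 (γ τ) τ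
        - theta k (γ τ) τ * (γ' * theta 1 (γ τ) τ + theta 2 (γ τ) τ / (2 * tpi)))
        / theta 0 (γ τ) τ ^ 2) τ := by
  have h0 : theta 0 (γ τ) τ ≠ 0 := fun h => hz ((theta_eq_zero_iff τ).mp h)
  have hc : 2 * tpi = 4 * Real.pi * Complex.I := by rw [tpi]; ring
  rw [hc]
  exact (hasDerivAt_theta_comp k τ.im_pos hγ).div (hasDerivAt_theta_comp 0 τ.im_pos hγ) h0

theorem theta_div_eq (hγ : ContinuousAt γ τ) (hz : γ τ ∉ (periods τ).lattice) :
    ∀ᶠ t : ℂ in 𝓝 (τ : ℂ), theta 1 (γ t) t / theta 0 (γ t) t = psi (ofComplex t) (γ t) ∧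
      theta 2 (γ t) t / theta 0 (γ t) t =
        psi (ofComplex t) (γ t) ^ 2 - wpEta (ofComplex t) (γ t) ∧
      theta 3 (γ t) t / theta 0 (γ t) t =
        psi (ofComplex t) (γ t) ^ 3 - 3 * psi (ofComplex t) (γ t) * wpEta (ofComplex t) (γ t)
          - (periods (ofComplex t)).derivWeierstrassP (γ t) := by
  filter_upwards [eventually_comp_notMem hγ hz, eventually_coe_ofComplex τ] with t ht ht'
  have h0 : theta 0 (γ t) (ofComplex t : ℍ) ≠ 0 :=
    fun h => ht ((theta_eq_zero_iff (ofComplex t)).mp h)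
  have h1 := theta_one_eq _ ht
  have h2 := theta_two_eq _ ht
  have h3 := theta_three_eq _ ht
  rw [ht'.2] at h0 h1 h2 h3
  exact ⟨by rw [h1, mul_div_cancel_right₀ _ h0], by rw [h2, mul_div_cancel_right₀ _ h0],
    by rw [h3, mul_div_cancel_right₀ _ h0]⟩

/-- ψ is a quotient of theta derivatives, so the heat equation trades its τ-derivative for
z-derivatives up to order three. The velocity γ' occurs only in ψ + 2πiγ'. -/
theorem hasDerivAt_psi_comp (hγ : HasDerivAt γ γ' τ) (hz : γ τ ∉ (periods τ).lattice) :
    HasDerivAt (fun t : ℂ => psi (ofComplex t) (γ t))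
      ((-(1 / 2) * (periods τ).derivWeierstrassP (γ τ)
        - (psi τ (γ τ) + tpi * γ') * wpEta τ (γ τ)) / tpi) τ := by
  have h0 : theta 0 (γ τ) τ ≠ 0 := fun h => hz ((theta_eq_zero_iff τ).mp h)
  have hc := tpi_ne_zero
  refine HasDerivAt.congr_of_eventuallyEq ?_ ((theta_div_eq hγ.continuousAt hz).mono
    fun t ht => ht.1.symm)
  convert! hasDerivAt_theta_div 1 hγ hz using 1
  rw [theta_three_eq τ hz, theta_two_eq τ hz, theta_one_eq τ hz]
  field_simp
  ring

theorem hasDerivAt_wpEta_comp (hγ : HasDerivAt γ γ' τ) (hz : γ τ ∉ (periods τ).lattice) :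
    HasDerivAt (fun t : ℂ => wpEta (ofComplex t) (γ t))
      (((psi τ (γ τ) + tpi * γ') * (periods τ).derivWeierstrassP (γ τ)
        + 3 * (periods τ).weierstrassP (γ τ) ^ 2 - (periods τ).g₂ / 4
        - wpEta τ (γ τ) ^ 2) / tpi) τ := by
  have h0 : theta 0 (γ τ) τ ≠ 0 := fun h => hz ((theta_eq_zero_iff τ).mp h)
  have hc := tpi_ne_zero
  have h1 := hasDerivAt_psi_comp hγ hz
  have h2 := hasDerivAt_theta_div 2 hγ hz
  refine HasDerivAt.congr_of_eventuallyEq (f := fun t => psi (ofComplex t) (γ t) ^ 2 -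
    theta 2 (γ t) t / theta 0 (γ t) t) ?_ ((theta_div_eq hγ.continuousAt hz).mono
    fun t ht => by simp only [ht.2.1]; ring)
  convert! (h1.pow 2).sub h2 using 1
  rw [theta_four_eq τ hz, theta_three_eq τ hz, theta_two_eq τ hz, theta_one_eq τ hz]
  simp only [ofComplex_apply, Nat.cast_ofNat]
  field_simp
  ring

/-- Since e₁ + e₂ + e₃ = 0, the sum of ℘ + 2η₁ over the three half periods is 6η₁; the terms with ψ
drop out because ℘' vanishes there. -/
theorem hasDerivAt_eta1 (τ : ℍ) : HasDerivAt (fun t : ℂ => eta1 (ofComplex t))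
    ((-2 * eta1 τ ^ 2 + (periods τ).g₂ / 24) / tpi) τ := by
  have hc := tpi_ne_zero
  have h1 := hasDerivAt_wpEta_comp (τ := τ) (hasDerivAt_const (τ : ℂ) (1 / 2)) (half_notMem τ)
  have h3 := hasDerivAt_wpEta_comp (τ := τ) ((hasDerivAt_id (τ : ℂ)).div_const 2)
    (tau_half_notMem τ)
  have h2 := hasDerivAt_wpEta_comp (τ := τ) (γ := fun t => -(1 / 2) - t / 2)
    (((hasDerivAt_id (τ : ℂ)).div_const 2).const_sub (-(1 / 2))) (neg_half_sub_notMem τ)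
  refine HasDerivAt.congr_of_eventuallyEq (f := fun t => (wpEta (ofComplex t) (1 / 2) +
    wpEta (ofComplex t) (-(1 / 2) - t / 2) + wpEta (ofComplex t) (t / 2)) / 6) ?_ ?_
  · convert! ((h1.add h2).add h3).div_const 6 using 1
    have hs := e_sum τ
    have hg := g₂_eq τ
    simp only [id, derivWeierstrassP_half, derivWeierstrassP_tau_half,
      derivWeierstrassP_neg_half_sub, wpEta]
    rw [e1, e2, e3] at hs hg
    linear_combination (hg / 6 + 2 / 3 * eta1 τ * hs) / tpi
  · filter_upwards [eventually_coe_ofComplex τ] with t ht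
    have hs := e_sum (ofComplex t)
    simp only [e1, e2, e3, ht.2] at hs
    simp only [wpEta]
    linear_combination (-1 / 6) * hs

theorem hasDerivAt_weierstrassP_comp (hγ : HasDerivAt γ γ' τ) (hz : γ τ ∉ (periods τ).lattice) :
    HasDerivAt (fun t : ℂ => (periods (ofComplex t)).weierstrassP (γ t))
      (((psi τ (γ τ) + tpi * γ') * (periods τ).derivWeierstrassP (γ τ)
        + 2 * (periods τ).weierstrassP (γ τ) ^ 2 - 4 * eta1 τ * (periods τ).weierstrassP (γ τ)
        - (periods τ).g₂ / 3) / tpi) τ := by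
  have hc := tpi_ne_zero
  convert! (hasDerivAt_wpEta_comp hγ hz).sub ((hasDerivAt_eta1 τ).const_mul 2) using 1
  · ext t
    simp only [wpEta, Pi.sub_apply]
    ring
  · rw [wpEta]
    field_simp
    ring

/-- ℘' is read off from the third theta quotient, so the heat equation requires theta derivatives up
to order five. -/
theorem hasDerivAt_derivWeierstrassP_comp (hγ : HasDerivAt γ γ' τ)
    (hz : γ τ ∉ (periods τ).lattice) :
    HasDerivAt (fun t : ℂ => (periods (ofComplex t)).derivWeierstrassP (γ t))
      (((psi τ (γ τ) + tpi * γ') *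
          (6 * (periods τ).weierstrassP (γ τ) ^ 2 - (periods τ).g₂ / 2)
        + 3 * (periods τ).weierstrassP (γ τ) * (periods τ).derivWeierstrassP (γ τ)
        - 6 * eta1 τ * (periods τ).derivWeierstrassP (γ τ)) / tpi) τ := by
  have h0 : theta 0 (γ τ) τ ≠ 0 := fun h => hz ((theta_eq_zero_iff τ).mp h)
  have hc := tpi_ne_zero
  have h1 := hasDerivAt_psi_comp hγ hz
  have h2 := hasDerivAt_wpEta_comp hγ hz
  have h3 := hasDerivAt_theta_div 3 hγ hz
  refine HasDerivAt.congr_of_eventuallyEq (f := fun t => psi (ofComplex t) (γ t) ^ 3 -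
    3 * psi (ofComplex t) (γ t) * wpEta (ofComplex t) (γ t) -
    theta 3 (γ t) t / theta 0 (γ t) t) ?_ ((theta_div_eq hγ.continuousAt hz).mono
    fun t ht => by simp only [ht.2.2]; ring)
  convert! ((h1.pow 3).sub ((h1.const_mul 3).mul h2)).sub h3 using 1
  rw [theta_five_eq τ hz, theta_four_eq τ hz, theta_three_eq τ hz, theta_two_eq τ hz,
    theta_one_eq τ hz]
  simp only [ofComplex_apply, Nat.cast_ofNat, wpEta]
  field_simp
  ring

end

/-! ### Derivatives of `e_i`, `g₂`, `g₃` -/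

section

variable (τ : ℍ)

theorem eta3_eq : eta3 τ = eta1 τ * τ - tpi / 2 := by
  have := legendre τ
  rw [tpi]
  linear_combination -this

theorem hasDerivAt_e1 : HasDerivAt (fun t : ℂ => e1 (ofComplex t))
    ((2 * e1 τ ^ 2 - 4 * eta1 τ * e1 τ - (periods τ).g₂ / 3) / tpi) τ := by
  convert! hasDerivAt_weierstrassP_comp (τ := τ) (hasDerivAt_const (τ : ℂ) (1 / 2))
    (half_notMem τ) using 1
  rw [derivWeierstrassP_half, e1]
  ring

theorem hasDerivAt_e3 : HasDerivAt (fun t : ℂ => e3 (ofComplex t))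
    ((2 * e3 τ ^ 2 - 4 * eta1 τ * e3 τ - (periods τ).g₂ / 3) / tpi) τ := by
  refine HasDerivAt.congr_of_eventuallyEq (f := fun t =>
    (periods (ofComplex t)).weierstrassP (t / 2)) ?_ (by
      filter_upwards [eventually_coe_ofComplex τ] with t ht
      rw [e3, ht.2])
  convert! hasDerivAt_weierstrassP_comp (τ := τ) ((hasDerivAt_id (τ : ℂ)).div_const 2)
    (tau_half_notMem τ) using 1
  simp only [id]
  rw [derivWeierstrassP_tau_half, e3]
  ring

theorem hasDerivAt_e2 : HasDerivAt (fun t : ℂ => e2 (ofComplex t))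
    ((2 * e2 τ ^ 2 - 4 * eta1 τ * e2 τ - (periods τ).g₂ / 3) / tpi) τ := by
  refine HasDerivAt.congr_of_eventuallyEq (f := fun t =>
    (periods (ofComplex t)).weierstrassP (-(1 / 2) - t / 2)) ?_ (by
      filter_upwards [eventually_coe_ofComplex τ] with t ht
      rw [e2, ht.2])
  convert! hasDerivAt_weierstrassP_comp (τ := τ) (γ := fun t => -(1 / 2) - t / 2)
    (((hasDerivAt_id (τ : ℂ)).div_const 2).const_sub (-(1 / 2))) (neg_half_sub_notMem τ) using 1
  rw [derivWeierstrassP_neg_half_sub, e2]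
  ring

theorem hasDerivAt_g₂ : HasDerivAt (fun t : ℂ => (periods (ofComplex t)).g₂)
    ((6 * (periods τ).g₃ - 8 * eta1 τ * (periods τ).g₂) / tpi) τ := by
  have h := ((((hasDerivAt_e1 τ).pow 2).add ((hasDerivAt_e2 τ).pow 2)).add
    ((hasDerivAt_e3 τ).pow 2)).const_mul 2
  convert! h using 1
  · ext t; simp [g₂_eq]
  · have he : e3 τ = -e1 τ - e2 τ := by linear_combination e_sum τ
    simp only [ofComplex_apply, g₂_eq, g₃_eq, Nat.cast_ofNat]
    rw [he]
    ring

theorem hasDerivAt_g₃ : HasDerivAt (fun t : ℂ => (periods (ofComplex t)).g₃)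
    (((periods τ).g₂ ^ 2 / 3 - 12 * eta1 τ * (periods τ).g₃) / tpi) τ := by
  have h := (((hasDerivAt_e1 τ).mul (hasDerivAt_e2 τ)).mul (hasDerivAt_e3 τ)).const_mul 4
  convert! h using 1
  · ext t; simp [g₃_eq]
  · have he : e3 τ = -e1 τ - e2 τ := by linear_combination e_sum τ
    simp only [ofComplex_apply, g₂_eq, g₃_eq, Pi.mul_apply]
    rw [he]
    ring

/-! ### Derivatives along `ω = C₁ ω₃ - C₃ ω₁` -/

variable (C₁ C₃ : ℂ)

/-- By Legendre, η = 2η₁ω - 2πi dω/dτ with dω/dτ = C₁/2. Hence ζ(ω) - η is precisely the combination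
ψ + 2πiγ' of the derivative formulas, and the system along ω closes. -/
theorem zetaSubEta_eq : zetaSubEta C₁ C₃ τ = psi τ (om C₁ C₃ τ) + tpi * (C₁ / 2) := by
  rw [zetaSubEta, psi, eta3_eq, om]
  ring

theorem hasDerivAt_om : HasDerivAt (fun t : ℂ => C₁ * (t / 2) - C₃ * (1 / 2)) (C₁ / 2) (τ : ℂ) := by
  convert! (((hasDerivAt_id (τ : ℂ)).div_const 2).const_mul C₁).sub_const (C₃ * (1 / 2)) using 1
  ring

theorem eventually_om_eq : ∀ᶠ t : ℂ in 𝓝 (τ : ℂ),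
    om C₁ C₃ (ofComplex t) = C₁ * (t / 2) - C₃ * (1 / 2) := by
  filter_upwards [eventually_coe_ofComplex τ] with t ht
  rw [om, ht.2]

variable {τ C₁ C₃}

theorem hasDerivAt_wp_om (h : om C₁ C₃ τ ∉ (periods τ).lattice) :
    HasDerivAt (fun t : ℂ => (periods (ofComplex t)).weierstrassP (om C₁ C₃ (ofComplex t)))
      ((zetaSubEta C₁ C₃ τ * (periods τ).derivWeierstrassP (om C₁ C₃ τ)
        + 2 * (periods τ).weierstrassP (om C₁ C₃ τ) ^ 2
        - 4 * eta1 τ * (periods τ).weierstrassP (om C₁ C₃ τ) - (periods τ).g₂ / 3) / tpi) τ := by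
  rw [zetaSubEta_eq]
  exact (hasDerivAt_weierstrassP_comp (hasDerivAt_om τ C₁ C₃) h).congr_of_eventuallyEq
    ((eventually_om_eq τ C₁ C₃).mono fun t ht => by simp only [ht])

theorem hasDerivAt_wp'_om (h : om C₁ C₃ τ ∉ (periods τ).lattice) :
    HasDerivAt (fun t : ℂ => (periods (ofComplex t)).derivWeierstrassP (om C₁ C₃ (ofComplex t)))
      ((zetaSubEta C₁ C₃ τ * (6 * (periods τ).weierstrassP (om C₁ C₃ τ) ^ 2 - (periods τ).g₂ / 2)
        + 3 * (periods τ).weierstrassP (om C₁ C₃ τ) * (periods τ).derivWeierstrassP (om C₁ C₃ τ)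
        - 6 * eta1 τ * (periods τ).derivWeierstrassP (om C₁ C₃ τ)) / tpi) τ := by
  rw [zetaSubEta_eq]
  exact (hasDerivAt_derivWeierstrassP_comp (hasDerivAt_om τ C₁ C₃) h).congr_of_eventuallyEq
    ((eventually_om_eq τ C₁ C₃).mono fun t ht => by simp only [ht])

theorem hasDerivAt_zetaSubEta (h : om C₁ C₃ τ ∉ (periods τ).lattice) :
    HasDerivAt (fun t : ℂ => zetaSubEta C₁ C₃ (ofComplex t))
      ((-(1 / 2) * (periods τ).derivWeierstrassP (om C₁ C₃ τ)
        - zetaSubEta C₁ C₃ τ * ((periods τ).weierstrassP (om C₁ C₃ τ) + 2 * eta1 τ)) / tpi) τ := by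
  have h1 := ((hasDerivAt_psi_comp (hasDerivAt_om τ C₁ C₃) h).add_const (tpi * (C₁ / 2)))
  rw [zetaSubEta_eq]
  exact h1.congr_of_eventuallyEq
    ((eventually_om_eq τ C₁ C₃).mono fun t ht => by simp only [zetaSubEta_eq]; rw [ht])

end

/-! ### Algebra of the Hermite-Krichever formulas -/

/-- The algebraic conditions on `A = ℘(α)`, `A' = ℘'(α)`, `κ` for a Hermite-Krichever solution;
`h = 6b² - g₂/2` and `C = 4b³ - g₂b - g₃`. -/
def HKCond (b μ h C A A' κ : ℂ) : Prop :=
  κ ^ 2 = A + 2 * b + C * μ ^ 2 - h * μ ∧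
  2 * (κ ^ 2 + A + 2 * b) * (b - A) + 2 * κ * A' = μ * C ∧
  4 * κ * (A ^ 2 + A * b + b ^ 2) - μ * C * κ - A' * (κ ^ 2 + A + 2 * b)
    - κ * (12 * b ^ 2 - 2 * h) = 0

/-- The product of the three factors of `Q`. -/
def hkT (b μ h C : ℂ) : ℂ :=
  C ^ 2 * μ ^ 3 / 2 - C * h * μ ^ 2 + (3 * b * C + h ^ 2) * μ / 2 - 3 / 2 * h * b + C / 4

section algebra

variable {b μ h C A A' κ N s : ℂ}

/-- κ² and κA' contain s only through s², so each condition becomes a rational identity in b, μ, h,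
C, apart from a common factor s in the third. -/
theorem hkCond_of_formulas (hN : N = 2 * C * μ ^ 3 - 2 * h * μ ^ 2 + 4) (hN0 : N ≠ 0)
    (hs : s ^ 2 = N * hkT b μ h C)
    (hA : A = (b * N - 3 * C * μ ^ 2 + 4 * h * μ - 12 * b) / N)
    (hA' : A' = -4 * (C * μ ^ 3 - 2 * h * μ ^ 2 + 12 * b * μ - 4) / N ^ 2 * s)
    (hκ : κ = 2 * μ / N * s) : HKCond b μ h C A A' κ := by
  have k2 : κ ^ 2 = 4 * μ ^ 2 * hkT b μ h C / N := by
    rw [hκ, mul_pow, hs]; field_simp; ring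
  have kA : κ * A' = -8 * μ * (C * μ ^ 3 - 2 * h * μ ^ 2 + 12 * b * μ - 4) * hkT b μ h C /
      N ^ 2 := by
    rw [hκ, hA', show ∀ x y : ℂ, x * s * (y * s) = x * y * s ^ 2 by intros; ring, hs]
    field_simp; ring
  refine ⟨?_, ?_, ?_⟩
  · rw [k2, hA, hkT]; field_simp; rw [hN]; ring
  · rw [mul_assoc 2 κ A', kA, k2, hA, hkT]; field_simp; rw [hN]; ring
  · rw [k2, hκ, hA, hA', hkT]; field_simp; rw [hN]; ring

/-- The Weierstrass equation for the prescribed values; 12b² - 2h and -8b³ + 2hb - C are g₂ and g₃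
written through b, h, C. -/
theorem cubic_num_eq (hN : N = 2 * C * μ ^ 3 - 2 * h * μ ^ 2 + 4) (hN0 : N ≠ 0)
    (hs : s ^ 2 = N * hkT b μ h C)
    (hA : A = (b * N - 3 * C * μ ^ 2 + 4 * h * μ - 12 * b) / N)
    (hA' : A' = -4 * (C * μ ^ 3 - 2 * h * μ ^ 2 + 12 * b * μ - 4) / N ^ 2 * s) :
    A' ^ 2 = 4 * A ^ 3 - (12 * b ^ 2 - 2 * h) * A - (-8 * b ^ 3 + 2 * h * b - C) := by
  rw [hA', mul_pow, hs, hA, hkT]; field_simp; rw [hN]; ring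

/-- On the formulas the inversion denominators are s and 4s²/N; b and μ are then read off as
quotients. -/
theorem inversion_of_formulas (hN : N = 2 * C * μ ^ 3 - 2 * h * μ ^ 2 + 4) (hN0 : N ≠ 0)
    (hs : s ^ 2 = N * hkT b μ h C)
    (hA : A = (b * N - 3 * C * μ ^ 2 + 4 * h * μ - 12 * b) / N)
    (hA' : A' = -4 * (C * μ ^ 3 - 2 * h * μ ^ 2 + 12 * b * μ - 4) / N ^ 2 * s)
    (hκ : κ = 2 * μ / N * s) :
    κ ^ 3 - 3 * A * κ + A' = s ∧
    2 * A * κ ^ 3 - 3 * A' * κ ^ 2 + (6 * A ^ 2 - (12 * b ^ 2 - 2 * h)) * κ - A * A' = 2 * b * s ∧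
    -2 * A' * κ ^ 3 + (12 * A ^ 2 - (12 * b ^ 2 - 2 * h)) * κ ^ 2 - 6 * A * A' * κ + A' ^ 2 =
      4 * s ^ 2 / N := by
  have k2 : κ ^ 2 = 4 * μ ^ 2 * hkT b μ h C / N := by
    rw [hκ, mul_pow, hs]; field_simp; ring
  have kA : κ * A' = -8 * μ * (C * μ ^ 3 - 2 * h * μ ^ 2 + 12 * b * μ - 4) * hkT b μ h C /
      N ^ 2 := by
    rw [hκ, hA', show ∀ x y : ℂ, x * s * (y * s) = x * y * s ^ 2 by intros; ring, hs]
    field_simp; ring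
  refine ⟨?_, ?_, ?_⟩
  · rw [pow_succ κ 2, k2, hκ, hA, hA', hkT]; field_simp; rw [hN]; ring
  · rw [pow_succ κ 2, k2, hκ, hA, hA', hkT]; field_simp; rw [hN]; ring
  · rw [cubic_num_eq hN hN0 hs hA hA', show -2 * A' * κ ^ 3 + (12 * A ^ 2 - (12 * b ^ 2 - 2 * h)) *
      κ ^ 2 - 6 * A * A' * κ = -2 * (κ * A') * κ ^ 2 + (12 * A ^ 2 - (12 * b ^ 2 - 2 * h)) *
      κ ^ 2 - 6 * A * (κ * A') by ring, kA, k2, hs, hA, hkT]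
    field_simp; rw [hN]; ring

/-- The first two conditions give κ² and κA' as polynomials in A. Eliminating κ and A' leaves a
linear equation for A, and s is then recovered from κ, or from A' when μ = 0. -/
theorem formulas_of_hkCond (hC : C ≠ 0) (hN : N = 2 * C * μ ^ 3 - 2 * h * μ ^ 2 + 4) (hN0 : N ≠ 0)
    (hT : hkT b μ h C ≠ 0)
    (hE : A' ^ 2 = 4 * A ^ 3 - (12 * b ^ 2 - 2 * h) * A - (-8 * b ^ 3 + 2 * h * b - C))
    (H : HKCond b μ h C A A' κ) :
    ∃ s, s ^ 2 = N * hkT b μ h C ∧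
      A = (b * N - 3 * C * μ ^ 2 + 4 * h * μ - 12 * b) / N ∧
      A' = -4 * (C * μ ^ 3 - 2 * h * μ ^ 2 + 12 * b * μ - 4) / N ^ 2 * s ∧ κ = 2 * μ / N * s := by
  obtain ⟨E1, E2, E3⟩ := H
  have hkA : 2 * (κ * A') = μ * C - 2 * (2 * A + 4 * b + C * μ ^ 2 - h * μ) * (b - A) := by
    rw [E1] at E2; linear_combination E2
  have hA : A * N = b * N - 3 * C * μ ^ 2 + 4 * h * μ - 12 * b := by
    -- The third condition times 2κ gives (Cμ - h) times the linear equation for A. If that factor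
    -- vanishes, (2κA')² = 4κ²A'² combined with the Weierstrass cubic gives it with factor C
    -- instead.
    by_cases hc : C * μ = h
    · have h2 : (2 * (κ * A')) ^ 2 = 4 * (κ ^ 2 * A' ^ 2) := by ring
      rw [hkA, E1, hE, ← hc] at h2
      rw [hN, ← hc]
      apply mul_left_cancel₀ hC
      linear_combination (-1) * h2
    · apply mul_left_cancel₀ (sub_ne_zero.mpr hc)
      have h2 : (2 * (κ * A')) * (κ ^ 2 + A + 2 * b) = 2 * κ ^ 2 *
          (4 * (A ^ 2 + A * b + b ^ 2) - μ * C - (12 * b ^ 2 - 2 * h)) := by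
        linear_combination (-2 * κ) * E3
      rw [hkA, E1] at h2
      rw [hN]
      linear_combination h2
  have hA' : A = (b * N - 3 * C * μ ^ 2 + 4 * h * μ - 12 * b) / N := by
    rw [eq_div_iff hN0, hA]
  by_cases hμ : μ = 0
  · subst hμ
    have hN4 : N = 4 := by rw [hN]; ring
    subst hN4
    have hA2 : A = -2 * b := by linear_combination hA / 4
    have hκ : κ = 0 := by
      rw [hA2] at E1
      have : κ ^ 2 = 0 := by linear_combination E1
      simpa using this
    refine ⟨A', ?_, hA', ?_, ?_⟩
    · rw [hE, hA2, hkT]; ring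
    · ring
    · rw [hκ]; ring
  · have hk2 : κ ^ 2 * N = 4 * μ ^ 2 * hkT b μ h C := by
      rw [E1, hkT]
      linear_combination hA + (2 * b + C * μ ^ 2 - h * μ + b) * hN
    have hκ0 : κ ≠ 0 := by
      rintro rfl
      have : 4 * μ ^ 2 * hkT b μ h C = 0 := by rw [← hk2]; ring
      simp [hμ, hT] at this
    -- The formula for κ forces this value of s; the formula for A' is then checked after
    -- multiplication by 2κ, which is nonzero because T ≠ 0.
    refine ⟨κ * N / (2 * μ), ?_, hA', ?_, ?_⟩
    · have : (κ * N / (2 * μ)) ^ 2 = (κ ^ 2 * N) * N / (4 * μ ^ 2) := by ring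
      rw [this, hk2]; field_simp
    · apply mul_left_cancel₀ (mul_ne_zero two_ne_zero hκ0)
      rw [mul_assoc, hkA]
      have : 2 * κ * (-4 * (C * μ ^ 3 - 2 * h * μ ^ 2 + 12 * b * μ - 4) / N ^ 2 *
          (κ * N / (2 * μ))) = -4 * (C * μ ^ 3 - 2 * h * μ ^ 2 + 12 * b * μ - 4) *
            (κ ^ 2 * N) / (N ^ 2 * μ) := by field_simp
      rw [this, hk2, hA', hkT]
      field_simp; rw [hN]; ring
    · field_simp

end algebra

/-! ### The function `Φ₀` -/

section

variable (τ : ℍ) {α x : ℂ}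

theorem analyticAt_Phi0 (hx : x ∉ (periods τ).lattice) : AnalyticAt ℂ (Phi0 τ α) x := by
  have h1 : AnalyticAt ℂ (fun x => sigma (periods τ) (x - α)) x :=
    ((differentiable_sigma _).analyticAt _).comp (by fun_prop)
  have h2 : AnalyticAt ℂ (fun x => Complex.exp (zeta (periods τ) α * x)) x := by fun_prop
  exact (h1.div ((differentiable_sigma _).analyticAt x) (sigma_ne_zero _ hx)).mul h2

theorem Phi0_ne_zero (hx : x ∉ (periods τ).lattice) (hxα : x - α ∉ (periods τ).lattice) :
    Phi0 τ α x ≠ 0 :=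
  mul_ne_zero (div_ne_zero (sigma_ne_zero _ hxα) (sigma_ne_zero _ hx)) (Complex.exp_ne_zero _)

theorem hasDerivAt_Phi0 (hx : x ∉ (periods τ).lattice) (hxα : x - α ∉ (periods τ).lattice) :
    HasDerivAt (Phi0 τ α) ((zeta (periods τ) (x - α) - zeta (periods τ) x + zeta (periods τ) α) *
      Phi0 τ α x) x := by
  have h1 := (hasDerivAt_sigma _ hxα).comp_sub_const x α
  have h2 : HasDerivAt (fun x => Complex.exp (zeta (periods τ) α * x))
      (Complex.exp (zeta (periods τ) α * x) * zeta (periods τ) α) x := by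
    simpa using ((hasDerivAt_id x).const_mul (zeta (periods τ) α)).cexp
  have h0 := sigma_ne_zero _ hx
  convert! (h1.div (hasDerivAt_sigma _ hx) h0).mul h2 using 1
  simp only [Phi0, Pi.div_apply]
  field_simp

/-- The addition theorem makes the logarithmic derivative ζ(x - α) - ζ(x) + ζ(α) rational in ℘ and
℘'. -/
theorem deriv_Phi0 (hα : α ∉ (periods τ).lattice) (hx : x ∉ (periods τ).lattice)
    (hne : (periods τ).weierstrassP x ≠ (periods τ).weierstrassP α) :
    deriv (Phi0 τ α) x = ((periods τ).derivWeierstrassP x + (periods τ).derivWeierstrassP α) /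
      (2 * ((periods τ).weierstrassP x - (periods τ).weierstrassP α)) * Phi0 τ α x := by
  have h := hne
  rw [Ne, weierstrassP_eq_iff _ hx hα, not_or] at h
  rw [(hasDerivAt_Phi0 τ hx h.2).deriv, ← zeta_addition _ hx hα h.1 h.2]
  have := sub_ne_zero.mpr hne
  field_simp

/-- The Lamé equation. Differentiating the rational form of Φ₀'/Φ₀ proves it where ℘(x) ≠ ℘(α), and
continuity covers the remaining points. -/
theorem deriv_deriv_Phi0 (hα : α ∉ (periods τ).lattice) (hx : x ∉ (periods τ).lattice) :
    deriv (deriv (Phi0 τ α)) x =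
      (2 * (periods τ).weierstrassP x + (periods τ).weierstrassP α) * Phi0 τ α x := by
  have ha := analyticAt_Phi0 τ (α := α) hx
  refine eq_of_eventually_nhdsNE (g := fun x =>
    (2 * (periods τ).weierstrassP x + (periods τ).weierstrassP α) * Phi0 τ α x)
    ha.deriv.deriv.continuousAt
    (((continuousAt_const.mul (analyticAt_weierstrassP _ hx).continuousAt).add
      continuousAt_const).mul ha.continuousAt) ?_
  filter_upwards [eventually_nhdsNE_weierstrassP_ne _ hα x] with w hw
  obtain ⟨hwl, hne⟩ := hw
  have hP := hasDerivAt_weierstrassP _ hwl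
  have hQ := hasDerivAt_derivWeierstrassP _ hwl
  have h0 := sub_ne_zero.mpr hne
  have hφ := (hQ.add_const ((periods τ).derivWeierstrassP α)).div
    ((hP.sub_const ((periods τ).weierstrassP α)).const_mul 2) (mul_ne_zero two_ne_zero h0)
  have hΦ := (analyticAt_Phi0 τ (α := α) hwl).differentiableAt.hasDerivAt
  have h2 := (hφ.mul hΦ).congr_of_eventuallyEq (f₁ := deriv (Phi0 τ α)) (by
    filter_upwards [eventually_notMem_lattice _ hwl, hP.continuousAt.eventually_ne hne]
      with y hy hy'
    exact deriv_Phi0 τ hα hy hy')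
  rw [h2.deriv, deriv_Phi0 τ hα hwl hne]
  have e1 := (periods τ).derivWeierstrassP_sq w hwl
  have e2 := (periods τ).derivWeierstrassP_sq α hα
  simp only [Pi.div_apply]
  field_simp
  linear_combination (-Phi0 τ α w) * e1 + Phi0 τ α w * e2

/-! ### The linear differential equation -/

/-- The coefficient of `Φ₀` after substitution of the ansatz in the linear equation. -/
def ansatz0 (b μC p A κ c₀ c₁ X X' : ℂ) : ℂ :=
  -(X - b) * ((κ ^ 2 + A + p) * c₀ + 2 * κ * c₁ * (2 * X + A)) - μC * c₀
    + X' * (κ * c₀ + c₁ * (A + 2 * b))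

/-- The coefficient of `Φ₀'` after substitution of the ansatz in the linear equation. -/
def ansatz1 (b μC p A κ c₀ c₁ X X' : ℂ) : ℂ :=
  -(X - b) * (2 * κ * c₀ + (κ ^ 2 + A + p) * c₁) - μC * c₁ + X' * (c₀ + κ * c₁)

/-- The Lamé equation removes all derivatives of Φ₀ beyond the first, so substitution leaves one
coefficient for Φ₀ and one for Φ₀'. -/
theorem linear_ansatz (b μ κ c₀ c₁ : ℂ) (hα : α ∉ (periods τ).lattice)
    (hx : x ∉ (periods τ).lattice) (hb : (periods τ).weierstrassP x ≠ b) :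
    (-deriv (deriv fun x => Complex.exp (κ * x) * (c₀ * Phi0 τ α x + c₁ * deriv (Phi0 τ α) x)) x
      + (periods τ).derivWeierstrassP x / ((periods τ).weierstrassP x - b) *
        deriv (fun x => Complex.exp (κ * x) * (c₀ * Phi0 τ α x + c₁ * deriv (Phi0 τ α) x)) x
      + (-(μ * cubic τ b) / ((periods τ).weierstrassP x - b)
          + 2 * (periods τ).weierstrassP x - apparentP τ b μ) *
        (Complex.exp (κ * x) * (c₀ * Phi0 τ α x + c₁ * deriv (Phi0 τ α) x))) *
      ((periods τ).weierstrassP x - b) =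
    Complex.exp (κ * x) *
      (ansatz0 b (μ * cubic τ b) (apparentP τ b μ) ((periods τ).weierstrassP α) κ c₀ c₁
          ((periods τ).weierstrassP x) ((periods τ).derivWeierstrassP x) * Phi0 τ α x
        + ansatz1 b (μ * cubic τ b) (apparentP τ b μ) ((periods τ).weierstrassP α) κ c₀ c₁
          ((periods τ).weierstrassP x) ((periods τ).derivWeierstrassP x) *
            deriv (Phi0 τ α) x) := by
  have hexp : ∀ x : ℂ, HasDerivAt (fun x => Complex.exp (κ * x)) (Complex.exp (κ * x) * κ) x :=
    fun x => by simpa using ((hasDerivAt_id x).const_mul κ).cexp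
  have hΦ : ∀ x ∉ (periods τ).lattice, HasDerivAt (Phi0 τ α) (deriv (Phi0 τ α) x) x :=
    fun x hx => (analyticAt_Phi0 τ hx).differentiableAt.hasDerivAt
  have hΦ' : ∀ x ∉ (periods τ).lattice, HasDerivAt (deriv (Phi0 τ α))
      ((2 * (periods τ).weierstrassP x + (periods τ).weierstrassP α) * Phi0 τ α x) x := by
    intro x hx
    rw [← deriv_deriv_Phi0 τ hα hx]
    exact (analyticAt_Phi0 τ hx).deriv.differentiableAt.hasDerivAt
  have d1 : ∀ x ∉ (periods τ).lattice,
      HasDerivAt (fun x => Complex.exp (κ * x) * (c₀ * Phi0 τ α x + c₁ * deriv (Phi0 τ α) x))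
        (Complex.exp (κ * x) *
          ((κ * c₀ + c₁ * (2 * (periods τ).weierstrassP x + (periods τ).weierstrassP α)) *
            Phi0 τ α x + (κ * c₁ + c₀) * deriv (Phi0 τ α) x)) x := by
    intro x hx
    convert! (hexp x).mul (((hΦ x hx).const_mul c₀).add ((hΦ' x hx).const_mul c₁)) using 1
    simp only [Pi.add_apply]
    ring
  have d2 : deriv (deriv fun x =>
      Complex.exp (κ * x) * (c₀ * Phi0 τ α x + c₁ * deriv (Phi0 τ α) x)) x =
        Complex.exp (κ * x) *
          ((κ * (κ * c₀ + c₁ * (2 * (periods τ).weierstrassP x + (periods τ).weierstrassP α))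
            + c₁ * (2 * (periods τ).derivWeierstrassP x)
            + (κ * c₁ + c₀) * (2 * (periods τ).weierstrassP x + (periods τ).weierstrassP α)) *
            Phi0 τ α x
          + (κ * c₀ + c₁ * (2 * (periods τ).weierstrassP x + (periods τ).weierstrassP α)
            + κ * (κ * c₁ + c₀)) * deriv (Phi0 τ α) x) := by
    have h := (hexp x).mul ((((((((hasDerivAt_weierstrassP _ hx).const_mul 2).add_const
      ((periods τ).weierstrassP α)).const_mul c₁).const_add (κ * c₀))).mul (hΦ x hx)).add
        ((hΦ' x hx).const_mul (κ * c₁ + c₀)))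
    have h' := h.congr_of_eventuallyEq (f₁ := deriv fun x =>
      Complex.exp (κ * x) * (c₀ * Phi0 τ α x + c₁ * deriv (Phi0 τ α) x)) (by
        filter_upwards [eventually_notMem_lattice _ hx] with y hy
        rw [(d1 y hy).deriv]
        rfl)
    rw [h'.deriv]
    simp only [Pi.add_apply, Pi.mul_apply]
    ring
  have h0 := sub_ne_zero.mpr hb
  rw [d2, (d1 x hx).deriv, ansatz0, ansatz1]
  field_simp
  ring

theorem solvesLinear_iff (b μ κ c₀ c₁ : ℂ) (hα : α ∉ (periods τ).lattice) :
    SolvesLinear τ b μ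
      (fun x => Complex.exp (κ * x) * (c₀ * Phi0 τ α x + c₁ * deriv (Phi0 τ α) x)) ↔
    ∀ x ∉ (periods τ).lattice, (periods τ).weierstrassP x ≠ b →
      ansatz0 b (μ * cubic τ b) (apparentP τ b μ) ((periods τ).weierstrassP α) κ c₀ c₁
          ((periods τ).weierstrassP x) ((periods τ).derivWeierstrassP x) * Phi0 τ α x
        + ansatz1 b (μ * cubic τ b) (apparentP τ b μ) ((periods τ).weierstrassP α) κ c₀ c₁
          ((periods τ).weierstrassP x) ((periods τ).derivWeierstrassP x) *
            deriv (Phi0 τ α) x = 0 := by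
  refine forall_congr' fun x => forall_congr' fun hx => forall_congr' fun hb => ?_
  have h := linear_ansatz τ b μ κ c₀ c₁ hα hx hb
  have h0 := sub_ne_zero.mpr hb
  constructor
  · intro hl
    rw [hl, zero_mul, eq_comm, mul_eq_zero] at h
    exact h.resolve_left (Complex.exp_ne_zero _)
  · intro hr
    rw [hr, mul_zero, mul_eq_zero] at h
    exact h.resolve_right h0

theorem coeff_eq_zero_of_cubic {a₀ a₁ a₂ a₃ : ℂ} (S : Finset ℂ)
    (h : ∀ v ∉ S, a₀ + a₁ * v + a₂ * v ^ 2 + a₃ * v ^ 3 = 0) :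
    a₀ = 0 ∧ a₁ = 0 ∧ a₂ = 0 ∧ a₃ = 0 := by
  open Polynomial in
  set p : ℂ[X] := C a₀ + C a₁ * X + C a₂ * X ^ 2 + C a₃ * X ^ 3 with hp
  have h0 : p = 0 := by
    refine Polynomial.eq_zero_of_infinite_isRoot p (Set.Infinite.mono ?_
      (S.finite_toSet.infinite_compl))
    intro v hv
    simpa [hp] using h v (by simpa using hv)
  have hc := fun n => congrArg (fun q => Polynomial.coeff q n) h0
  have c0 := hc 0
  have c1 := hc 1
  have c2 := hc 2
  have c3 := hc 3
  simp only [hp] at c0 c1 c2 c3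
  simp [Polynomial.coeff_X, Polynomial.coeff_C, Polynomial.coeff_X_pow] at c0 c1 c2 c3
  exact ⟨c0, c1, c2, c3⟩

theorem isHermiteKrichever_iff (b μ κ : ℂ) (hα : α ∉ (periods τ).lattice) :
    IsHermiteKrichever τ b μ α κ ↔ HKCond b μ (6 * b ^ 2 - (periods τ).g₂ / 2) (cubic τ b)
      ((periods τ).weierstrassP α) ((periods τ).derivWeierstrassP α) κ := by
  classical
  set A := (periods τ).weierstrassP α with hA
  set A' := (periods τ).derivWeierstrassP α with hA'
  have hAA : A' ^ 2 = 4 * A ^ 3 - (periods τ).g₂ * A - (periods τ).g₃ :=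
    (periods τ).derivWeierstrassP_sq α hα
  constructor
  · rintro ⟨c₀, c₁, hc, hsol⟩
    rw [solvesLinear_iff τ b μ κ c₀ c₁ hα] at hsol
    set p := apparentP τ b μ with hp
    set C := cubic τ b with hC
    have hpt : ∀ x ∉ (periods τ).lattice, (periods τ).weierstrassP x ≠ b →
        (periods τ).weierstrassP x ≠ A →
        2 * ((periods τ).weierstrassP x - A) * ansatz0 b (μ * C) p A κ c₀ c₁
          ((periods τ).weierstrassP x) ((periods τ).derivWeierstrassP x) +
        ((periods τ).derivWeierstrassP x + A') * ansatz1 b (μ * C) p A κ c₀ c₁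
          ((periods τ).weierstrassP x) ((periods τ).derivWeierstrassP x) = 0 := by
      intro x hx hxb hxA
      have h1 := hsol x hx hxb
      rw [deriv_Phi0 τ hα hx hxA] at h1
      have h2 := hxA
      rw [hA, Ne, weierstrassP_eq_iff _ hx hα, not_or] at h2
      have h0 := sub_ne_zero.mpr hxA
      apply mul_right_cancel₀ (Phi0_ne_zero τ hx h2.2)
      rw [← hA, ← hA'] at h1
      field_simp at h1
      linear_combination h1
    -- Comparing x with -x separates the parts even and odd in ℘'. The excluded values of ℘ are
    -- those where a denominator vanishes (A, b) or ℘' does (the eᵢ), so the odd part can be divided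
    -- by ℘'.
    have hval : ∀ v ∉ ({A, b, e1 τ, e2 τ, e3 τ} : Finset ℂ),
        (2 * (v - A) * (-(v - b) * ((κ ^ 2 + A + p) * c₀ + 2 * κ * c₁ * (2 * v + A)) - μ * C * c₀)
          + A' * (-(v - b) * (2 * κ * c₀ + (κ ^ 2 + A + p) * c₁) - μ * C * c₁)
          + (c₀ + κ * c₁) * (4 * v ^ 3 - (periods τ).g₂ * v - (periods τ).g₃) = 0) ∧
        (2 * (v - A) * (κ * c₀ + c₁ * (A + 2 * b)) + A' * (c₀ + κ * c₁)
          - (v - b) * (2 * κ * c₀ + (κ ^ 2 + A + p) * c₁) - μ * C * c₁ = 0) := by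
      intro v hv
      simp only [Finset.mem_insert, Finset.mem_singleton, not_or] at hv
      obtain ⟨hvA, hvb, hv1, hv2, hv3⟩ := hv
      obtain ⟨x, hx, rfl⟩ := weierstrassP_surjective (periods τ) v
      have hsq := (periods τ).derivWeierstrassP_sq x hx
      have hne : (periods τ).derivWeierstrassP x ≠ 0 := by
        intro h
        have h3 := cubic_eq_sq τ hx
        rw [h, zero_pow two_ne_zero, eq_comm] at h3
        exact (notBranchValue_iff τ _).mp ⟨hv1, hv2, hv3⟩ h3
      have k1 := hpt x hx hvb hvA
      have k2 := hpt (-x) (notMem_neg _ hx) (by simpa using hvb) (by simpa using hvA)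
      simp only [weierstrassP_neg, derivWeierstrassP_neg] at k2
      rw [ansatz0, ansatz1] at k1 k2
      constructor
      · rw [← hsq]
        linear_combination k1 / 2 + k2 / 2
      · apply mul_left_cancel₀ hne
        linear_combination k1 / 2 - k2 / 2
    have hco1 := coeff_eq_zero_of_cubic (a₀ := -2 * A * b * ((κ ^ 2 + A + p) * c₀ + 2 * κ * c₁ * A)
        + 2 * A * μ * C * c₀ + A' * (b * (2 * κ * c₀ + (κ ^ 2 + A + p) * c₁) - μ * C * c₁)
        - (periods τ).g₃ * (c₀ + κ * c₁))
      (a₁ := -8 * κ * c₁ * A * b + 2 * ((κ ^ 2 + A + p) * c₀ + 2 * κ * c₁ * A) * (A + b)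
        - 2 * μ * C * c₀ - A' * (2 * κ * c₀ + (κ ^ 2 + A + p) * c₁)
        - (periods τ).g₂ * (c₀ + κ * c₁))
      (a₂ := -2 * ((κ ^ 2 + A + p) * c₀ + 2 * κ * c₁ * A) + 8 * κ * c₁ * (A + b))
      (a₃ := 4 * (c₀ + κ * c₁) - 8 * κ * c₁) _
      (fun v hv => by linear_combination (hval v hv).1)
    have hco2 := coeff_eq_zero_of_cubic (a₀ := -2 * A * (κ * c₀ + c₁ * (A + 2 * b))
        + A' * (c₀ + κ * c₁) + b * (2 * κ * c₀ + (κ ^ 2 + A + p) * c₁) - μ * C * c₁)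
      (a₁ := 2 * (κ * c₀ + c₁ * (A + 2 * b)) - (2 * κ * c₀ + (κ ^ 2 + A + p) * c₁))
      (a₂ := 0) (a₃ := 0) _ (fun v hv => by linear_combination (hval v hv).2)
    obtain ⟨-, f1, -, f3⟩ := hco1
    obtain ⟨f4, f5, -, -⟩ := hco2
    -- The leading coefficient of the even part fixes the ratio c₀ : c₁; hence c₁ ≠ 0 can be
    -- cancelled from the other coefficients, which become the three conditions.
    have hc0 : c₀ = κ * c₁ := by linear_combination f3 / 4
    have hc1 : c₁ ≠ 0 := by
      rintro rfl
      simp [hc0] at hc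
    subst hc0
    have hK : κ ^ 2 + p = A + 4 * b := by
      apply mul_left_cancel₀ hc1
      linear_combination -f5
    have hpe : p = A + 4 * b - κ ^ 2 := by linear_combination hK
    rw [hpe] at f1 f4
    have E2 : 2 * (κ ^ 2 + A + 2 * b) * (b - A) + 2 * κ * A' = μ * C := by
      apply mul_left_cancel₀ hc1
      linear_combination f4
    refine ⟨?_, E2, ?_⟩
    · rw [hp, apparentP] at hK
      linear_combination hK
    · apply mul_left_cancel₀ hc1
      linear_combination f1 / 2
  · rintro ⟨E1, E2, E3⟩
    -- Up to scaling, the only constants allowed by the other direction.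
    refine ⟨κ, 1, Or.inr one_ne_zero, ?_⟩
    rw [solvesLinear_iff τ b μ κ κ 1 hα]
    intro x hx _
    have hpe : apparentP τ b μ = A + 4 * b - κ ^ 2 := by
      rw [E1, apparentP]; ring
    rw [hpe]
    have hP := (analyticAt_weierstrassP (periods τ) hx).continuousAt
    have hP' := (analyticAt_derivWeierstrassP (periods τ) hx).continuousAt
    have hΦ := analyticAt_Phi0 τ (α := α) hx
    -- The rational form of Φ₀' is not available where ℘(x) = ℘(α); these points are reached by
    -- continuity.
    refine eq_of_eventually_nhdsNE (g := fun _ => (0 : ℂ)) (f := fun x =>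
      ansatz0 b (μ * cubic τ b) (A + 4 * b - κ ^ 2) A κ κ 1
          ((periods τ).weierstrassP x) ((periods τ).derivWeierstrassP x) * Phi0 τ α x
        + ansatz1 b (μ * cubic τ b) (A + 4 * b - κ ^ 2) A κ κ 1
          ((periods τ).weierstrassP x) ((periods τ).derivWeierstrassP x) *
            deriv (Phi0 τ α) x) ?_ continuousAt_const ?_
    · have h1 := hΦ.continuousAt
      have h2 := hΦ.deriv.continuousAt
      unfold ansatz0 ansatz1
      fun_prop
    · filter_upwards [eventually_nhdsNE_weierstrassP_ne _ hα x] with w hw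
      obtain ⟨hwl, hne⟩ := hw
      have h0 := sub_ne_zero.mpr hne
      have hsq := (periods τ).derivWeierstrassP_sq w hwl
      rw [deriv_Phi0 τ hα hwl hne, ansatz0, ansatz1, ← hA, ← hA']
      rw [← hA] at h0
      field_simp
      set X := (periods τ).weierstrassP w
      set X' := (periods τ).derivWeierstrassP w
      linear_combination Phi0 τ α w *
        (2 * (X - A) * E3 + (A' + X') * E2 - 2 * κ * hAA + 2 * κ * hsq)

end

/-! ### The Hermite-Krichever formulas -/

section

variable (τ : ℍ)

theorem hkDen_eq (b μ : ℂ) : hkDen τ b μ =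
    2 * cubic τ b * μ ^ 3 - 2 * (6 * b ^ 2 - (periods τ).g₂ / 2) * μ ^ 2 + 4 := by
  rw [hkDen]; ring

theorem neg_hkQ_eq (b μ : ℂ) : -hkQ τ b μ =
    hkDen τ b μ * hkT b μ (6 * b ^ 2 - (periods τ).g₂ / 2) (cubic τ b) := by
  have he : e3 τ = -e1 τ - e2 τ := by linear_combination e_sum τ
  rw [hkQ, neg_neg, hkT, cubic_eq_prod, g₂_eq, he]
  ring

theorem hkFormulas_iff (b μ s α κ : ℂ) : HKFormulas τ b μ s α κ ↔
    (periods τ).weierstrassP α = (b * hkDen τ b μ - 3 * cubic τ b * μ ^ 2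
        + 4 * (6 * b ^ 2 - (periods τ).g₂ / 2) * μ - 12 * b) / hkDen τ b μ ∧
    (periods τ).derivWeierstrassP α = -4 * (cubic τ b * μ ^ 3
        - 2 * (6 * b ^ 2 - (periods τ).g₂ / 2) * μ ^ 2 + 12 * b * μ - 4) / hkDen τ b μ ^ 2 * s ∧
    κ = 2 * μ / hkDen τ b μ * s := by
  have e1 : 2 * cubic τ b * b * μ ^ 3
        + (-24 * b ^ 3 + 4 * (periods τ).g₂ * b + 3 * (periods τ).g₃) * μ ^ 2
        + (24 * b ^ 2 - 2 * (periods τ).g₂) * μ - 8 * b = b * hkDen τ b μ - 3 * cubic τ b * μ ^ 2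
        + 4 * (6 * b ^ 2 - (periods τ).g₂ / 2) * μ - 12 * b := by
    rw [hkDen, cubic]; ring
  have e2 : cubic τ b * μ ^ 3 - (12 * b ^ 2 - (periods τ).g₂) * μ ^ 2 + 12 * b * μ - 4 =
      cubic τ b * μ ^ 3 - 2 * (6 * b ^ 2 - (periods τ).g₂ / 2) * μ ^ 2 + 12 * b * μ - 4 := by
    ring
  rw [HKFormulas, e1, e2]

theorem derivWeierstrassP_sq' (b : ℂ) {α : ℂ} (hα : α ∉ (periods τ).lattice) :
    (periods τ).derivWeierstrassP α ^ 2 = 4 * (periods τ).weierstrassP α ^ 3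
      - (12 * b ^ 2 - 2 * (6 * b ^ 2 - (periods τ).g₂ / 2)) * (periods τ).weierstrassP α
      - (-8 * b ^ 3 + 2 * (6 * b ^ 2 - (periods τ).g₂ / 2) * b - cubic τ b) := by
  rw [(periods τ).derivWeierstrassP_sq α hα, cubic]; ring

theorem isHermiteKrichever_iff_formulas {b μ : ℂ} (hb : NotBranchValue τ b)
    (hQ : hkQ τ b μ ≠ 0) {α : ℂ} (κ : ℂ) (hα : α ∉ (periods τ).lattice) :
    IsHermiteKrichever τ b μ α κ ↔ ∃ s : ℂ, s ^ 2 = -hkQ τ b μ ∧ HKFormulas τ b μ s α κ := by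
  rw [isHermiteKrichever_iff τ b μ κ hα]
  have hNT := neg_hkQ_eq τ b μ
  have hNT0 := hNT ▸ neg_ne_zero.mpr hQ
  have hN0 := left_ne_zero_of_mul hNT0
  have hT0 := right_ne_zero_of_mul hNT0
  simp only [hkFormulas_iff, hNT]
  constructor
  · exact formulas_of_hkCond ((notBranchValue_iff τ b).mp hb) (hkDen_eq τ b μ) hN0 hT0
      (derivWeierstrassP_sq' τ b hα)
  · rintro ⟨s, hs, h1, h2, h3⟩
    exact hkCond_of_formulas (hkDen_eq τ b μ) hN0 hs h1 h2 h3

theorem exists_isHermiteKrichever {b μ : ℂ} (hb : NotBranchValue τ b) (hQ : hkQ τ b μ ≠ 0) :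
    ∃ α κ : ℂ, α ∉ (periods τ).lattice ∧ IsHermiteKrichever τ b μ α κ := by
  have hNT := neg_hkQ_eq τ b μ
  have hN0 := left_ne_zero_of_mul (hNT ▸ neg_ne_zero.mpr hQ)
  obtain ⟨s, hs⟩ := IsAlgClosed.exists_pow_nat_eq (-hkQ τ b μ) two_pos
  obtain ⟨α, hα, hA⟩ := weierstrassP_surjective (periods τ) ((b * hkDen τ b μ
    - 3 * cubic τ b * μ ^ 2 + 4 * (6 * b ^ 2 - (periods τ).g₂ / 2) * μ - 12 * b) / hkDen τ b μ)
  set A' := -4 * (cubic τ b * μ ^ 3 - 2 * (6 * b ^ 2 - (periods τ).g₂ / 2) * μ ^ 2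
    + 12 * b * μ - 4) / hkDen τ b μ ^ 2 * s with hA'
  have hsq : (periods τ).derivWeierstrassP α ^ 2 = A' ^ 2 := by
    rw [cubic_num_eq (hkDen_eq τ b μ) hN0 (hs.trans hNT) hA hA', derivWeierstrassP_sq' τ b hα]
  -- Surjectivity fixes ℘(α), and the cubic then fixes ℘'(α) up to sign; replacing α by -α adjusts
  -- the sign.
  have key : ∃ β ∉ (periods τ).lattice, (periods τ).weierstrassP β = (periods τ).weierstrassP α ∧
      (periods τ).derivWeierstrassP β = A' := by
    rcases sq_eq_sq_iff_eq_or_eq_neg.mp hsq with h | h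
    · exact ⟨α, hα, rfl, h⟩
    · exact ⟨-α, notMem_neg _ hα, by simp, by simp [h]⟩
  obtain ⟨β, hβ, h1, h2⟩ := key
  refine ⟨β, 2 * μ / hkDen τ b μ * s, hβ, ?_⟩
  rw [isHermiteKrichever_iff_formulas τ hb hQ _ hβ]
  refine ⟨s, hs, ?_⟩
  rw [hkFormulas_iff]
  exact ⟨h1.trans hA, h2.trans hA', rfl⟩

theorem inversion_of_isHermiteKrichever {b μ : ℂ} (hb : NotBranchValue τ b)
    (hQ : hkQ τ b μ ≠ 0) {α κ : ℂ} (hα : α ∉ (periods τ).lattice)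
    (H : IsHermiteKrichever τ b μ α κ) :
    invDenB τ α κ ≠ 0 ∧ invDenMu τ α κ ≠ 0 ∧ b = invB τ α κ ∧ μ = invMu τ α κ := by
  rw [isHermiteKrichever_iff_formulas τ hb hQ κ hα] at H
  obtain ⟨s, hs, hF⟩ := H
  rw [hkFormulas_iff] at hF
  obtain ⟨h1, h2, h3⟩ := hF
  have hNT := neg_hkQ_eq τ b μ
  have hN0 := left_ne_zero_of_mul (hNT ▸ neg_ne_zero.mpr hQ)
  have hs0 : s ≠ 0 := by
    rintro rfl
    exact hQ (by linear_combination hs)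
  obtain ⟨k1, k2, k3⟩ := inversion_of_formulas (hkDen_eq τ b μ) hN0 (hs.trans hNT) h1 h2 h3
  have g : 12 * b ^ 2 - 2 * (6 * b ^ 2 - (periods τ).g₂ / 2) = (periods τ).g₂ := by ring
  rw [g] at k2 k3
  have d1 : invDenB τ α κ = s := k1
  have d2 : invDenMu τ α κ = 4 * s ^ 2 / hkDen τ b μ := k3
  have d2' : invDenMu τ α κ ≠ 0 := by
    rw [d2]; exact div_ne_zero (mul_ne_zero (by norm_num) (pow_ne_zero 2 hs0)) hN0
  refine ⟨by rwa [d1], d2', ?_, ?_⟩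
  · rw [invB, k2, d1]; field_simp
  · rw [invMu, d1, d2, h3]; field_simp; norm_num

end

/-! ### The explicit function as an inversion -/

section algebra

variable {P Q Z g₂ g₃ d M B μ : ℂ}

/-- The denominator M of μ₁ divides the value of the cubic at b₁, so M ≠ 0 as soon as b₁ is not a
branch value. -/
theorem cubic_of_inversion (hg : Q ^ 2 = 4 * P ^ 3 - g₂ * P - g₃) (hd : d = Z ^ 3 - 3 * P * Z - Q)
    (hd0 : d ≠ 0)
    (hM : M = 2 * Q * Z ^ 3 + (12 * P ^ 2 - g₂) * Z ^ 2 + 6 * P * Q * Z + Q ^ 2)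
    (hB : B = (2 * P * Z ^ 3 + 3 * Q * Z ^ 2 + (6 * P ^ 2 - g₂) * Z + P * Q) / (2 * d)) :
    4 * B ^ 3 - g₂ * B - g₃ = M * ((Z ^ 4 + 2 * Q * Z + 3 * P ^ 2 - g₂) *
      (3 * Q * Z ^ 2 + (12 * P ^ 2 - g₂) * Z + 3 * P * Q) / 2 - Q * d ^ 2) / d ^ 3 := by
  have hg' : g₃ = 4 * P ^ 3 - g₂ * P - Q ^ 2 := by linear_combination hg
  rw [hB, hg', hM]
  field_simp
  rw [hd]
  ring

/-- With P = ℘(ω), Q = ℘'(ω), Z = ζ(ω) - η, one finds N = 4d²/M. The second conclusion says -Q = d²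
for the discriminant Q of the formulas, so that Q is nonzero. -/
theorem hkCond_of_inversion (hg : Q ^ 2 = 4 * P ^ 3 - g₂ * P - g₃)
    (hd : d = Z ^ 3 - 3 * P * Z - Q) (hd0 : d ≠ 0)
    (hM : M = 2 * Q * Z ^ 3 + (12 * P ^ 2 - g₂) * Z ^ 2 + 6 * P * Q * Z + Q ^ 2) (hM0 : M ≠ 0)
    (hB : B = (2 * P * Z ^ 3 + 3 * Q * Z ^ 2 + (6 * P ^ 2 - g₂) * Z + P * Q) / (2 * d))
    (hμ : μ = 2 * d * Z / M) :
    HKCond B μ (6 * B ^ 2 - g₂ / 2) (4 * B ^ 3 - g₂ * B - g₃) P (-Q) Z ∧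
    (2 * (4 * B ^ 3 - g₂ * B - g₃) * μ ^ 3 - 2 * (6 * B ^ 2 - g₂ / 2) * μ ^ 2 + 4) *
      hkT B μ (6 * B ^ 2 - g₂ / 2) (4 * B ^ 3 - g₂ * B - g₃) = d ^ 2 := by
  rw [cubic_of_inversion hg hd hd0 hM hB]
  have hN : 2 * (M * ((Z ^ 4 + 2 * Q * Z + 3 * P ^ 2 - g₂) *
      (3 * Q * Z ^ 2 + (12 * P ^ 2 - g₂) * Z + 3 * P * Q) / 2 - Q * d ^ 2) / d ^ 3) * μ ^ 3
        - 2 * (6 * B ^ 2 - g₂ / 2) * μ ^ 2 + 4 = 4 * d ^ 2 / M := by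
    rw [hμ, hB]
    field_simp
    rw [hd, hM]
    ring
  refine ⟨⟨?_, ?_, ?_⟩, ?_⟩
  · rw [hμ, hB]
    field_simp
    rw [hd, hM]
    ring
  · rw [hμ, hB]
    field_simp
    rw [hd]
    ring
  · rw [hμ, hB]
    field_simp
    rw [hd]
    ring
  · rw [hN, hkT, hμ, hB]
    field_simp
    rw [hd, hM]
    ring

end algebra

section

variable (C₁ C₃ : ℂ) (τ : ℍ)

/-- The numerator of `b₁`. -/
def solNum : ℂ :=
  2 * (periods τ).weierstrassP (om C₁ C₃ τ) * zetaSubEta C₁ C₃ τ ^ 3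
    + 3 * (periods τ).derivWeierstrassP (om C₁ C₃ τ) * zetaSubEta C₁ C₃ τ ^ 2
    + (6 * (periods τ).weierstrassP (om C₁ C₃ τ) ^ 2 - (periods τ).g₂) * zetaSubEta C₁ C₃ τ
    + (periods τ).weierstrassP (om C₁ C₃ τ) * (periods τ).derivWeierstrassP (om C₁ C₃ τ)

/-- The denominator of `μ₁` at `α = -ω`, `κ = ζ(ω) - η`. -/
def solMuDen : ℂ :=
  2 * (periods τ).derivWeierstrassP (om C₁ C₃ τ) * zetaSubEta C₁ C₃ τ ^ 3
    + (12 * (periods τ).weierstrassP (om C₁ C₃ τ) ^ 2 - (periods τ).g₂) * zetaSubEta C₁ C₃ τ ^ 2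
    + 6 * (periods τ).weierstrassP (om C₁ C₃ τ) * (periods τ).derivWeierstrassP (om C₁ C₃ τ)
        * zetaSubEta C₁ C₃ τ
    + (periods τ).derivWeierstrassP (om C₁ C₃ τ) ^ 2

/-- The value of `μ₁` at `α = -ω`, `κ = ζ(ω) - η`. -/
def solMu : ℂ := 2 * solDen C₁ C₃ τ * zetaSubEta C₁ C₃ τ / solMuDen C₁ C₃ τ

theorem solB_eq_div : solB C₁ C₃ τ = solNum C₁ C₃ τ / (2 * solDen C₁ C₃ τ) := rfl

theorem invDenB_neg_om : invDenB τ (-om C₁ C₃ τ) (zetaSubEta C₁ C₃ τ) = solDen C₁ C₃ τ := by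
  rw [invDenB, weierstrassP_neg, derivWeierstrassP_neg, solDen]
  ring

theorem invDenMu_neg_om : invDenMu τ (-om C₁ C₃ τ) (zetaSubEta C₁ C₃ τ) = solMuDen C₁ C₃ τ := by
  rw [invDenMu, weierstrassP_neg, derivWeierstrassP_neg, solMuDen]
  ring

theorem invB_neg_om : invB τ (-om C₁ C₃ τ) (zetaSubEta C₁ C₃ τ) = solB C₁ C₃ τ := by
  rw [invB, invDenB_neg_om, solB, weierstrassP_neg, derivWeierstrassP_neg]
  ring

theorem invMu_neg_om : invMu τ (-om C₁ C₃ τ) (zetaSubEta C₁ C₃ τ) = solMu C₁ C₃ τ := by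
  rw [invMu, invDenB_neg_om, invDenMu_neg_om, solMu]

variable {C₁ C₃ τ}

theorem cubic_solB (hω : om C₁ C₃ τ ∉ (periods τ).lattice) (hd : solDen C₁ C₃ τ ≠ 0) :
    cubic τ (solB C₁ C₃ τ) = solMuDen C₁ C₃ τ *
      ((zetaSubEta C₁ C₃ τ ^ 4
        + 2 * (periods τ).derivWeierstrassP (om C₁ C₃ τ) * zetaSubEta C₁ C₃ τ
        + 3 * (periods τ).weierstrassP (om C₁ C₃ τ) ^ 2 - (periods τ).g₂) *
      (3 * (periods τ).derivWeierstrassP (om C₁ C₃ τ) * zetaSubEta C₁ C₃ τ ^ 2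
        + (12 * (periods τ).weierstrassP (om C₁ C₃ τ) ^ 2 - (periods τ).g₂) * zetaSubEta C₁ C₃ τ
        + 3 * (periods τ).weierstrassP (om C₁ C₃ τ) * (periods τ).derivWeierstrassP (om C₁ C₃ τ))
        / 2 - (periods τ).derivWeierstrassP (om C₁ C₃ τ) * solDen C₁ C₃ τ ^ 2)
      / solDen C₁ C₃ τ ^ 3 :=
  cubic_of_inversion ((periods τ).derivWeierstrassP_sq _ hω) rfl hd rfl rfl

theorem solMuDen_ne_zero (h : SolRegular C₁ C₃ τ) : solMuDen C₁ C₃ τ ≠ 0 := by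
  obtain ⟨hω, hd, hb⟩ := h
  rw [notBranchValue_iff, cubic_solB hω hd] at hb
  intro h
  simp [h] at hb

theorem isHermiteKrichever_solB (hω : om C₁ C₃ τ ∉ (periods τ).lattice)
    (hd : solDen C₁ C₃ τ ≠ 0) (hM : solMuDen C₁ C₃ τ ≠ 0) :
    hkQ τ (solB C₁ C₃ τ) (solMu C₁ C₃ τ) ≠ 0 ∧
    IsHermiteKrichever τ (solB C₁ C₃ τ) (solMu C₁ C₃ τ) (-om C₁ C₃ τ) (zetaSubEta C₁ C₃ τ) := by
  obtain ⟨h1, h2⟩ := hkCond_of_inversion ((periods τ).derivWeierstrassP_sq _ hω)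
    (d := solDen C₁ C₃ τ) rfl hd (M := solMuDen C₁ C₃ τ) rfl hM
    (B := solB C₁ C₃ τ) rfl (μ := solMu C₁ C₃ τ) rfl
  constructor
  · have h3 : -hkQ τ (solB C₁ C₃ τ) (solMu C₁ C₃ τ) = solDen C₁ C₃ τ ^ 2 := by
      rw [neg_hkQ_eq, hkDen_eq]
      exact h2
    rw [← neg_ne_zero, h3]
    exact pow_ne_zero 2 hd
  · rw [isHermiteKrichever_iff τ _ _ _ (notMem_neg _ hω), weierstrassP_neg, derivWeierstrassP_neg]
    exact h1

/-! ### Derivatives with respect to `τ` -/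

theorem hasDerivAt_solDen (hω : om C₁ C₃ τ ∉ (periods τ).lattice) :
    HasDerivAt (fun t : ℂ => solDen C₁ C₃ (ofComplex t))
      ((-6 * eta1 τ * solDen C₁ C₃ τ - 3 / 2 * solNum C₁ C₃ τ) / tpi) τ := by
  have hc := tpi_ne_zero
  have hP := hasDerivAt_wp_om hω
  have hQ := hasDerivAt_wp'_om hω
  have hZ := hasDerivAt_zetaSubEta hω
  convert! ((hZ.pow 3).sub ((hP.const_mul 3).mul hZ)).sub hQ using 1
  simp only [ofComplex_apply, solDen, solNum, Nat.cast_ofNat]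
  field_simp
  ring

theorem g₃_eq_of_notMem {z : ℂ} (hz : z ∉ (periods τ).lattice) : (periods τ).g₃ =
    4 * (periods τ).weierstrassP z ^ 3 - (periods τ).g₂ * (periods τ).weierstrassP z
      - (periods τ).derivWeierstrassP z ^ 2 := by
  linear_combination (periods τ).derivWeierstrassP_sq z hz

theorem hasDerivAt_solNum (hω : om C₁ C₃ τ ∉ (periods τ).lattice) :
    HasDerivAt (fun t : ℂ => solNum C₁ C₃ (ofComplex t))
      ((-10 * eta1 τ * solNum C₁ C₃ τ + 2 * ((zetaSubEta C₁ C₃ τ ^ 2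
          - (periods τ).weierstrassP (om C₁ C₃ τ)) * solNum C₁ C₃ τ
        - 2 * (periods τ).weierstrassP (om C₁ C₃ τ) * (zetaSubEta C₁ C₃ τ ^ 2
          + (periods τ).weierstrassP (om C₁ C₃ τ)) * solDen C₁ C₃ τ
        - 2 * zetaSubEta C₁ C₃ τ * (periods τ).derivWeierstrassP (om C₁ C₃ τ) * solDen C₁ C₃ τ)
        - (periods τ).g₂ / 6 * solDen C₁ C₃ τ) / tpi) τ := by
  have hc := tpi_ne_zero
  have hP := hasDerivAt_wp_om hω
  have hQ := hasDerivAt_wp'_om hω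
  have hZ := hasDerivAt_zetaSubEta hω
  have hg := hasDerivAt_g₂ τ
  convert! ((((hP.const_mul 2).mul (hZ.pow 3)).add ((hQ.const_mul 3).mul (hZ.pow 2))).add
    ((((hP.pow 2).const_mul 6).sub hg).mul hZ)).add (hP.mul hQ) using 1
  simp only [ofComplex_apply, solDen, solNum, Nat.cast_ofNat, Pi.sub_apply, Pi.pow_apply]
  rw [g₃_eq_of_notMem hω]
  field_simp
  ring

theorem hasDerivAt_solMuDen (hω : om C₁ C₃ τ ∉ (periods τ).lattice) :
    HasDerivAt (fun t : ℂ => solMuDen C₁ C₃ (ofComplex t))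
      ((-12 * eta1 τ * solMuDen C₁ C₃ τ
        + ((12 * (periods τ).weierstrassP (om C₁ C₃ τ) ^ 2 - (periods τ).g₂)
            * zetaSubEta C₁ C₃ τ ^ 4
          + 24 * (periods τ).weierstrassP (om C₁ C₃ τ) * (periods τ).derivWeierstrassP (om C₁ C₃ τ)
            * zetaSubEta C₁ C₃ τ ^ 3
          + (9 * (periods τ).derivWeierstrassP (om C₁ C₃ τ) ^ 2
              + 36 * (periods τ).weierstrassP (om C₁ C₃ τ) ^ 3
              - 3 * (periods τ).g₂ * (periods τ).weierstrassP (om C₁ C₃ τ))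
            * zetaSubEta C₁ C₃ τ ^ 2
          + (24 * (periods τ).weierstrassP (om C₁ C₃ τ) ^ 2 - 2 * (periods τ).g₂)
            * (periods τ).derivWeierstrassP (om C₁ C₃ τ) * zetaSubEta C₁ C₃ τ
          + 3 * (periods τ).weierstrassP (om C₁ C₃ τ)
            * (periods τ).derivWeierstrassP (om C₁ C₃ τ) ^ 2)) / tpi) τ := by
  have hc := tpi_ne_zero
  have hP := hasDerivAt_wp_om hω
  have hQ := hasDerivAt_wp'_om hω
  have hZ := hasDerivAt_zetaSubEta hω
  have hg := hasDerivAt_g₂ τ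
  convert! ((((hQ.const_mul 2).mul (hZ.pow 3)).add
    ((((hP.pow 2).const_mul 12).sub hg).mul (hZ.pow 2))).add
    (((hP.const_mul 6).mul hQ).mul hZ)).add (hQ.pow 2) using 1
  simp only [ofComplex_apply, solMuDen, Nat.cast_ofNat, Pi.mul_apply, Pi.sub_apply, Pi.pow_apply]
  rw [g₃_eq_of_notMem hω]
  field_simp
  ring

/-- Together with the equation for μ₁ this is a closed system: ω, ℘(ω), ℘'(ω) and ζ(ω) - η are
eliminated, and the Painlevé computation uses only b₁, μ₁ and modular quantities. -/
theorem hasDerivAt_solB (hω : om C₁ C₃ τ ∉ (periods τ).lattice) (hd : solDen C₁ C₃ τ ≠ 0)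
    (hM : solMuDen C₁ C₃ τ ≠ 0) :
    HasDerivAt (fun t : ℂ => solB C₁ C₃ (ofComplex t))
      ((cubic τ (solB C₁ C₃ τ) * solMu C₁ C₃ τ - solB C₁ C₃ τ ^ 2
        - 4 * eta1 τ * solB C₁ C₃ τ - (periods τ).g₂ / 12) / tpi) τ := by
  have hc := tpi_ne_zero
  have h := (hasDerivAt_solNum hω).div ((hasDerivAt_solDen hω).const_mul 2)
    (mul_ne_zero two_ne_zero (by simpa using hd))
  convert! h using 1
  rw [cubic_solB hω hd, solB_eq_div, solMu]
  simp only [ofComplex_apply]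
  field_simp
  simp only [solNum, solDen]
  ring

theorem hasDerivAt_solMu (hω : om C₁ C₃ τ ∉ (periods τ).lattice) (hd : solDen C₁ C₃ τ ≠ 0)
    (hM : solMuDen C₁ C₃ τ ≠ 0) :
    HasDerivAt (fun t : ℂ => solMu C₁ C₃ (ofComplex t))
      ((-(1 / 2) * (12 * solB C₁ C₃ τ ^ 2 - (periods τ).g₂) * solMu C₁ C₃ τ ^ 2
        + 2 * solB C₁ C₃ τ * solMu C₁ C₃ τ + 1 + 4 * eta1 τ * solMu C₁ C₃ τ) / tpi) τ := by
  have hc := tpi_ne_zero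
  have h := (((hasDerivAt_solDen hω).const_mul 2).mul (hasDerivAt_zetaSubEta hω)).div
    (hasDerivAt_solMuDen hω) (by simpa using hM)
  convert! h using 1
  rw [solB_eq_div, solMu]
  simp only [ofComplex_apply, Pi.mul_apply]
  field_simp
  simp only [solNum, solDen, solMuDen]
  ring

end

/-! ### Local solvability of `℘(δ) = b` -/

section

variable {τ : ℍ}

/-- Clearing θ² turns the equation into one holomorphic in z and τ jointly, to which the implicit
function theorem applies. -/
theorem wpEta_eq_iff {τ : ℍ} {z β : ℂ} (hz : z ∉ (periods τ).lattice) :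
    wpEta τ z = β ↔ theta 1 z τ ^ 2 - theta 0 z τ * theta 2 z τ - β * theta 0 z τ ^ 2 = 0 := by
  have h0 : theta 0 z τ ≠ 0 := fun h => hz ((theta_eq_zero_iff τ).mp h)
  rw [theta_one_eq τ hz, theta_two_eq τ hz, ← sub_eq_zero,
    show (psi τ z * theta 0 z τ) ^ 2 - theta 0 z τ * ((psi τ z ^ 2 - wpEta τ z) * theta 0 z τ)
      - β * theta 0 z τ ^ 2 = (wpEta τ z - β) * theta 0 z τ ^ 2 by ring]
  simp [h0]

theorem eventually_prod_notMem {z : ℂ} (hz : z ∉ (periods τ).lattice) :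
    ∀ᶠ v : ℂ × ℂ in 𝓝 ((τ : ℂ), z), ((ofComplex v.1 : ℍ) : ℂ) = v.1 ∧
      v.2 ∉ (periods (ofComplex v.1)).lattice := by
  have h0 : theta 0 z τ ≠ 0 := fun h => hz ((theta_eq_zero_iff τ).mp h)
  have hc : ContinuousAt (fun v : ℂ × ℂ => theta 0 v.2 v.1) ((τ : ℂ), z) :=
    ContinuousAt.comp (f := Prod.swap) (x := ((τ : ℂ), z))
      (continuousAt_theta 0 (p := (z, (τ : ℂ))) τ.im_pos) continuous_swap.continuousAt
  filter_upwards [hc.eventually_ne h0, continuousAt_fst.eventually (eventually_coe_ofComplex τ)]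
    with v hv hv'
  refine ⟨hv'.2, fun hmem => hv ?_⟩
  rw [← hv'.2]
  exact (theta_eq_zero_iff (ofComplex v.1)).mpr hmem

/-- The z-derivative of the cleared equation is θ²℘'(z), nonzero by assumption. The equivalence near
(τ, z) includes uniqueness, so every continuous branch through z is the differentiable one. -/
theorem exists_branch {β : ℂ → ℂ} (hβ : AnalyticAt ℂ β τ) {z : ℂ} (hz : z ∉ (periods τ).lattice)
    (hW : (periods τ).derivWeierstrassP z ≠ 0) (hzβ : wpEta τ z = β τ) :
    ∃ (φ : ℂ → ℂ) (φ' : ℂ →L[ℂ] ℂ), HasStrictFDerivAt φ φ' (τ : ℂ) ∧ φ τ = z ∧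
      ∀ᶠ v : ℂ × ℂ in 𝓝 ((τ : ℂ), z), wpEta (ofComplex v.1) v.2 = β v.1 ↔ φ v.1 = v.2 := by
  set f : ℂ × ℂ → ℂ := fun v =>
    theta 1 v.2 v.1 ^ 2 - theta 0 v.2 v.1 * theta 2 v.2 v.1 - β v.1 * theta 0 v.2 v.1 ^ 2 with hf
  have h0 : theta 0 z τ ≠ 0 := fun h => hz ((theta_eq_zero_iff τ).mp h)
  have hθ : ∀ k, ∃ D, HasStrictFDerivAt (fun v : ℂ × ℂ => theta k v.2 v.1) D ((τ : ℂ), z) :=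
    fun k => ⟨_, HasStrictFDerivAt.comp (f := Prod.swap) ((τ : ℂ), z)
      (hasStrictFDerivAt_theta k (p := (z, (τ : ℂ))) τ.im_pos)
      (ContinuousLinearEquiv.prodComm ℂ ℂ ℂ).hasStrictFDerivAt⟩
  obtain ⟨D0, hD0⟩ := hθ 0
  obtain ⟨D1, hD1⟩ := hθ 1
  obtain ⟨D2, hD2⟩ := hθ 2
  have hβ' : HasStrictFDerivAt (fun v : ℂ × ℂ => β v.1) _ ((τ : ℂ), z) :=
    hβ.hasStrictFDerivAt.comp ((τ : ℂ), z) hasStrictFDerivAt_fst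
  have hex : ∃ D, HasStrictFDerivAt f D ((τ : ℂ), z) :=
    ⟨_, ((hD1.pow 2).sub (hD0.mul hD2)).sub (hβ'.mul (hD0.pow 2))⟩
  obtain ⟨D, hD⟩ := hex
  have hpart : D (0, 1) = theta 0 z τ ^ 2 * (periods τ).derivWeierstrassP z := by
    have h1 := hD.hasFDerivAt.comp_hasDerivAt (f := fun w => ((τ : ℂ), w)) z
      ((hasDerivAt_const z (τ : ℂ)).prodMk (hasDerivAt_id z))
    have h2 := (((hasDerivAt_theta_fst 1 z τ.im_pos).pow 2).sub
      ((hasDerivAt_theta_fst 0 z τ.im_pos).mul (hasDerivAt_theta_fst 2 z τ.im_pos))).sub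
      (((hasDerivAt_theta_fst 0 z τ.im_pos).pow 2).const_mul (β τ))
    rw [h1.unique h2]
    rw [show theta (0 + 1) z τ = theta 1 z τ from rfl, show theta (1 + 1) z τ = theta 2 z τ from rfl,
      show theta (2 + 1) z τ = theta 3 z τ from rfl, theta_one_eq τ hz,
      theta_two_eq τ hz, theta_three_eq τ hz, ← hzβ]
    simp only [Nat.cast_ofNat]
    ring
  have hinv : (D ∘L .inr ℂ ℂ ℂ).IsInvertible := by
    have hne : D (0, 1) ≠ 0 := by rw [hpart]; exact mul_ne_zero (pow_ne_zero 2 h0) hW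
    refine ⟨ContinuousLinearEquiv.unitsEquivAut ℂ (Units.mk0 _ hne), ?_⟩
    ext
    simp
  have hfu : f ((τ : ℂ), z) = 0 := (wpEta_eq_iff hz).mp hzβ
  have hφ := hD.eventually_apply_eq_iff_implicitFunctionOfProdDomain hinv
  refine ⟨hD.implicitFunctionOfProdDomain hinv, _,
    hD.hasStrictFDerivAt_implicitFunctionOfProdDomain hinv, hφ.self_of_nhds.mp rfl, ?_⟩
  filter_upwards [hφ, eventually_prod_notMem hz] with v hv hv'
  rw [← hv, hfu, wpEta_eq_iff hv'.2, hv'.1]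

end

/-! ### Translation by half periods -/

/-- Both differences are σ-quotients, and quasi-periodicity of σ cancels all dependence on z. -/
theorem weierstrassP_half_shift_mul (L : PeriodPair) {l : ℂ} (hl : l ∈ L.lattice)
    (hl2 : l / 2 ∉ L.lattice) {z : ℂ} (hz : z ∉ L.lattice) (hz2 : z + l / 2 ∉ L.lattice) :
    (L.weierstrassP (z + l / 2) - L.weierstrassP (l / 2)) *
      (L.weierstrassP z - L.weierstrassP (l / 2)) =
    Complex.exp (2 * zeta L (l / 2) * (l / 2)) / sigma L (l / 2) ^ 4 := by
  have h0 := sigma_ne_zero L hl2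
  have h1 := sigma_ne_zero L hz
  have h2 := sigma_ne_zero L hz2
  have hzm : z - l / 2 ∉ L.lattice := by
    intro h
    refine hz2 ?_
    convert! add_mem h hl using 1
    ring
  have h3 := sigma_ne_zero L hzm
  have s1 := sigma_add_of_half L hl hl2 z
  have s2 := sigma_add_of_half L hl hl2 (z - l / 2)
  rw [show z - l / 2 + l = z + l / 2 by ring, show z - l / 2 + l / 2 = z by ring] at s2
  have hexp : Complex.exp (2 * zeta L (l / 2) * (z + l / 2)) =
      Complex.exp (2 * zeta L (l / 2) * z) * Complex.exp (2 * zeta L (l / 2) * (l / 2)) := by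
    rw [← Complex.exp_add]; ring_nf
  have hne := Complex.exp_ne_zero (2 * zeta L (l / 2) * z)
  rw [weierstrassP_sub L hz2 hl2, weierstrassP_sub L hz hl2, show z + l / 2 + l / 2 = z + l by ring,
    show z + l / 2 - l / 2 = z by ring, s1, s2, hexp]
  generalize sigma L (z - l / 2) = S at h3
  field_simp

/-- The constant product is differentiated in z. The auxiliary point v serves to evaluate the
constant; at another half period it becomes a product of differences of the eᵢ. -/
theorem derivWeierstrassP_half_shift (L : PeriodPair) {l : ℂ} (hl : l ∈ L.lattice)
    (hl2 : l / 2 ∉ L.lattice) {v : ℂ} (hv : v ∉ L.lattice) (hv2 : v + l / 2 ∉ L.lattice)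
    {z : ℂ} (hz : z ∉ L.lattice) (hz2 : z + l / 2 ∉ L.lattice)
    (hne : L.weierstrassP z ≠ L.weierstrassP (l / 2)) :
    L.derivWeierstrassP (z + l / 2) =
      -((L.weierstrassP (l / 2) - L.weierstrassP (v + l / 2)) *
        (L.weierstrassP (l / 2) - L.weierstrassP v)) * L.derivWeierstrassP z /
          (L.weierstrassP z - L.weierstrassP (l / 2)) ^ 2 := by
  set e := L.weierstrassP (l / 2)
  set K := (e - L.weierstrassP (v + l / 2)) * (e - L.weierstrassP v) with hK
  have hmul : ∀ w, w ∉ L.lattice → w + l / 2 ∉ L.lattice →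
      (L.weierstrassP (w + l / 2) - e) * (L.weierstrassP w - e) = K := by
    intro w hw hw2
    rw [weierstrassP_half_shift_mul L hl hl2 hw hw2, ← weierstrassP_half_shift_mul L hl hl2 hv hv2,
      hK]
    ring
  have h1 := (((hasDerivAt_weierstrassP L hz2).comp_add_const z (l / 2)).sub_const e).mul
    ((hasDerivAt_weierstrassP L hz).sub_const e)
  have h2 := h1.congr_of_eventuallyEq (f₁ := fun _ => K) (by
    filter_upwards [eventually_notMem_lattice L hz,
      (continuous_add_const (l / 2)).continuousAt.eventually (eventually_notMem_lattice L hz2)]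
      with w hw hw2
    exact (hmul w hw hw2).symm)
  have h3 := h2.unique (hasDerivAt_const z K)
  have h4 := hmul z hz hz2
  have h0 := sub_ne_zero.mpr hne
  rw [eq_div_iff (pow_ne_zero 2 h0)]
  linear_combination (L.weierstrassP z - e) * h3 - L.derivWeierstrassP z * h4

section

variable (τ : ℍ) {z : ℂ}

theorem weierstrassP_half_add_tau_half :
    (periods τ).weierstrassP (1 / 2 + τ / 2) = e2 τ := by
  rw [e2, ← weierstrassP_neg]
  congr 1
  ring

theorem derivWeierstrassP_add_half (hz : 2 * z ∉ (periods τ).lattice)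
    (hne : (periods τ).weierstrassP z ≠ e1 τ) :
    (periods τ).derivWeierstrassP (z + 1 / 2) = -((e1 τ - e2 τ) * (e1 τ - e3 τ)) *
      (periods τ).derivWeierstrassP z / ((periods τ).weierstrassP z - e1 τ) ^ 2 := by
  have hz1 : z ∉ (periods τ).lattice := fun h => hz (by rw [two_mul]; exact add_mem h h)
  have hz2 : z + 1 / 2 ∉ (periods τ).lattice := fun h => hz (by
    convert! sub_mem (add_mem h h) (one_mem τ) using 1; ring)
  have h := derivWeierstrassP_half_shift (periods τ) (one_mem τ) (half_notMem τ)
    (tau_half_notMem τ) (by rw [add_comm]; exact half_add_tau_half_notMem τ) hz1 hz2 hne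
  rw [h, add_comm (τ / 2 : ℂ), weierstrassP_half_add_tau_half]
  rfl

theorem derivWeierstrassP_add_tau_half (hz : 2 * z ∉ (periods τ).lattice)
    (hne : (periods τ).weierstrassP z ≠ e3 τ) :
    (periods τ).derivWeierstrassP (z + τ / 2) = -((e3 τ - e1 τ) * (e3 τ - e2 τ)) *
      (periods τ).derivWeierstrassP z / ((periods τ).weierstrassP z - e3 τ) ^ 2 := by
  have hz1 : z ∉ (periods τ).lattice := fun h => hz (by rw [two_mul]; exact add_mem h h)
  have hz2 : z + τ / 2 ∉ (periods τ).lattice := fun h => hz (by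
    convert! sub_mem (add_mem h h) (tau_mem τ) using 1; ring)
  have h := derivWeierstrassP_half_shift (periods τ) (tau_mem τ) (tau_half_notMem τ)
    (half_notMem τ) (half_add_tau_half_notMem τ) hz1 hz2 hne
  rw [h, weierstrassP_half_add_tau_half, mul_comm (e3 τ - e1 τ)]
  rfl

theorem derivWeierstrassP_add_half_add_tau_half (hz : 2 * z ∉ (periods τ).lattice)
    (hne : (periods τ).weierstrassP z ≠ e2 τ) :
    (periods τ).derivWeierstrassP (z + (τ + 1) / 2) = -((e2 τ - e3 τ) * (e2 τ - e1 τ)) *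
      (periods τ).derivWeierstrassP z / ((periods τ).weierstrassP z - e2 τ) ^ 2 := by
  have he : ((τ : ℂ) + 1) / 2 = 1 / 2 + τ / 2 := by ring
  have hmem := add_mem (tau_mem τ) (one_mem τ)
  have hz1 : z ∉ (periods τ).lattice := fun h => hz (by rw [two_mul]; exact add_mem h h)
  have hz2 : z + (τ + 1) / 2 ∉ (periods τ).lattice := fun h => hz (by
    convert! sub_mem (add_mem h h) hmem using 1; ring)
  have hs : (1 / 2 : ℂ) + (τ + 1) / 2 = τ / 2 + 1 := by ring
  have hw : (periods τ).weierstrassP (((τ : ℂ) + 1) / 2) = e2 τ := by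
    rw [he, weierstrassP_half_add_tau_half]
  have h := derivWeierstrassP_half_shift (periods τ) hmem
    (by rw [he]; exact half_add_tau_half_notMem τ) (half_notMem τ)
    (by rw [hs]; exact notMem_add _ (tau_half_notMem τ) (one_mem τ)) hz1 hz2 (by rwa [hw])
  rw [h, hs, weierstrassP_add_of_mem _ (one_mem τ), hw]
  rfl

end

/-! ### The regular set -/

section

variable {C₁ C₃ : ℂ} {τ : ℍ}

theorem hasDerivAt_cubic_solB (h : SolRegular C₁ C₃ τ) :
    HasDerivAt (fun t : ℂ => cubic (ofComplex t) (solB C₁ C₃ (ofComplex t)))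
      (((12 * solB C₁ C₃ τ ^ 2 - (periods τ).g₂) *
          (cubic τ (solB C₁ C₃ τ) * solMu C₁ C₃ τ - solB C₁ C₃ τ ^ 2
            - 4 * eta1 τ * solB C₁ C₃ τ - (periods τ).g₂ / 12)
        - (6 * (periods τ).g₃ - 8 * eta1 τ * (periods τ).g₂) * solB C₁ C₃ τ
        - ((periods τ).g₂ ^ 2 / 3 - 12 * eta1 τ * (periods τ).g₃)) / tpi) τ := by
  have hb := hasDerivAt_solB h.1 h.2.1 (solMuDen_ne_zero h)
  convert! (((hb.pow 3).const_mul 4).sub ((hasDerivAt_g₂ τ).mul hb)).sub (hasDerivAt_g₃ τ) using 1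
  simp only [ofComplex_apply, Nat.cast_ofNat]
  ring

theorem eventually_solRegular (h : SolRegular C₁ C₃ τ) :
    ∀ᶠ t : ℂ in 𝓝 (τ : ℂ), SolRegular C₁ C₃ (ofComplex t) := by
  have hc := (hasDerivAt_cubic_solB h).continuousAt.eventually_ne (y := 0)
    (by simpa using (notBranchValue_iff τ _).mp h.2.2)
  have hd := (hasDerivAt_solDen h.1).continuousAt.eventually_ne (y := 0) (by simpa using h.2.1)
  filter_upwards [hc, hd, eventually_om_eq τ C₁ C₃,
    eventually_comp_notMem (hasDerivAt_om τ C₁ C₃).continuousAt h.1] with t h1 h2 h3 h4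
  exact ⟨by rwa [h3], h2, (notBranchValue_iff _ _).mpr h1⟩

/-- The term 2η₁ is added because theta quotients express ℘ + 2η₁ and not ℘ itself. -/
theorem analyticAt_solB_add (h : SolRegular C₁ C₃ τ) :
    AnalyticAt ℂ (fun t : ℂ => solB C₁ C₃ (ofComplex t) + 2 * eta1 (ofComplex t)) τ := by
  rw [Complex.analyticAt_iff_eventually_differentiableAt]
  filter_upwards [eventually_solRegular h, eventually_coe_ofComplex τ] with t ht ht'
  have h1 := ((hasDerivAt_solB ht.1 ht.2.1 (solMuDen_ne_zero ht)).add
    ((hasDerivAt_eta1 (ofComplex t)).const_mul 2)).differentiableAt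
  rwa [ht'.2] at h1

theorem derivWeierstrassP_ne_zero_of_notBranchValue {z : ℂ} (hz : z ∉ (periods τ).lattice)
    (hb : NotBranchValue τ ((periods τ).weierstrassP z)) :
    (periods τ).derivWeierstrassP z ≠ 0 := by
  intro h
  have h1 := cubic_eq_sq τ hz
  rw [h, zero_pow two_ne_zero] at h1
  exact (notBranchValue_iff τ _).mp hb h1.symm

theorem exists_isDelta (h : SolRegular C₁ C₃ τ) :
    ∃ (U : Set ℂ) (δ : ℂ → ℂ), (τ : ℂ) ∈ U ∧ IsDelta C₁ C₃ U δ := by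
  obtain ⟨z, hz, hzb⟩ := weierstrassP_surjective (periods τ) (solB C₁ C₃ τ)
  obtain ⟨φ, φ', hφ, rfl, hev⟩ := exists_branch (analyticAt_solB_add h) hz
    (derivWeierstrassP_ne_zero_of_notBranchValue hz (hzb ▸ h.2.2))
    (by simp only [ofComplex_apply]; rw [wpEta, hzb])
  have hφc : ContinuousAt φ τ := hφ.continuousAt
  -- Strict differentiability at one point gives a Lipschitz bound nearby, hence continuity on a
  -- whole neighbourhood.
  obtain ⟨K, s, hs, hK⟩ := hφ.exists_lipschitzOnWith
  have htend : Tendsto (fun t => (t, φ t)) (𝓝 (τ : ℂ)) (𝓝 ((τ : ℂ), φ τ)) :=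
    (continuousAt_id.prodMk hφc)
  have hall : ∀ᶠ t : ℂ in 𝓝 (τ : ℂ), t ∈ s ∧ 0 < t.im ∧ SolRegular C₁ C₃ (ofComplex t) ∧
      φ t ∉ (periods (ofComplex t)).lattice ∧
      (periods (ofComplex t)).weierstrassP (φ t) = solB C₁ C₃ (ofComplex t) := by
    filter_upwards [hs, eventually_coe_ofComplex τ, eventually_solRegular h,
      eventually_comp_notMem hφc hz, htend.eventually hev] with t h1 h2 h3 h4 h5
    refine ⟨h1, h2.1, h3, h4, ?_⟩
    have h6 := h5.mpr rfl
    exact add_right_cancel h6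
  obtain ⟨U, hU, hUo, hτ⟩ := mem_nhds_iff.mp hall
  refine ⟨U, φ, hτ, hUo, fun t ht => (hU ht).2.1, hK.continuousOn.mono fun t ht => (hU ht).1,
    fun t ht => ?_⟩
  have := (hU ht).2.2
  rwa [ofComplex_apply] at this

end

/-! ### The sixth Painlevé equation -/

/-- Here W = ℘'(δ), Y = ψ(δ) + 2πiδ', T = YW, and primes stand for 2πi d/dτ, so the left side is
(2πi)²δ''. On the right the half-period translates of ℘' are written through b - eᵢ. -/
theorem pvi_identity {b μ η e₁ e₂ e₃ g₂ g₃ C b' C' T T' W Y : ℂ} (hs : e₁ + e₂ + e₃ = 0)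
    (h1 : b ≠ e₁) (h2 : b ≠ e₂) (h3 : b ≠ e₃)
    (hg₂ : g₂ = 2 * (e₁ ^ 2 + e₂ ^ 2 + e₃ ^ 2)) (hg₃ : g₃ = 4 * (e₁ * e₂ * e₃))
    (hC : C = 4 * ((b - e₁) * (b - e₂) * (b - e₃))) (hW : W ^ 2 = C) (hW0 : W ≠ 0)
    (hb' : b' = C * μ - b ^ 2 - 4 * η * b - g₂ / 12)
    (hC' : C' = (12 * b ^ 2 - g₂) * b' - (6 * g₃ - 8 * η * g₂) * b - (g₂ ^ 2 / 3 - 12 * η * g₃))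
    (hT : T = C * μ - 3 * b ^ 2 + g₂ / 4)
    (hT' : T' = C' * μ + C * (-(1 / 2) * (12 * b ^ 2 - g₂) * μ ^ 2 + 2 * b * μ + 1 + 4 * η * μ)
      - 6 * b * b' + (6 * g₃ - 8 * η * g₂) / 4) (hY : Y = T / W) :
    (T' * W - T * (Y * (6 * b ^ 2 - g₂ / 2) + 3 * b * W - 6 * η * W)) / W ^ 2
        - (-(1 / 2) * W - Y * (b + 2 * η)) =
      9 / 8 * W + 1 / 8 * (-((e₁ - e₂) * (e₁ - e₃)) * W / (b - e₁) ^ 2)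
        + 1 / 8 * (-((e₂ - e₃) * (e₂ - e₁)) * W / (b - e₂) ^ 2)
        + 1 / 8 * (-((e₃ - e₁) * (e₃ - e₂)) * W / (b - e₃) ^ 2) := by
  have d1 := sub_ne_zero.mpr h1
  have d2 := sub_ne_zero.mpr h2
  have d3 := sub_ne_zero.mpr h3
  have hl : (T' * W - T * (Y * (6 * b ^ 2 - g₂ / 2) + 3 * b * W - 6 * η * W)) / W ^ 2
        - (-(1 / 2) * W - Y * (b + 2 * η)) =
      (T' - T ^ 2 * (6 * b ^ 2 - g₂ / 2) / W ^ 2 - 2 * b * T + 8 * η * T + W ^ 2 / 2) / W := by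
    rw [hY]; field_simp; ring
  have hr : 9 / 8 * W + 1 / 8 * (-((e₁ - e₂) * (e₁ - e₃)) * W / (b - e₁) ^ 2)
        + 1 / 8 * (-((e₂ - e₃) * (e₂ - e₁)) * W / (b - e₂) ^ 2)
        + 1 / 8 * (-((e₃ - e₁) * (e₃ - e₂)) * W / (b - e₃) ^ 2) =
      W ^ 2 * (9 / 8 + 1 / 8 * (-((e₁ - e₂) * (e₁ - e₃)) / (b - e₁) ^ 2)
        + 1 / 8 * (-((e₂ - e₃) * (e₂ - e₁)) / (b - e₂) ^ 2)
        + 1 / 8 * (-((e₃ - e₁) * (e₃ - e₂)) / (b - e₃) ^ 2)) / W := by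
    field_simp
  rw [hl, hr, hW, hT', hC', hb', hT, hC, hg₂, hg₃]
  congr 1
  -- The differences u, v, w = b - eᵢ are free variables with b = (u + v + w)/3, since the eᵢ sum to
  -- zero; η and μ cancel.
  obtain ⟨u, hu⟩ : ∃ u, u = b - e₁ := ⟨_, rfl⟩
  obtain ⟨v, hv⟩ : ∃ v, v = b - e₂ := ⟨_, rfl⟩
  obtain ⟨w, hw⟩ : ∃ w, w = b - e₃ := ⟨_, rfl⟩
  rw [← hu] at d1
  rw [← hv] at d2
  rw [← hw] at d3
  have hb : b = (u + v + w) / 3 := by linear_combination (-1 / 3) * (hu + hv + hw - hs)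
  have k1 : e₁ = b - u := by rw [hu]; ring
  have k2 : e₂ = b - v := by rw [hv]; ring
  have k3 : e₃ = b - w := by rw [hw]; ring
  rw [← hu, ← hv, ← hw, k1, k2, k3, hb]
  field_simp
  ring

section

variable {C₁ C₃ : ℂ} {U : Set ℂ} {δ : ℂ → ℂ} {τ : ℍ}

theorem IsDelta.eventually (h : IsDelta C₁ C₃ U δ) (hτ : (τ : ℂ) ∈ U) :
    ∀ᶠ t : ℂ in 𝓝 (τ : ℂ), t ∈ U ∧ ((ofComplex t : ℍ) : ℂ) = t ∧
      SolRegular C₁ C₃ (ofComplex t) ∧ δ t ∉ (periods (ofComplex t)).lattice ∧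
      (periods (ofComplex t)).weierstrassP (δ t) = solB C₁ C₃ (ofComplex t) := by
  filter_upwards [h.1.mem_nhds hτ, eventually_coe_ofComplex τ] with t ht ht'
  have := h.2.2.2 (ofComplex t) (by rwa [ht'.2])
  rw [ht'.2] at this
  exact ⟨ht, ht'.2, this⟩

theorem IsDelta.derivWeierstrassP_ne_zero (h : IsDelta C₁ C₃ U δ) (hτ : (τ : ℂ) ∈ U) :
    (periods τ).derivWeierstrassP (δ τ) ≠ 0 := by
  obtain ⟨hr, hz, hb⟩ := h.2.2.2 τ hτ
  exact derivWeierstrassP_ne_zero_of_notBranchValue hz (hb ▸ hr.2.2)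

theorem IsDelta.differentiableAt (h : IsDelta C₁ C₃ U δ) (hτ : (τ : ℂ) ∈ U) :
    DifferentiableAt ℂ δ τ := by
  obtain ⟨hr, hz, hb⟩ := h.2.2.2 τ hτ
  have hc : ContinuousAt δ τ := h.2.2.1.continuousAt (h.1.mem_nhds hτ)
  obtain ⟨φ, φ', hφ, -, hev⟩ := exists_branch (analyticAt_solB_add hr) hz
    (h.derivWeierstrassP_ne_zero hτ) (by simp only [ofComplex_apply]; rw [wpEta, hb])
  have htend : Tendsto (fun t => (t, δ t)) (𝓝 (τ : ℂ)) (𝓝 ((τ : ℂ), δ τ)) :=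
    continuousAt_id.prodMk hc
  refine hφ.hasFDerivAt.differentiableAt.congr_of_eventuallyEq ?_
  filter_upwards [htend.eventually hev, h.eventually hτ] with t h1 h2
  exact (h1.mp (by rw [wpEta, h2.2.2.2.2])).symm

/-- The value of `(ζ(δ) - 2η₁δ + 2πi δ') ℘'(δ)` for `℘(δ) = b₁`. -/
def deltaNum (C₁ C₃ : ℂ) (τ : ℍ) : ℂ :=
  cubic τ (solB C₁ C₃ τ) * solMu C₁ C₃ τ - 3 * solB C₁ C₃ τ ^ 2 + (periods τ).g₂ / 4

/-- The derivative of ℘(δ(τ)) is compared with that of b₁; η₁ cancels. -/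
theorem IsDelta.mul_derivWeierstrassP (h : IsDelta C₁ C₃ U δ) (hτ : (τ : ℂ) ∈ U) :
    (psi τ (δ τ) + tpi * deriv δ τ) * (periods τ).derivWeierstrassP (δ τ) =
      deltaNum C₁ C₃ τ := by
  obtain ⟨hr, hz, hb⟩ := h.2.2.2 τ hτ
  have h1 := hasDerivAt_weierstrassP_comp (h.differentiableAt hτ).hasDerivAt hz
  have h2 := (hasDerivAt_solB hr.1 hr.2.1 (solMuDen_ne_zero hr)).congr_of_eventuallyEq
    ((h.eventually hτ).mono fun t ht => ht.2.2.2.2)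
  have h3 := h1.unique h2
  have hc := tpi_ne_zero
  rw [div_left_inj' hc, hb] at h3
  rw [deltaNum]
  linear_combination h3

theorem hasDerivAt_deltaNum (h : SolRegular C₁ C₃ τ) :
    HasDerivAt (fun t : ℂ => deltaNum C₁ C₃ (ofComplex t))
      ((((12 * solB C₁ C₃ τ ^ 2 - (periods τ).g₂) *
          (cubic τ (solB C₁ C₃ τ) * solMu C₁ C₃ τ - solB C₁ C₃ τ ^ 2
            - 4 * eta1 τ * solB C₁ C₃ τ - (periods τ).g₂ / 12)
        - (6 * (periods τ).g₃ - 8 * eta1 τ * (periods τ).g₂) * solB C₁ C₃ τ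
        - ((periods τ).g₂ ^ 2 / 3 - 12 * eta1 τ * (periods τ).g₃)) * solMu C₁ C₃ τ
        + cubic τ (solB C₁ C₃ τ) *
          (-(1 / 2) * (12 * solB C₁ C₃ τ ^ 2 - (periods τ).g₂) * solMu C₁ C₃ τ ^ 2
            + 2 * solB C₁ C₃ τ * solMu C₁ C₃ τ + 1 + 4 * eta1 τ * solMu C₁ C₃ τ)
        - 6 * solB C₁ C₃ τ * (cubic τ (solB C₁ C₃ τ) * solMu C₁ C₃ τ - solB C₁ C₃ τ ^ 2
            - 4 * eta1 τ * solB C₁ C₃ τ - (periods τ).g₂ / 12)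
        + (6 * (periods τ).g₃ - 8 * eta1 τ * (periods τ).g₂) / 4) / tpi) τ := by
  have hM := solMuDen_ne_zero h
  have hb := hasDerivAt_solB h.1 h.2.1 hM
  convert! (((hasDerivAt_cubic_solB h).mul (hasDerivAt_solMu h.1 h.2.1 hM)).sub
    ((hb.pow 2).const_mul 3)).add ((hasDerivAt_g₂ τ).div_const 4) using 1
  simp only [ofComplex_apply, Nat.cast_ofNat]
  ring

theorem IsDelta.solvesEllipticPVI (h : IsDelta C₁ C₃ U δ) :
    SolvesEllipticPVI (1 / 2) (1 / 2) (1 / 2) (3 / 2) U δ := by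
  refine ⟨fun t ht => ?_, fun τ hτ => ?_⟩
  · have h1 := h.differentiableAt (τ := ⟨t, h.2.1 t ht⟩) ht
    exact h1.differentiableWithinAt
  obtain ⟨hr, hz, hb⟩ := h.2.2.2 τ hτ
  have hW := h.derivWeierstrassP_ne_zero hτ
  have h2z : 2 * δ τ ∉ (periods τ).lattice := by
    rwa [Ne, derivWeierstrassP_eq_zero_iff _ hz] at hW
  refine ⟨h2z, ?_⟩
  have hc := tpi_ne_zero
  have hδ := (h.differentiableAt hτ).hasDerivAt
  have hY : psi τ (δ τ) + tpi * deriv δ τ =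
      deltaNum C₁ C₃ τ / (periods τ).derivWeierstrassP (δ τ) := by
    rw [eq_div_iff hW, h.mul_derivWeierstrassP hτ]
  -- Near τ, 2πiδ' = T/℘'(δ) - ψ(δ); differentiating this once more gives δ''.
  have hd := (((hasDerivAt_deltaNum hr).div (hasDerivAt_derivWeierstrassP_comp hδ hz)
    (by simpa using hW)).sub (hasDerivAt_psi_comp hδ hz)).div_const tpi
  have hd2 := hd.congr_of_eventuallyEq (f₁ := deriv δ) (by
    filter_upwards [h.eventually hτ] with t ht
    obtain ⟨htU, hte, -⟩ := ht
    have h1 := h.mul_derivWeierstrassP (τ := ofComplex t) (by rwa [hte])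
    have h2 := h.derivWeierstrassP_ne_zero (τ := ofComplex t) (by rwa [hte])
    rw [hte] at h1 h2
    simp only [Pi.sub_apply, Pi.div_apply]
    rw [← h1]
    field_simp
    ring)
  obtain ⟨n1, n2, n3⟩ := hr.2.2
  have hid := pvi_identity (e_sum τ) n1 n2 n3 (g₂_eq τ) (g₃_eq τ) (cubic_eq_prod τ _)
    (hb ▸ cubic_eq_sq τ hz) hW (μ := solMu C₁ C₃ τ) (η := eta1 τ) rfl rfl rfl rfl rfl
  rw [derivWeierstrassP_add_half τ h2z (hb ▸ n1),
    derivWeierstrassP_add_half_add_tau_half τ h2z (hb ▸ n2),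
    derivWeierstrassP_add_tau_half τ h2z (hb ▸ n3), hd2.deriv, hb]
  have hpi : -(1 / (4 * (Real.pi : ℂ) ^ 2)) = 1 / tpi ^ 2 := by
    have : (Real.pi : ℂ) ≠ 0 := by exact_mod_cast Real.pi_ne_zero
    rw [tpi, mul_pow, Complex.I_sq]
    field_simp
    norm_num
  rw [hpi]
  simp only [ofComplex_apply]
  rw [wpEta, hb, hY]
  rw [show ∀ x y z w : ℂ, (3 / 2 : ℂ) ^ 2 / 2 * x + (1 / 2) ^ 2 / 2 * y + (1 / 2) ^ 2 / 2 * z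
    + (1 / 2) ^ 2 / 2 * w = 9 / 8 * x + 1 / 8 * y + 1 / 8 * z + 1 / 8 * w by intros; ring, ← hid]
  simp only [deltaNum]
  field_simp

end

/-! ### The Bäcklund transform of Hitchin's solution -/

/-- The left side is 2πi(e₂ - e₁) dλ/dτ for Hitchin's λ; the factor 2e₃ + 4η comes from the
logarithmic derivative of e₂ - e₁. -/
theorem hitchin_identity {P Q Z e₁ e₂ e₃ η g₂ b d : ℂ} (hs : e₁ + e₂ + e₃ = 0)
    (hg₂ : g₂ = 2 * (e₁ ^ 2 + e₂ ^ 2 + e₃ ^ 2)) (hZ : Z ≠ 0) (hb : b = P + Q / (2 * Z))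
    (hd : d = Z ^ 3 - 3 * P * Z - Q) :
    (Z * Q + 2 * P ^ 2 - 4 * η * P - g₂ / 3)
      + ((Z * (6 * P ^ 2 - g₂ / 2) + 3 * P * Q - 6 * η * Q) * Z
        - Q * (-(1 / 2) * Q - Z * (P + 2 * η))) / (2 * Z ^ 2)
      - (2 * e₁ ^ 2 - 4 * η * e₁ - g₂ / 3) + (b - e₁) * (2 * e₃ + 4 * η) =
    Q * d / Z ^ 2 + (b - e₂) * (b - e₃) + (b - e₁) * (b - e₃) + 3 * ((b - e₁) * (b - e₂)) := by
  have he : e₃ = -e₁ - e₂ := by linear_combination hs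
  rw [hb, hd, hg₂, he]
  field_simp
  ring

section

variable {C₁ C₃ : ℂ} {τ : ℍ}

theorem hasDerivAt_hitchinB (hω : om C₁ C₃ τ ∉ (periods τ).lattice)
    (hZ : zetaSubEta C₁ C₃ τ ≠ 0) :
    HasDerivAt (fun t : ℂ => hitchinB C₁ C₃ (ofComplex t))
      (((zetaSubEta C₁ C₃ τ * (periods τ).derivWeierstrassP (om C₁ C₃ τ)
        + 2 * (periods τ).weierstrassP (om C₁ C₃ τ) ^ 2
        - 4 * eta1 τ * (periods τ).weierstrassP (om C₁ C₃ τ) - (periods τ).g₂ / 3)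
      + ((zetaSubEta C₁ C₃ τ * (6 * (periods τ).weierstrassP (om C₁ C₃ τ) ^ 2 - (periods τ).g₂ / 2)
        + 3 * (periods τ).weierstrassP (om C₁ C₃ τ) * (periods τ).derivWeierstrassP (om C₁ C₃ τ)
        - 6 * eta1 τ * (periods τ).derivWeierstrassP (om C₁ C₃ τ)) * zetaSubEta C₁ C₃ τ
        - (periods τ).derivWeierstrassP (om C₁ C₃ τ) *
          (-(1 / 2) * (periods τ).derivWeierstrassP (om C₁ C₃ τ)
            - zetaSubEta C₁ C₃ τ * ((periods τ).weierstrassP (om C₁ C₃ τ) + 2 * eta1 τ)))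
        / (2 * zetaSubEta C₁ C₃ τ ^ 2)) / tpi) τ := by
  have hc := tpi_ne_zero
  convert! (hasDerivAt_wp_om hω).add ((hasDerivAt_wp'_om hω).div
    ((hasDerivAt_zetaSubEta hω).const_mul 2) (by simpa using hZ)) using 1
  simp only [ofComplex_apply]
  field_simp

theorem e2_sub_e1_ne_zero (τ : ℍ) : e2 τ - e1 τ ≠ 0 := sub_ne_zero.mpr (e1_ne_e2 τ).symm

theorem modT_ne_zero (τ : ℍ) : modT τ ≠ 0 :=
  div_ne_zero (sub_ne_zero.mpr (e1_ne_e3 τ).symm) (e2_sub_e1_ne_zero τ)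

theorem modT_sub_one (τ : ℍ) : modT τ - 1 = (e3 τ - e2 τ) / (e2 τ - e1 τ) := by
  have := e2_sub_e1_ne_zero τ
  rw [modT]
  field_simp
  ring

theorem modT_sub_one_ne_zero (τ : ℍ) : modT τ - 1 ≠ 0 := by
  rw [modT_sub_one]
  exact div_ne_zero (sub_ne_zero.mpr (e2_ne_e3 τ).symm) (e2_sub_e1_ne_zero τ)

theorem hasDerivAt_modT (τ : ℍ) : HasDerivAt (fun t : ℂ => modT (ofComplex t))
    (2 * (e2 τ - e1 τ) * (modT τ * (modT τ - 1)) / tpi) τ := by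
  have hc := tpi_ne_zero
  have h0 := e2_sub_e1_ne_zero τ
  convert! ((hasDerivAt_e3 τ).sub (hasDerivAt_e1 τ)).div ((hasDerivAt_e2 τ).sub (hasDerivAt_e1 τ))
    (by simpa using h0) using 1
  rw [modT_sub_one, modT]
  simp only [Pi.sub_apply, ofComplex_apply]
  field_simp
  ring

theorem lamOf_sub_one (τ : ℍ) (b : ℂ) : lamOf τ b - 1 = (b - e2 τ) / (e2 τ - e1 τ) := by
  have := e2_sub_e1_ne_zero τ
  rw [lamOf]
  field_simp
  ring

theorem lamOf_sub_modT (τ : ℍ) (b : ℂ) : lamOf τ b - modT τ = (b - e3 τ) / (e2 τ - e1 τ) := by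
  rw [lamOf, modT]
  ring

theorem hasDerivAt_lamOf_hitchinB (hω : om C₁ C₃ τ ∉ (periods τ).lattice)
    (hZ : zetaSubEta C₁ C₃ τ ≠ 0) :
    HasDerivAt (fun t : ℂ => lamOf (ofComplex t) (hitchinB C₁ C₃ (ofComplex t)))
      (((periods τ).derivWeierstrassP (om C₁ C₃ τ) * solDen C₁ C₃ τ / zetaSubEta C₁ C₃ τ ^ 2
        + (hitchinB C₁ C₃ τ - e2 τ) * (hitchinB C₁ C₃ τ - e3 τ)
        + (hitchinB C₁ C₃ τ - e1 τ) * (hitchinB C₁ C₃ τ - e3 τ)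
        + 3 * ((hitchinB C₁ C₃ τ - e1 τ) * (hitchinB C₁ C₃ τ - e2 τ)))
        / (e2 τ - e1 τ) / tpi) τ := by
  have hc := tpi_ne_zero
  have h0 := e2_sub_e1_ne_zero τ
  convert! ((hasDerivAt_hitchinB hω hZ).sub (hasDerivAt_e1 τ)).div
    ((hasDerivAt_e2 τ).sub (hasDerivAt_e1 τ)) (by simpa using h0) using 1
  rw [← hitchin_identity (η := eta1 τ) (e_sum τ) (g₂_eq τ) hZ
    (show hitchinB C₁ C₃ τ = _ from rfl) (show solDen C₁ C₃ τ = _ from rfl)]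
  simp only [Pi.sub_apply, ofComplex_apply]
  rw [show e3 τ = -e1 τ - e2 τ by linear_combination e_sum τ]
  field_simp
  ring

theorem hasDerivAt_hamiltonian (k0 k1 kt kinf t l m : ℂ) :
    HasDerivAt (fun m => hamiltonian ⟨k0, k1, kt, kinf, t, l, m⟩)
      ((2 * (l * (l - 1) * (l - t)) * m
        - (k0 * (l - 1) * (l - t) + k1 * l * (l - t) + (kt - 1) * l * (l - 1)))
        / (t * (t - 1))) m := by
  have h1 := (hasDerivAt_id m).pow 2 |>.const_mul (l * (l - 1) * (l - t))
  have h2 := (hasDerivAt_id m).const_mul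
    (k0 * (l - 1) * (l - t) + k1 * l * (l - t) + (kt - 1) * l * (l - 1))
  convert! ((h1.sub h2).add_const (((k0 + k1 + kt - 1) ^ 2 - kinf ^ 2) / 4 * (l - t))).const_mul
    (1 / (t * (t - 1))) using 1
  simp only [id, Nat.cast_ofNat]
  ring

theorem cubic_hitchinB (hω : om C₁ C₃ τ ∉ (periods τ).lattice) (hZ : zetaSubEta C₁ C₃ τ ≠ 0) :
    cubic τ (hitchinB C₁ C₃ τ) = (periods τ).derivWeierstrassP (om C₁ C₃ τ) * solMuDen C₁ C₃ τ
      / (2 * zetaSubEta C₁ C₃ τ ^ 3) := by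
  rw [cubic, hitchinB, g₃_eq_of_notMem hω, solMuDen]
  field_simp
  ring

/-- This difference is Okamoto's shift: divided by e₂ - e₁ it is the reciprocal of the momentum
after the sign changes. -/
theorem solB_sub_hitchinB (hZ : zetaSubEta C₁ C₃ τ ≠ 0) (hd : solDen C₁ C₃ τ ≠ 0) :
    solB C₁ C₃ τ - hitchinB C₁ C₃ τ =
      solMuDen C₁ C₃ τ / (2 * zetaSubEta C₁ C₃ τ * solDen C₁ C₃ τ) := by
  rw [solB_eq_div, hitchinB]
  field_simp
  rw [solNum, solMuDen, solDen]
  ring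

theorem HitchinRegular.solMuDen_ne_zero (h : HitchinRegular C₁ C₃ τ) : solMuDen C₁ C₃ τ ≠ 0 := by
  obtain ⟨hω, hZ, hb⟩ := h
  rw [notBranchValue_iff, cubic_hitchinB hω hZ] at hb
  intro h
  simp [h] at hb

/-- The variable conjugate to Hitchin's solution. -/
def hitchinMu (C₁ C₃ : ℂ) (τ : ℍ) : ℂ :=
  2 * (e2 τ - e1 τ) * zetaSubEta C₁ C₃ τ * solDen C₁ C₃ τ / solMuDen C₁ C₃ τ
    + 1 / 2 / lamOf τ (hitchinB C₁ C₃ τ) + 1 / 2 / (lamOf τ (hitchinB C₁ C₃ τ) - 1)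
    + 1 / 2 / (lamOf τ (hitchinB C₁ C₃ τ) - modT τ)

theorem isHitchinMomentum_iff (h : HitchinRegular C₁ C₃ τ) (m : ℂ) :
    IsHitchinMomentum C₁ C₃ τ m ↔ m = hitchinMu C₁ C₃ τ := by
  have hM := h.solMuDen_ne_zero
  obtain ⟨hω, hZ, hb⟩ := h
  have hc := tpi_ne_zero
  have h0 := e2_sub_e1_ne_zero τ
  have ht := mul_ne_zero (modT_ne_zero τ) (modT_sub_one_ne_zero τ)
  have hC := cubic_hitchinB hω hZ
  rw [cubic_eq_prod] at hC
  obtain ⟨n1, n2, n3⟩ := hb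
  have n1 := sub_ne_zero.mpr n1
  have n2 := sub_ne_zero.mpr n2
  have n3 := sub_ne_zero.mpr n3
  rw [IsHitchinMomentum, (hasDerivAt_lamOf_hitchinB hω hZ).deriv, (hasDerivAt_modT τ).deriv]
  simp only [hitchinPoint]
  rw [(hasDerivAt_hamiltonian _ _ _ _ _ _ m).deriv, hitchinMu, lamOf_sub_one, lamOf_sub_modT]
  rw [lamOf]
  set b := hitchinB C₁ C₃ τ
  set E := e2 τ - e1 τ
  set M := solMuDen C₁ C₃ τ
  set Z := zetaSubEta C₁ C₃ τ
  set Q := (periods τ).derivWeierstrassP (om C₁ C₃ τ)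
  set d := solDen C₁ C₃ τ
  set u := b - e1 τ
  set v := b - e2 τ
  set w := b - e3 τ
  set T := modT τ * (modT τ - 1)
  -- The cubic at b^H eliminates ℘'(ω), so that u, v, w divide the whole equation.
  have hQ : Q = 8 * Z ^ 3 * (u * v * w) / M := by
    rw [eq_div_iff hM]
    rw [eq_div_iff (mul_ne_zero two_ne_zero (pow_ne_zero 3 hZ))] at hC
    linear_combination -hC
  -- The two sides of the Hamilton equation differ by a nonzero multiple of (claimed momentum - m),
  -- which gives both existence and uniqueness.
  have hm : (Q * d / Z ^ 2 + v * w + u * w + 3 * (u * v)) / E / tpi -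
      2 * E * T / tpi * ((2 * (u / E * (v / E) * (w / E)) * m -
        (1 / 2 * (v / E) * (w / E) + 1 / 2 * (u / E) * (w / E)
          + (1 / 2 - 1) * (u / E) * (v / E))) / T) =
      4 * (u * v * w) / (E ^ 2 * tpi) * (2 * E * Z * d / M + 1 / 2 / (u / E) + 1 / 2 / (v / E)
        + 1 / 2 / (w / E) - m) := by
    rw [hQ]
    field_simp
    ring
  have hne : 4 * (u * v * w) / (E ^ 2 * tpi) ≠ 0 :=
    div_ne_zero (mul_ne_zero (by norm_num) (mul_ne_zero (mul_ne_zero n1 n2) n3))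
      (mul_ne_zero (pow_ne_zero 2 h0) hc)
  rw [← sub_eq_zero, hm, mul_eq_zero, or_iff_right hne, sub_eq_zero, eq_comm]

theorem flip_mu_hitchinPoint (m : ℂ) (hm : m = hitchinMu C₁ C₃ τ) :
    (hitchinPoint C₁ C₃ τ m).flip0.flip1.flipt.mu =
      2 * (e2 τ - e1 τ) * zetaSubEta C₁ C₃ τ * solDen C₁ C₃ τ / solMuDen C₁ C₃ τ := by
  simp only [hitchinPoint, Point.flip0, Point.flip1, Point.flipt]
  rw [hm, hitchinMu]
  ring

theorem backlund_hitchinPoint (h : HitchinRegular C₁ C₃ τ) (hd : solDen C₁ C₃ τ ≠ 0) (m : ℂ)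
    (hm : IsHitchinMomentum C₁ C₃ τ m) :
    (hitchinPoint C₁ C₃ τ m).flip0.flip1.flipt.mu ≠ 0 ∧
    ∃ m' : ℂ, (hitchinPoint C₁ C₃ τ m).backlund =
      ⟨1 / 2, 1 / 2, 1 / 2, 3 / 2, modT τ, lamOf τ (solB C₁ C₃ τ), m'⟩ := by
  have hM := h.solMuDen_ne_zero
  have h0 := e2_sub_e1_ne_zero τ
  have hmu := flip_mu_hitchinPoint m ((isHitchinMomentum_iff h m).mp hm)
  constructor
  · rw [hmu]
    exact div_ne_zero (mul_ne_zero (mul_ne_zero (mul_ne_zero two_ne_zero h0) h.2.1) hd) hM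
  -- After the sign changes the finite parameters are -1/2 and κ_∞ = 1/2, so a = 1.
  · have ha : (hitchinPoint C₁ C₃ τ m).flip0.flip1.flipt.a = 1 := by
      simp only [hitchinPoint, Point.flip0, Point.flip1, Point.flipt, Point.a]
      norm_num
    have hlam : lamOf τ (hitchinB C₁ C₃ τ) + 1 /
        (2 * (e2 τ - e1 τ) * zetaSubEta C₁ C₃ τ * solDen C₁ C₃ τ / solMuDen C₁ C₃ τ) =
        lamOf τ (solB C₁ C₃ τ) := by
      have hs := solB_sub_hitchinB (C₁ := C₁) (C₃ := C₃) h.2.1 hd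
      have hZ := h.2.1
      rw [show solB C₁ C₃ τ = hitchinB C₁ C₃ τ + solMuDen C₁ C₃ τ /
        (2 * zetaSubEta C₁ C₃ τ * solDen C₁ C₃ τ) by rw [← hs]; ring, lamOf, lamOf]
      field_simp
      ring
    refine ⟨(hitchinPoint C₁ C₃ τ m).backlund.mu, ?_⟩
    rw [← hlam, ← hmu, Point.backlund, Point.okamoto, ha]
    simp only [hitchinPoint, Point.flip0, Point.flip1, Point.flipt, Point.mk.injEq, and_true]
    norm_num

end

end PVI

end
theorem mainTheorem7 :
    -- the Hermite-Krichever formulas and their inversion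
    (∀ (τ : UpperHalfPlane) (b μ : ℂ), PVI.NotBranchValue τ b → PVI.hkQ τ b μ ≠ 0 →
      (∃ α κ : ℂ, α ∉ (PVI.periods τ).lattice ∧ PVI.IsHermiteKrichever τ b μ α κ) ∧
      ∀ α κ : ℂ, α ∉ (PVI.periods τ).lattice →
        (PVI.IsHermiteKrichever τ b μ α κ ↔
          ∃ s : ℂ, s ^ 2 = -PVI.hkQ τ b μ ∧ PVI.HKFormulas τ b μ s α κ) ∧
        (PVI.IsHermiteKrichever τ b μ α κ →
          PVI.invDenB τ α κ ≠ 0 ∧ PVI.invDenMu τ α κ ≠ 0 ∧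
          b = PVI.invB τ α κ ∧ μ = PVI.invMu τ α κ)) ∧
    ∀ C₁ C₃ : ℂ,
      -- the explicit function is the inversion at `α = -ω`, `κ = ζ(ω) - η`
      (∀ τ : UpperHalfPlane, PVI.SolRegular C₁ C₃ τ →
        PVI.solB C₁ C₃ τ = PVI.invB τ (-PVI.om C₁ C₃ τ) (PVI.zetaSubEta C₁ C₃ τ) ∧
        PVI.invDenMu τ (-PVI.om C₁ C₃ τ) (PVI.zetaSubEta C₁ C₃ τ) ≠ 0 ∧
        PVI.hkQ τ (PVI.solB C₁ C₃ τ)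
          (PVI.invMu τ (-PVI.om C₁ C₃ τ) (PVI.zetaSubEta C₁ C₃ τ)) ≠ 0 ∧
        PVI.IsHermiteKrichever τ (PVI.solB C₁ C₃ τ)
          (PVI.invMu τ (-PVI.om C₁ C₃ τ) (PVI.zetaSubEta C₁ C₃ τ))
          (-PVI.om C₁ C₃ τ) (PVI.zetaSubEta C₁ C₃ τ)) ∧
      -- local solvability of `℘(δ₁) = b₁`, and the sixth Painlevé equation for `δ₁`
      (∀ τ : UpperHalfPlane, PVI.SolRegular C₁ C₃ τ →
        ∃ (U : Set ℂ) (δ : ℂ → ℂ), (τ : ℂ) ∈ U ∧ PVI.IsDelta C₁ C₃ U δ) ∧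
      (∀ (U : Set ℂ) (δ : ℂ → ℂ), PVI.IsDelta C₁ C₃ U δ →
        PVI.SolvesEllipticPVI (1 / 2) (1 / 2) (1 / 2) (3 / 2) U δ) ∧
      -- agreement with the Bäcklund transform of Hitchin's solution
      (∀ τ : UpperHalfPlane, PVI.HitchinRegular C₁ C₃ τ → PVI.solDen C₁ C₃ τ ≠ 0 →
        (∃! m : ℂ, PVI.IsHitchinMomentum C₁ C₃ τ m) ∧
        ∀ m : ℂ, PVI.IsHitchinMomentum C₁ C₃ τ m →
          (PVI.hitchinPoint C₁ C₃ τ m).flip0.flip1.flipt.mu ≠ 0 ∧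
          ∃ m' : ℂ, (PVI.hitchinPoint C₁ C₃ τ m).backlund =
            ⟨1 / 2, 1 / 2, 1 / 2, 3 / 2, PVI.modT τ,
              PVI.lamOf τ (PVI.solB C₁ C₃ τ), m'⟩) := by
  refine ⟨fun τ b μ hb hQ => ⟨PVI.exists_isHermiteKrichever τ hb hQ, fun α κ hα =>
      ⟨PVI.isHermiteKrichever_iff_formulas τ hb hQ κ hα,
        PVI.inversion_of_isHermiteKrichever τ hb hQ hα⟩⟩,
    fun C₁ C₃ => ⟨fun τ h => ?_, fun τ h => PVI.exists_isDelta h,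
      fun U δ h => h.solvesEllipticPVI, fun τ h hd => ⟨?_, PVI.backlund_hitchinPoint h hd⟩⟩⟩
  · rw [PVI.invB_neg_om, PVI.invDenMu_neg_om, PVI.invMu_neg_om]
    exact ⟨rfl, PVI.solMuDen_ne_zero h,
      PVI.isHermiteKrichever_solB h.1 h.2.1 (PVI.solMuDen_ne_zero h)⟩
  · exact ⟨PVI.hitchinMu C₁ C₃ τ, (PVI.isHitchinMomentum_iff h _).mpr rfl,
      fun m hm => (PVI.isHitchinMomentum_iff h m).mp hm⟩
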